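/- Let $k$ be a field of characteristic $0$ with algebraic closure $\overline{k}$, and let $F/k(T)$ be a finite Galois extension with group $G$ that is $k$-regular (i.e. $F\cap\overline{k}=k$). Let $\mathbf{t}\subset\mathbb{P}^1(\overline{k})$ be its branch point set, i.e. the set of points of $\mathbb{P}^1(\overline k)$ that ramify in $F\overline{k}/\overline{k}(T)$, and let $r=|\mathbf{t}|$. Assume that one of the following conditions holds: (1) $G$ is cyclic of even order, $r=2$, and $\mathbf{t}\subset\mathbb{P}^1(k)$; (2) $G$ is cyclic of odd order and $r=2$; (3) $G$ is dihedral of order $2n$ for some odd $n>1$, $r=3$, and $\mathbf{t}\subset\mathbb{P}^1(k)$. For a field extension $L/k$ and $t_0\in\mathbb{P}^1(L)$, let $FL$ denote the compositum of $F$ and $L(T)$ in an algebraic closure of $L(T)$, and let $(FL)_{t_0}/L$ denote the specialization of $FL/L(T)$ at $t_0$: the residue extension at any prime ideal lying over $\langle T-t_0\rangle$ of the integral closure of $L[T]$ in $FL$ (if $t_0=\infty$, use $L[1/T]$ and $\langle 1/T\rangle$ instead). Then $F/k(T)$ is generic, i.e. for every field extension $L/k$, every Galois extension $E/L$ with group isomorphic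 to $G$ is of the form $E=(FL)_{t_0}$ for some $t_0\in\mathbb{P}^1(L)$. More precisely, for every field extension $L/k$ and every finite Galois extension $E/L$ whose group is isomorphic to a subgroup of $G$, one has $E=(FL)_{t_0}$ (as extensions of $L$, up to $L$-isomorphism) for infinitely many points $t_0\in\mathbb{P}^1(L)$. -/

import Mathlib

open scoped OnePoint

universe u₁ u₂ v w

namespace RegExt

/-! The projective line `ℙ¹(K)` is Mathlib's `OnePoint K`, and `K(T)` is `RatFunc K`. -/

section Points

variable {K : Type*} [Field K]

/-- The standard uniformizer of `K(T)` at a point of `ℙ¹(K)`: `T - t` at `t ∈ K`, and `1/T` at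
infinity. -/
noncomputable def unif : OnePoint K → RatFunc K
  | ∞ => (RatFunc.X)⁻¹
  | (t : K) => RatFunc.X - RatFunc.C t

/-- The coordinate ring of the standard affine chart around a point of `ℙ¹(K)`:
`K[T - t] = K[T]` at `t ∈ K`, and `K[1/T]` at infinity. -/
noncomputable def chart (t : OnePoint K) : Subalgebra K (RatFunc K) :=
  Algebra.adjoin K {unif t}

/-- The prime ideal of the point `t` in its chart: `⟨T - t⟩ ⊆ K[T]`, or `⟨1/T⟩ ⊆ K[1/T]`. -/
noncomputable def pointIdeal (t : OnePoint K) : Ideal (chart t) :=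
  Ideal.span {⟨unif t, Algebra.subset_adjoin rfl⟩}

end Points

section Extensions

variable {K : Type*} [Field K]
  (M : Type*) [Field M] [Algebra (RatFunc K) M] [Algebra K M] [IsScalarTower K (RatFunc K) M]

/-- The integral closure in `M` of the coordinate ring of the chart around `t`. -/
noncomputable def chartClosure (t : OnePoint K) : Subalgebra (chart t) M :=
  integralClosure (chart t) M

/-- The inclusion of the chart into its integral closure. -/
noncomputable instance (t : OnePoint K) : Algebra (chart t) (chartClosure M t) :=
  Subalgebra.algebra (chartClosure M t)

/-- The inclusion of the constants `K` into the integral closure of the chart. -/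
noncomputable instance (t : OnePoint K) : Algebra K (chartClosure M t) :=
  Subalgebra.algebra' (chartClosure M t)

/-- The extension `M / K(T)` is ramified over the point `t`. -/
def IsRamifiedOver (t : OnePoint K) : Prop :=
  ∃ P : Ideal (chartClosure M t), P.IsPrime ∧ P.LiesOver (pointIdeal t) ∧
    1 < Ideal.ramificationIdx' (pointIdeal t) P

/-- `E / K` is (isomorphic to) the specialized extension `M_t / K` of the Galois extension
`M / K(T)` at `t ∈ ℙ¹(K)`, that is, the residue extension at a prime above `t`. (The primes above
`t` are conjugate, so their residue extensions are isomorphic.) -/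
def IsSpecializationAt (t : OnePoint K) (E : Type*) [Field E] [Algebra K E] : Prop :=
  ∃ P : Ideal (chartClosure M t), P.IsPrime ∧ P.LiesOver (pointIdeal t) ∧
    Nonempty (E ≃ₐ[K] (chartClosure M t ⧸ P))

end Extensions

section BaseChange

variable (k : Type*) [Field k]

/-- The inclusion `k(T) → L(T)` attached to a field extension `L / k`. -/
noncomputable def ratFuncMap (L : Type*) [Field L] [Algebra k L] : RatFunc k →+* RatFunc L :=
  RatFunc.mapRingHom (Polynomial.mapRingHom (algebraMap k L))
    (nonZeroDivisors_le_comap_nonZeroDivisors_of_injective _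
      (Polynomial.map_injective _ (algebraMap k L).injective))

variable (F : Type*) [Field F] [Algebra (RatFunc k) F]

/-- For a Galois extension `F / k(T)` and a field extension `L / k`, the compositum `FL` of `F` and
`L(T)` in an algebraic closure `Ω` of `L(T)`: it is generated over `L(T)` by the images of the
embeddings `F → Ω` that extend `k(T) → L(T)`. (As `F / k(T)` is Galois, these embeddings have one
and the same image.) -/
noncomputable def compositum (L : Type*) [Field L] [Algebra k L] :
    IntermediateField (RatFunc L) (AlgebraicClosure (RatFunc L)) :=
  IntermediateField.adjoin (RatFunc L)
    {y | ∃ σ : F →+* AlgebraicClosure (RatFunc L),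
      σ.comp (algebraMap (RatFunc k) F) =
        (algebraMap (RatFunc L) (AlgebraicClosure (RatFunc L))).comp (ratFuncMap k L) ∧
      y ∈ σ.range}

/-- The branch point set of the `k`-regular Galois extension `F / k(T)`: the set of points of
`ℙ¹` over the algebraic closure of `k` that ramify in `F k̄ / k̄(T)`. -/
noncomputable def branchPoints : Set (OnePoint (AlgebraicClosure k)) :=
  {t | IsRamifiedOver (compositum k F (AlgebraicClosure k)) t}

/-- All branch points of `F / k(T)` are `k`-rational, i.e. contained in `ℙ¹(k)`. -/
def BranchPointsRational : Prop :=
  branchPoints k F ⊆ Set.range (OnePoint.map (algebraMap k (AlgebraicClosure k)))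

/-- `F / k(T)` is `L`-parametric: every Galois extension of `L` with the same group as `F / k(T)`
is the specialization of `FL / L(T)` at some point of `ℙ¹(L)`. -/
def IsParametric (L : Type*) [Field L] [Algebra k L] : Prop :=
  ∀ (E : Type w) [Field E] [Algebra L E] [FiniteDimensional L E] [IsGalois L E],
    Nonempty ((E ≃ₐ[L] E) ≃* (F ≃ₐ[RatFunc k] F)) →
      ∃ t : OnePoint L, IsSpecializationAt (compositum k F L) t E

/-- `F / k(T)` is generic: it is `L`-parametric for every field extension `L / k`. -/
def IsGeneric : Prop :=
  ∀ (L : Type v) [Field L] [Algebra k L], IsParametric.{w} k F L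

end BaseChange

end RegExt

/-!
The extension `F / k(T)` turns out to be a *linear* action on a rational function field: there are
`v₀`, `v₁` in `F` with `F = k(v₀ / v₁)` whose `k`-span is stable under `G = Gal(F/k(T))`
(`HasLinearCoordinate`). This property alone gives the specializations, and the hypotheses on the
group and on the branch points serve only to establish it.

*From a linear coordinate to specializations* (`HasLinearCoordinate.infinite_specializations`).
An injection `Gal(E/L) → G` turns the plane spanned by `v₀` and `v₁` into a two-dimensional
representation of `Gal(E/L)` over `L`. By Hilbert's Theorem 90 for `GL₂`, or rather by the
independence of characters behind it, there are infinitely many `x₀ = w₀ / w₁` in `E` on which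
`Gal(E/L)` acts by the same fractional linear substitutions as on the coordinate `x = v₀ / v₁`.
Writing `T = R(x)`, the value `t₀ = R(x₀)` is then invariant, hence lies in `L`. Away from finitely
many fixed points `x₀` has as many conjugates as `E / L` has automorphisms, so `E = L(x₀)`, and
`x ↦ x₀` identifies `E` with the residue field of `F L = L(x)` at a prime over `t₀`.

*From the branch points to a linear coordinate* (`hasLinearCoordinate_of_branchPoints`). Let `K` be
the algebraic closure of `k` and `M = F K`. At an unramified point `t`, a uniformizer of `K(T)` is
one of `M`, for a discrete valuation trivial on `K`; this is all that is used of ramification.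
* If `M / K(T)` is cyclic with two branch points, Kummer theory and these valuations show
  `M = K(y)` with `y ^ m` the coordinate `S` whose zero and pole are the branch points
  (`exists_pow_eq_of_isCyclic`). The automorphisms of an algebraic closure of `K(T)` over `k(T)`
  multiply `y` by constants if the branch points are rational; if they interchange the branch points
  they map `y` to a constant multiple of `1 / y`.
* If the group is dihedral, the quadratic subextension is `K(s)`, where `s ^ 2` is a coordinate with
  zero and pole at two of the three branch points, and takes a value `β ^ 2` at the third. Above it
  `M = K(y)` with `y ^ m = (s - β) / (s + β)` (`exists_pow_eq_of_dihedral`), and again automorphisms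
  map `y` to constant multiples of `y` or `1 / y`.

If `y` is only scaled, the plane spanned by `y` and `1` is stable. If `y` can be inverted but `m` is
odd, say `m = 2 j + 1`, one takes the plane spanned by `y ^ (j + 1) + y ^ (-j)` and
`y ^ j + y ^ (-(j + 1))`, whose ratio is `y`: an `m`-th root of unity `c` acts on it through its
square root `c ^ (j + 1)`. By regularity the stable plane over `K` has a basis in `F`
(`exists_basis_of_stable_plane`), and this is the linear coordinate.
-/

namespace RegExt

open Polynomial

/-! ### The affine charts of the projective line -/

section Charts

variable {K : Type*} [Field K]

theorem unif_coe (t : K) : unif (t : OnePoint K) = RatFunc.X - RatFunc.C t := rfl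

theorem unif_infty : unif (∞ : OnePoint K) = (RatFunc.X : RatFunc K)⁻¹ := rfl

theorem transcendental_unif (t : OnePoint K) : Transcendental K (unif t) := by
  intro h
  apply RatFunc.transcendental_X (K := K)
  induction t using OnePoint.rec with
  | infty => simpa [unif_infty] using h.inv
  | coe t =>
    have := h.add (isAlgebraic_algebraMap (R := K) (A := RatFunc K) t)
    simpa [unif_coe, RatFunc.algebraMap_eq_C] using this

/-- The chart around a point is a polynomial ring in the uniformizer. -/
noncomputable def chartEquiv (t : OnePoint K) : K[X] ≃ₐ[K] chart t :=
  algEquivOfTranscendental K (unif t) (transcendental_unif t)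

theorem coe_chartEquiv (t : OnePoint K) (p : K[X]) :
    (chartEquiv t p : RatFunc K) = aeval (unif t) p := by
  exact (aeval_algHom_apply (chart t).val ⟨unif t, Algebra.subset_adjoin rfl⟩ p).symm

theorem pointIdeal_eq_map (t : OnePoint K) :
    pointIdeal t = (Ideal.span {(X : K[X])}).map (chartEquiv t) := by
  rw [Ideal.map_span, Set.image_singleton, pointIdeal]
  congr 2
  ext
  simp [coe_chartEquiv]

instance (t : OnePoint K) : (pointIdeal t).IsMaximal := by
  rw [pointIdeal_eq_map]
  have : (Ideal.span {(X : K[X])}).IsMaximal :=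
    PrincipalIdealRing.isMaximal_of_irreducible Polynomial.irreducible_X
  exact Ideal.map_isMaximal_of_equiv (chartEquiv t)

instance (t : OnePoint K) : IsPrincipalIdealRing (chart t) :=
  IsPrincipalIdealRing.of_surjective (chartEquiv t).toRingEquiv.toRingHom (chartEquiv t).surjective

/-- The rational function field is the fraction field of each chart. -/
instance (t : OnePoint K) : IsFractionRing (chart t) (RatFunc K) := by
  have hX : (RatFunc.X : RatFunc K) ∈ IntermediateField.adjoin K {unif t} := by
    have h := IntermediateField.mem_adjoin_simple_self K (unif t)
    induction t using OnePoint.rec with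
    | infty => simpa [unif_infty] using inv_mem h
    | coe t =>
      have := add_mem h ((IntermediateField.adjoin K {unif (t : OnePoint K)}).algebraMap_mem t)
      simpa [unif_coe, RatFunc.algebraMap_eq_C] using this
  have htop : IntermediateField.adjoin K {unif t} = ⊤ := by
    rw [eq_top_iff, ← RatFunc.adjoin_X, IntermediateField.adjoin_simple_le_iff]
    exact hX
  refine IsFractionRing.of_field _ _ fun z ↦ ?_
  have hz : z ∈ IntermediateField.adjoin K {unif t} := htop ▸ trivial
  obtain ⟨r, s, rfl⟩ := IntermediateField.mem_adjoin_simple_iff K z |>.1 hz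
  exact ⟨chartEquiv t r, chartEquiv t s, by simp [← coe_chartEquiv]⟩

end Charts

/-! ### Discrete valuations over unramified points -/

section Valuation

variable {K : Type*} [Field K]
  (M : Type*) [Field M] [Algebra (RatFunc K) M] [Algebra K M] [IsScalarTower K (RatFunc K) M]
  [FiniteDimensional (RatFunc K) M] [Algebra.IsSeparable (RatFunc K) M]

open WithZero in
/-- Over an unramified point `t` the field `M` has a discrete valuation for which the uniformizer
of `K(T)` at `t` is still a uniformizer. -/
theorem exists_valuation_of_not_isRamifiedOver {t : OnePoint K} (ht : ¬ IsRamifiedOver M t) :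
    ∃ v : Valuation M (WithZero (Multiplicative ℤ)),
      (∀ a : K, a ≠ 0 → v (algebraMap K M a) = 1) ∧
      v (algebraMap (RatFunc K) M (unif t)) = exp (-1 : ℤ) := by
  have : IsDedekindDomain (chartClosure M t) :=
    integralClosure.isDedekindDomain (chart t) (RatFunc K) M
  have : IsFractionRing (integralClosure (chart t) M) M :=
    integralClosure.isFractionRing_of_finite_extension (A := chart t) (RatFunc K) M
  have : IsFractionRing (chartClosure M t) M := this
  have : Algebra.IsIntegral (chart t) (chartClosure M t) :=
    inferInstanceAs (Algebra.IsIntegral (chart t) (integralClosure (chart t) M))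
  have hinj : Function.Injective (algebraMap (chart t) (chartClosure M t)) := by
    intro a b hab
    have := congrArg (fun x : chartClosure M t ↦ (x : M)) hab
    exact Subtype.ext ((algebraMap (RatFunc K) M).injective this)
  obtain ⟨P, hPmax, hP⟩ := Ideal.exists_ideal_over_maximal_of_isIntegral
    (S := chartClosure M t) (pointIdeal t) (by
      rw [(RingHom.injective_iff_ker_eq_bot _).1 hinj]; exact bot_le)
  have hlies : P.LiesOver (pointIdeal t) := ⟨hP.symm⟩
  let π : chart t := ⟨unif t, Algebra.subset_adjoin rfl⟩
  have hπ0 : π ≠ 0 := fun h ↦ by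
    have h0 : unif t = 0 := congrArg Subtype.val h
    exact transcendental_unif t (h0 ▸ isAlgebraic_zero)
  have hmap : (pointIdeal t).map (algebraMap (chart t) (chartClosure M t)) =
      Ideal.span {algebraMap _ _ π} := by
    rw [pointIdeal, Ideal.map_span, Set.image_singleton]
  have hπP : algebraMap (chart t) (chartClosure M t) π ∈ P := by
    have : π ∈ Ideal.comap (algebraMap (chart t) (chartClosure M t)) P := by
      rw [hP]; exact Ideal.subset_span rfl
    exact this
  have hA0 : algebraMap (chart t) (chartClosure M t) π ≠ 0 := fun h ↦
    hπ0 (hinj (h.trans (map_zero _).symm))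
  have hP0 : P ≠ ⊥ := fun h ↦ hA0 (by rw [h] at hπP; exact hπP)
  have hπP2 : algebraMap (chart t) (chartClosure M t) π ∉ P ^ 2 := by
    intro h2
    apply ht
    refine ⟨P, hPmax.isPrime, hlies, ?_⟩
    have hne : (pointIdeal t).map (algebraMap (chart t) (chartClosure M t)) ≠ ⊥ := by
      rwa [hmap, Ne, Ideal.span_singleton_eq_bot]
    rw [Ideal.IsDedekindDomain.ramificationIdx'_eq_multiplicity hne hPmax.isPrime]
    have hdvd : P ^ 2 ∣ (pointIdeal t).map (algebraMap (chart t) (chartClosure M t)) := by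
      rw [Ideal.dvd_iff_le, hmap, Ideal.span_singleton_le_iff_mem]
      exact h2
    have hfin : FiniteMultiplicity P
        ((pointIdeal t).map (algebraMap (chart t) (chartClosure M t))) :=
      FiniteMultiplicity.of_prime_left (Ideal.prime_of_isPrime hP0 hPmax.isPrime) hne
    exact hfin.le_multiplicity_of_pow_dvd hdvd
  let w : IsDedekindDomain.HeightOneSpectrum (chartClosure M t) := ⟨P, hPmax.isPrime, hP0⟩
  refine ⟨w.valuation M, fun a ha ↦ ?_, ?_⟩
  · have h1 : ∀ b : K, w.valuation M (algebraMap K M b) ≤ 1 := fun b ↦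
      w.valuation_le_one (K := M) (algebraMap K (chartClosure M t) b)
    refine le_antisymm (h1 a) ?_
    have h2 := h1 a⁻¹
    rw [map_inv₀, map_inv₀] at h2
    exact (inv_le_one₀ (zero_lt_iff.2 (by simpa using ha))).1 h2
  · have he : algebraMap (RatFunc K) M (unif t) =
        algebraMap (chartClosure M t) M (algebraMap (chart t) (chartClosure M t) π) := rfl
    rw [he, w.valuation_of_algebraMap]
    have h1 := (w.intValuation_le_pow_iff_mem (algebraMap (chart t) (chartClosure M t) π) 1).2
      (by simpa [w] using hπP)
    have h2 := mt (w.intValuation_le_pow_iff_mem (algebraMap (chart t) (chartClosure M t) π) 2).1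
      (by simpa [w] using hπP2)
    have h0 := w.intValuation_ne_zero _ hA0
    rw [← exp_log h0] at h1 h2 ⊢
    rw [exp_le_exp] at h1 h2
    congr 1
    push_cast at h1 h2
    omega

end Valuation

/-! ### Residue extensions of a rational function field -/

section Specialization

variable {L : Type*} [Field L]
  {M : Type*} [Field M] [Algebra (RatFunc L) M] [Algebra L M] [IsScalarTower L (RatFunc L) M]
  {E : Type*} [Field E] [Algebra L E] [FiniteDimensional L E]

/-- The residue extension of a rational function field `M = L(x)` over `L(T)` at a point `t₀`: if
`T = p(x) / q(x)` and `x₀` generates `E` over `L` with `p(x₀) / q(x₀) = t₀`, then evaluation at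
`x₀` identifies the specialization at `t₀` with `E`. The condition on the coefficients of degree
`d` says that the pole of `x` does not lie over `t₀`. -/
theorem isSpecializationAt_of_eval {x : M} (hx : Transcendental L x)
    (htop : IntermediateField.adjoin L {x} = ⊤) {p q : L[X]}
    (hT : algebraMap (RatFunc L) M RatFunc.X * aeval x q = aeval x p)
    {x₀ : E} (hE : IntermediateField.adjoin L {x₀} = ⊤) {t₀ : L} (hq : aeval x₀ q ≠ 0)
    (ht : aeval x₀ p = algebraMap L E t₀ * aeval x₀ q)
    {d : ℕ} (hpd : p.natDegree ≤ d) (hqd : q.natDegree ≤ d)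
    (hd : p.coeff d - t₀ * q.coeff d ≠ 0) :
    IsSpecializationAt M (t₀ : OnePoint L) E := by
  -- the local ring of the `x`-line at `x₀`, with its embedding into `M` and evaluation in `E`
  let 𝔭 : Ideal L[X] := RingHom.ker (aeval x₀ : L[X] →ₐ[L] E)
  have h𝔭 : 𝔭.IsPrime := RingHom.ker_isPrime _
  let O := Localization.AtPrime 𝔭
  have hmem : ∀ s : 𝔭.primeCompl, aeval x₀ (s : L[X]) ≠ 0 := fun s hs ↦ s.2 hs
  have hne : ∀ s : L[X], s ≠ 0 → aeval x s ≠ 0 := fun s hs h ↦ hx ⟨s, hs, h⟩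
  have hne' : ∀ s : 𝔭.primeCompl, (s : L[X]) ≠ 0 := fun s hs ↦ hmem s (by rw [hs, map_zero])
  let f : O →ₐ[L] M := IsLocalization.liftAlgHom (M := 𝔭.primeCompl) (f := aeval x)
    (fun s ↦ (hne _ (hne' s)).isUnit)
  let g : O →ₐ[L] E := IsLocalization.liftAlgHom (M := 𝔭.primeCompl) (f := aeval x₀)
    (fun s ↦ (hmem s).isUnit)
  have hf : ∀ a : L[X], f (algebraMap L[X] O a) = aeval x a := fun a ↦ by
    simp [f, IsLocalization.liftAlgHom_apply]
  have hg : ∀ a : L[X], g (algebraMap L[X] O a) = aeval x₀ a := fun a ↦ by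
    simp [g, IsLocalization.liftAlgHom_apply]
  have hfinj : Function.Injective f := by
    rw [injective_iff_map_eq_zero]
    intro o ho
    obtain ⟨a, s, rfl⟩ := IsLocalization.exists_mk'_eq 𝔭.primeCompl o
    have h1 : f (IsLocalization.mk' O a s) * f (algebraMap L[X] O s) = aeval x a := by
      rw [← map_mul, IsLocalization.mk'_spec, hf]
    rw [ho, zero_mul] at h1
    have : a = 0 := by
      by_contra h
      exact hne a h h1.symm
    rw [this, IsLocalization.mk'_zero]
  have : IsIntegrallyClosed O :=
    isIntegrallyClosed_of_isLocalization O 𝔭.primeCompl 𝔭.primeCompl_le_nonZeroDivisors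
  let _ : Algebra O M := f.toRingHom.toAlgebra
  have hOM : ∀ o : O, algebraMap O M o = f o := fun _ ↦ rfl
  have : FaithfulSMul O M := (faithfulSMul_iff_algebraMap_injective O M).2 hfinj
  have : IsFractionRing O M := by
    refine IsFractionRing.of_field _ _ fun z ↦ ?_
    have hz : z ∈ IntermediateField.adjoin L {x} := htop ▸ trivial
    obtain ⟨r, s, rfl⟩ := IntermediateField.mem_adjoin_simple_iff L z |>.1 hz
    exact ⟨algebraMap _ _ r, algebraMap _ _ s, by rw [hOM, hOM, hf, hf]⟩
  -- the function `T - t₀` belongs to the local ring and vanishes at `x₀`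
  let qs : 𝔭.primeCompl := ⟨q, hq⟩
  let o : O := IsLocalization.mk' O (p - C t₀ * q) qs
  have ho : o * algebraMap L[X] O q = algebraMap L[X] O (p - C t₀ * q) :=
    IsLocalization.mk'_spec O (p - C t₀ * q) qs
  have hfo : f o = algebraMap (RatFunc L) M (unif (t₀ : OnePoint L)) := by
    have h1 := congrArg f ho
    rw [map_mul, hf, hf] at h1
    apply mul_right_cancel₀ (hne q (fun h ↦ hq (by rw [h, map_zero])))
    rw [h1, unif_coe, map_sub, map_sub (algebraMap (RatFunc L) M), sub_mul, hT,
      ← RatFunc.algebraMap_eq_C, ← IsScalarTower.algebraMap_apply]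
    simp
  have hgo : g o = 0 := by
    have h1 := congrArg g ho
    rw [map_mul, hg, hg] at h1
    apply mul_right_cancel₀ hq
    rw [h1]
    simp [ht]
  let j : chart (t₀ : OnePoint L) →ₐ[L] O := (aeval o).comp (chartEquiv _).symm.toAlgHom
  have hj : ∀ c : chart (t₀ : OnePoint L), f (j c) = algebraMap (RatFunc L) M c := by
    intro c
    obtain ⟨r, rfl⟩ := (chartEquiv (t₀ : OnePoint L)).surjective c
    rw [coe_chartEquiv]
    simp only [j, AlgHom.comp_apply, AlgEquiv.toAlgHom_apply, AlgEquiv.symm_apply_apply]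
    rw [← aeval_algHom_apply, hfo, aeval_algebraMap_apply]
  let π : chart (t₀ : OnePoint L) := ⟨unif (t₀ : OnePoint L), Algebra.subset_adjoin rfl⟩
  have hjπ : j π = o := hfinj (by rw [hj, hfo])
  -- integrality over the chart forces membership in the local ring
  let ι : chartClosure M (t₀ : OnePoint L) →ₐ[L] M :=
    { (chartClosure M (t₀ : OnePoint L)).val.toRingHom with commutes' := fun _ ↦ rfl }
  have hιmem : ∀ a, ι a ∈ f.range := by
    intro a
    have ha : IsIntegral (chart (t₀ : OnePoint L)) (ι a) := a.2
    have : IsIntegral O (ι a) := ha.map_of_comp_eq j.toRingHom (RingHom.id M)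
      (RingHom.ext fun c ↦ hj c)
    obtain ⟨y, hy⟩ := IsIntegrallyClosed.isIntegral_iff.1 this
    exact ⟨y, hy⟩
  let e := AlgEquiv.ofInjective f hfinj
  let φ : chartClosure M (t₀ : OnePoint L) →ₐ[L] E :=
    (g.comp e.symm.toAlgHom).comp (ι.codRestrict f.range hιmem)
  have hφ : ∀ (a : chartClosure M (t₀ : OnePoint L)) (b : O), (a : M) = f b → φ a = g b := by
    intro a b hab
    have : ι.codRestrict f.range hιmem a = e b := Subtype.ext hab
    simp only [φ, AlgHom.comp_apply, this, AlgEquiv.toAlgHom_apply, AlgEquiv.symm_apply_apply]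
  have hφsurj : Function.Surjective φ := by
    rw [← AlgHom.range_eq_top, eq_top_iff]
    have halg : IsAlgebraic L x₀ := Algebra.IsAlgebraic.isAlgebraic x₀
    have h1 : Algebra.adjoin L {x₀} = ⊤ := by
      rw [← IntermediateField.adjoin_simple_toSubalgebra_of_isAlgebraic halg, hE,
        IntermediateField.top_toSubalgebra]
    rw [← h1, Algebra.adjoin_le_iff, Set.singleton_subset_iff]
    -- clearing the leading coefficient of `p - T q` makes `x` integral over the chart
    let τ : chart (t₀ : OnePoint L) := π + algebraMap L _ t₀
    have hjτ : j τ = o + algebraMap L O t₀ := by simp only [τ, map_add, hjπ, AlgHom.commutes]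
    let Ψ : (chart (t₀ : OnePoint L))[X] :=
      p.map (algebraMap L _) - C τ * q.map (algebraMap L _)
    have hcoeff : g (j (Ψ.coeff d)) = algebraMap L E (p.coeff d - t₀ * q.coeff d) := by
      simp [Ψ, hjτ, hgo]
    have hΨd : Ψ.coeff d ≠ 0 := fun h ↦ by
      rw [h, map_zero, map_zero] at hcoeff
      exact hd ((algebraMap L E).injective (hcoeff.symm.trans (map_zero _).symm))
    have hdeg : Ψ.natDegree = d := by
      refine le_antisymm ?_ (le_natDegree_of_ne_zero hΨd)
      refine (natDegree_sub_le _ _).trans (max_le ((natDegree_map_le).trans hpd) ?_)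
      exact (natDegree_C_mul_le _ _).trans ((natDegree_map_le).trans hqd)
    have hτM : algebraMap (chart (t₀ : OnePoint L)) M τ = algebraMap (RatFunc L) M RatFunc.X := by
      have : (τ : RatFunc L) = RatFunc.X := by
        change unif (t₀ : OnePoint L) + algebraMap L (RatFunc L) t₀ = _
        rw [unif_coe, RatFunc.algebraMap_eq_C, sub_add_cancel]
      exact congrArg (algebraMap (RatFunc L) M) this
    have hΨ : aeval x Ψ = 0 := by
      simp only [Ψ, map_sub, map_mul, aeval_C, aeval_map_algebraMap, hτM, hT, sub_self]
    have hint := isIntegral_leadingCoeff_smul Ψ x hΨ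
    rw [leadingCoeff, hdeg] at hint
    have h2 : φ ⟨_, hint⟩ = g (j (Ψ.coeff d) * algebraMap L[X] O X) := by
      apply hφ
      rw [map_mul, hj, hf, aeval_X]
      exact Algebra.smul_def (Ψ.coeff d) x
    rw [map_mul, hcoeff, hg, aeval_X, ← Algebra.smul_def] at h2
    have h3 := φ.range.smul_mem ⟨_, h2⟩ (p.coeff d - t₀ * q.coeff d)⁻¹
    rwa [smul_smul, inv_mul_cancel₀ hd, one_smul] at h3
  refine ⟨RingHom.ker φ, RingHom.ker_isPrime _, ⟨?_⟩,
    ⟨(Ideal.quotientKerAlgEquivOfSurjective hφsurj).symm⟩⟩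
  have hprime : (RingHom.ker φ).IsPrime := RingHom.ker_isPrime _
  refine Ideal.IsMaximal.eq_of_le inferInstance
    (Ideal.IsPrime.under (chart (t₀ : OnePoint L)) (RingHom.ker φ)).ne_top ?_
  rw [pointIdeal, Ideal.span_singleton_le_iff_mem]
  change φ (algebraMap (chart (t₀ : OnePoint L)) (chartClosure M (t₀ : OnePoint L)) π) = 0
  rw [← hgo]
  exact hφ _ _ hfo.symm

end Specialization

/-! ### Rational points of twisted projective lines -/

section Twist

variable {L : Type*} [Field L] {E : Type*} [Field E] [Algebra L E] [FiniteDimensional L E]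

/-- Hilbert's Theorem 90 for `GL₂`, in the form that a two-dimensional `L`-representation `A` of
`Gal(E/L)` has equivariant maps to `E` not contained in a given `E`-hyperplane: averages of a
coordinate function avoid the hyperplane by the independence of characters. -/
theorem exists_equivariant_ne_zero (A : Gal(E/L) → Matrix (Fin 2) (Fin 2) L) (h1 : A 1 = 1)
    (hmul : ∀ σ τ, A (σ * τ) = A σ * A τ) (e : Fin 2 → E) (he : e ≠ 0) :
    ∃ w : Fin 2 → E, (∀ σ : Gal(E/L), ∀ j, σ (w j) = ∑ i, algebraMap L E (A σ i j) * w i) ∧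
      ∑ j, e j * w j ≠ 0 := by
  by_contra! hcon
  apply he
  ext i
  let w : E → Fin 2 → E := fun c j ↦ ∑ σ : Gal(E/L), σ⁻¹ c * algebraMap L E (A σ i j)
  have hw : ∀ c, ∀ τ : Gal(E/L), ∀ j,
      τ (w c j) = ∑ l, algebraMap L E (A τ l j) * w c l := by
    intro c τ j
    have : ∑ l, algebraMap L E (A τ l j) * w c l =
        ∑ σ : Gal(E/L), σ⁻¹ c * algebraMap L E (A (σ * τ) i j) := by
      simp only [w, Finset.mul_sum]
      rw [Finset.sum_comm]
      refine Finset.sum_congr rfl fun σ _ ↦ ?_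
      rw [hmul, Matrix.mul_apply, map_sum, Finset.mul_sum]
      refine Finset.sum_congr rfl fun l _ ↦ ?_
      rw [map_mul]; ring
    rw [this, ← Equiv.sum_comp (Equiv.mulRight τ⁻¹)]
    simp [w, map_sum]
  have hind := Fintype.linearIndependent_iff.1
    ((linearIndependent_monoidHom E E).comp
      (fun σ : Gal(E/L) ↦ ((σ⁻¹ : Gal(E/L)) : E ≃* E).toMonoidHom) (fun σ τ h ↦ by
        apply inv_injective
        ext x
        exact DFunLike.congr_fun h x))
    (fun σ ↦ ∑ j, e j * algebraMap L E (A σ i j)) (by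
      ext c
      have := hcon (w c) (hw c)
      simp only [w, Finset.mul_sum] at this
      rw [Finset.sum_comm] at this
      simp only [Finset.sum_apply, Pi.smul_apply, smul_eq_mul, Function.comp_apply, Finset.sum_mul,
        Pi.zero_apply]
      rw [← this]
      refine Finset.sum_congr rfl fun σ _ ↦ Finset.sum_congr rfl fun j _ ↦ ?_
      change e j * _ * (σ⁻¹ c) = _
      ring)
  have := hind 1
  simpa [h1, Matrix.one_apply] using this

/-- The twist of the projective line by a linear representation of `Gal(E/L)` has infinitely many
rational points. -/
theorem infinite_equivariant_ratio [CharZero L]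
    (A : Gal(E/L) → Matrix (Fin 2) (Fin 2) L) (h1 : A 1 = 1)
    (hmul : ∀ σ τ, A (σ * τ) = A σ * A τ) :
    {y : E | ∃ w : Fin 2 → E, w 1 ≠ 0 ∧ y = w 0 / w 1 ∧
      ∀ σ : Gal(E/L), ∀ j, σ (w j) = ∑ i, algebraMap L E (A σ i j) * w i}.Infinite := by
  obtain ⟨w, hw, hw1⟩ := exists_equivariant_ne_zero A h1 hmul ![0, 1]
    (fun h ↦ one_ne_zero (congrFun h 1))
  obtain ⟨w', hw', hdet⟩ := exists_equivariant_ne_zero A h1 hmul ![w 1, - w 0]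
    (fun h ↦ hw1 (by simpa using congrFun h 0))
  simp only [Fin.sum_univ_two, Matrix.cons_val_zero, Matrix.cons_val_one] at hw1 hdet
  replace hw1 : w 1 ≠ 0 := by simpa using hw1
  -- the points `(w + a w')` for `a` in `L`, leaving out the zero of the denominator
  have hfin : {a : L | w 1 + algebraMap L E a * w' 1 = 0}.Finite := by
    apply Set.Subsingleton.finite
    intro a ha b hb
    simp only [Set.mem_ofPred_eq] at ha hb
    have hne : w' 1 ≠ 0 := fun h ↦ by simp [h, hw1] at ha
    apply (algebraMap L E).injective
    apply mul_right_cancel₀ hne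
    linear_combination ha - hb
  refine Set.infinite_of_injOn_mapsTo
    (f := fun a : L ↦ (w 0 + algebraMap L E a * w' 0) / (w 1 + algebraMap L E a * w' 1))
    (s := {a : L | w 1 + algebraMap L E a * w' 1 = 0}ᶜ) ?_ ?_ hfin.infinite_compl
  · intro a ha b hb hab
    simp only [Set.mem_compl_iff, Set.mem_ofPred_eq] at ha hb hab
    rw [div_eq_div_iff ha hb] at hab
    apply (algebraMap L E).injective
    apply mul_right_cancel₀ hdet
    linear_combination hab
  · intro a ha
    refine ⟨fun j ↦ w j + algebraMap L E a * w' j, ha, rfl, fun σ j ↦ ?_⟩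
    rw [map_add, map_mul, hw, hw', AlgEquiv.commutes, Finset.mul_sum, ← Finset.sum_add_distrib]
    exact Finset.sum_congr rfl fun i _ ↦ by ring

end Twist

/-! ### Homogenized polynomials -/

section Homogeneous

variable {k : Type*} [Field k]

/-- The homogenization of degree `d` of a polynomial `p`, evaluated at `(u, v)`. -/
noncomputable def homogEval {R : Type*} [CommRing R] [Algebra k R] (p : k[X]) (d : ℕ) (u v : R) :
    R :=
  ∑ i ∈ Finset.range (d + 1), algebraMap k R (p.coeff i) * u ^ i * v ^ (d - i)

theorem map_homogEval {R S : Type*} [CommRing R] [Algebra k R] [CommRing S] [Algebra k S]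
    (φ : R →ₐ[k] S) (p : k[X]) (d : ℕ) (u v : R) :
    φ (homogEval p d u v) = homogEval p d (φ u) (φ v) := by
  simp [homogEval]

theorem homogEval_eq {R : Type*} [Field R] [Algebra k R] {p : k[X]} {d : ℕ}
    (hd : p.natDegree ≤ d) (u : R) {v : R} (hv : v ≠ 0) :
    homogEval p d u v = v ^ d * aeval (u / v) p := by
  rw [aeval_eq_sum_range' (Nat.lt_succ_of_le hd), Finset.mul_sum, homogEval]
  refine Finset.sum_congr rfl fun i hi ↦ ?_
  have hi' : i ≤ d := Nat.lt_succ_iff.1 (Finset.mem_range.1 hi)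
  rw [Algebra.smul_def, div_pow, ← Nat.sub_add_cancel hi', pow_add, Nat.add_sub_cancel]
  field_simp

/-- The numerator of `R(g x) - R(x)` for `R = p / q` and the fractional linear substitution with
matrix `A`. -/
noncomputable def invarianceNumerator (p q : k[X]) (A : Matrix (Fin 2) (Fin 2) k) : k[X] :=
  homogEval p (max p.natDegree q.natDegree) (C (A 0 0) * X + C (A 1 0))
      (C (A 0 1) * X + C (A 1 1)) * q -
    p * homogEval q (max p.natDegree q.natDegree) (C (A 0 0) * X + C (A 1 0))
      (C (A 0 1) * X + C (A 1 1))

theorem aeval_invarianceNumerator {R : Type*} [Field R] [Algebra k R] (p q : k[X])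
    (A : Matrix (Fin 2) (Fin 2) k) {u u' : Fin 2 → R} (hu : u 1 ≠ 0) (hu' : u' 1 ≠ 0)
    (h : ∀ j, u' j = ∑ i, algebraMap k R (A i j) * u i) :
    aeval (u 0 / u 1) (invarianceNumerator p q A) =
      (u' 1 / u 1) ^ (max p.natDegree q.natDegree) *
        (aeval (u' 0 / u' 1) p * aeval (u 0 / u 1) q -
          aeval (u 0 / u 1) p * aeval (u' 0 / u' 1) q) := by
  have e0 : aeval (u 0 / u 1) (C (A 0 0) * X + C (A 1 0)) = u' 0 / u 1 := by
    simp only [map_add, map_mul, aeval_C, aeval_X, h 0, Fin.sum_univ_two]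
    field_simp
  have e1 : aeval (u 0 / u 1) (C (A 0 1) * X + C (A 1 1)) = u' 1 / u 1 := by
    simp only [map_add, map_mul, aeval_C, aeval_X, h 1, Fin.sum_univ_two]
    field_simp
  have hne : u' 1 / u 1 ≠ 0 := div_ne_zero hu' hu
  have e2 : u' 0 / u 1 / (u' 1 / u 1) = u' 0 / u' 1 := by field_simp
  rw [invarianceNumerator, map_sub, map_mul, map_mul, map_homogEval, map_homogEval, e0, e1,
    homogEval_eq (le_max_left _ _) _ hne, homogEval_eq (le_max_right _ _) _ hne, e2]
  ring

end Homogeneous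

/-! ### The compositum as the field generated by one embedding -/

section Compositum

variable (k : Type*) [Field k] (F : Type*) [Field F] [Algebra (RatFunc k) F]
  [Normal (RatFunc k) F] (L : Type*) [Field L] [Algebra k L]

/-- One embedding of the normal extension `F` suffices to generate the compositum. -/
theorem exists_embedding_compositum :
    ∃ ι : F →+* AlgebraicClosure (RatFunc L),
      ι.comp (algebraMap (RatFunc k) F) =
        (algebraMap (RatFunc L) (AlgebraicClosure (RatFunc L))).comp (ratFuncMap k L) ∧
      compositum k F L = IntermediateField.adjoin (RatFunc L) (Set.range ι) := by
  let _ : Algebra (RatFunc k) (AlgebraicClosure (RatFunc L)) :=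
    ((algebraMap (RatFunc L) (AlgebraicClosure (RatFunc L))).comp (ratFuncMap k L)).toAlgebra
  let ι : F →ₐ[RatFunc k] AlgebraicClosure (RatFunc L) := IsAlgClosed.lift
  refine ⟨ι.toRingHom, ι.comp_algebraMap, ?_⟩
  rw [compositum]
  congr 1
  ext y
  constructor
  · rintro ⟨σ, hσ, f, rfl⟩
    let _ : Algebra F (AlgebraicClosure (RatFunc L)) := ι.toRingHom.toAlgebra
    have : IsScalarTower (RatFunc k) F (AlgebraicClosure (RatFunc L)) :=
      IsScalarTower.of_algebraMap_eq' ι.comp_algebraMap.symm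
    let σ' : F →ₐ[RatFunc k] AlgebraicClosure (RatFunc L) :=
      { σ with commutes' := fun r ↦ RingHom.congr_fun hσ r }
    refine ⟨Normal.algHomEquivAut (RatFunc k) (AlgebraicClosure (RatFunc L)) F σ' f, ?_⟩
    have := (Normal.algHomEquivAut (RatFunc k) (AlgebraicClosure (RatFunc L)) F).symm_apply_apply σ'
    exact DFunLike.congr_fun this f
  · rintro ⟨f, rfl⟩
    exact ⟨ι.toRingHom, ι.comp_algebraMap, f, rfl⟩

end Compositum

/-! ### Linear coordinates -/

section Linearized

variable (k : Type*) [Field k] (F : Type*) [Field F] [Algebra (RatFunc k) F] [Algebra k F]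

/-- `F` is a rational function field `k(v₀ / v₁)` on which `Gal(F/k(T))` acts by the fractional
linear substitutions coming from a *linear* action on the plane spanned by `v₀` and `v₁`. -/
def HasLinearCoordinate : Prop :=
  ∃ v : Fin 2 → F, v 1 ≠ 0 ∧ IntermediateField.adjoin k {v 0 / v 1} = ⊤ ∧
    ∀ (g : Gal(F/RatFunc k)) (j : Fin 2), g (v j) ∈ Submodule.span k (Set.range v)

variable {k F} [IsScalarTower k (RatFunc k) F]

theorem transcendental_algebraMap_X {k F : Type*} [Field k] [Field F] [Algebra (RatFunc k) F]
    [Algebra k F] [IsScalarTower k (RatFunc k) F] :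
    Transcendental k (algebraMap (RatFunc k) F RatFunc.X) :=
  (transcendental_algebraMap_iff (algebraMap (RatFunc k) F).injective).2 RatFunc.transcendental_X

/-- A generator of `F` over `k` is transcendental, because `T` is. -/
theorem transcendental_of_adjoin_eq_top {x : F} (hx : IntermediateField.adjoin k {x} = ⊤) :
    Transcendental k x := by
  intro halg
  have h1 := IntermediateField.isAlgebraic_adjoin_simple halg.isIntegral
  rw [hx] at h1
  have h2 : IsAlgebraic k (⟨algebraMap (RatFunc k) F RatFunc.X, trivial⟩ :
      (⊤ : IntermediateField k F)) := h1.isAlgebraic _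
  exact transcendental_algebraMap_X (k := k) (F := F)
    (h2.algHom (⊤ : IntermediateField k F).val)

/-- The linear action in matrix form. -/
theorem exists_matrix_of_linear {v : Fin 2 → F} (hv1 : v 1 ≠ 0)
    (htr : Transcendental k (v 0 / v 1))
    (hstab : ∀ (g : Gal(F/RatFunc k)) (j : Fin 2), g (v j) ∈ Submodule.span k (Set.range v)) :
    ∃ A : Gal(F/RatFunc k) → Matrix (Fin 2) (Fin 2) k,
      (∀ g j, g (v j) = ∑ i, algebraMap k F (A g i j) * v i) ∧ A 1 = 1 ∧
      ∀ g h, A (g * h) = A g * A h := by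
  have hind : LinearIndependent k v := by
    refine linearIndependent_fin2.2 ⟨hv1, fun a ha ↦ htr ?_⟩
    rw [← ha, Algebra.smul_def, mul_div_cancel_right₀ _ hv1]
    exact isAlgebraic_algebraMap a
  have huniq : ∀ a b : Fin 2 → k, ∑ i, algebraMap k F (a i) * v i =
      ∑ i, algebraMap k F (b i) * v i → a = b := by
    intro a b hab
    have := Fintype.linearIndependent_iff.1 hind (a - b) (by
      simp only [Algebra.smul_def, Pi.sub_apply, map_sub, sub_mul, Finset.sum_sub_distrib, hab,
        sub_self])
    exact funext fun i ↦ sub_eq_zero.1 (this i)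
  have hfix : ∀ (g : Gal(F/RatFunc k)) (a : k), g (algebraMap k F a) = algebraMap k F a :=
    fun g a ↦ (g.restrictScalars k).commutes a
  choose c hc using fun g j ↦ Submodule.mem_span_range_iff_exists_fun k |>.1 (hstab g j)
  have hA : ∀ g j, g (v j) = ∑ i, algebraMap k F (c g j i) * v i := fun g j ↦ by
    rw [← hc]
    exact Finset.sum_congr rfl fun i _ ↦ Algebra.smul_def _ _
  refine ⟨fun g ↦ Matrix.of fun i j ↦ c g j i, hA, ?_, fun g h ↦ ?_⟩
  · ext i j
    refine congrFun (huniq (c 1 j) (fun i ↦ (1 : Matrix (Fin 2) (Fin 2) k) i j) ?_) i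
    rw [← hA]
    simp [Matrix.one_apply]
  · ext i j
    refine congrFun (huniq (c (g * h) j)
      (fun i ↦ ((Matrix.of fun i j ↦ c g j i) * (Matrix.of fun i j ↦ c h j i)) i j) ?_) i
    rw [← hA, AlgEquiv.mul_apply, hA h, map_sum]
    simp only [map_mul, hfix, hA g, Matrix.mul_apply, Matrix.of_apply, map_sum, Finset.mul_sum,
      Finset.sum_mul]
    rw [Finset.sum_comm]
    exact Finset.sum_congr rfl fun _ _ ↦ Finset.sum_congr rfl fun _ _ ↦ by ring

end Linearized

/-! ### Base change of the constants -/

section BaseChange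

variable {k : Type*} [Field k] {L : Type*} [Field L] [Algebra k L]

theorem ratFuncMap_algebraMap_polynomial (p : k[X]) :
    ratFuncMap k L (algebraMap k[X] (RatFunc k) p) =
      algebraMap L[X] (RatFunc L) (p.map (algebraMap k L)) := by
  have := RatFunc.map_apply_div (Polynomial.mapRingHom (algebraMap k L))
    (nonZeroDivisors_le_comap_nonZeroDivisors_of_injective _
      (Polynomial.map_injective _ (algebraMap k L).injective)) p 1
  rw [ratFuncMap, RatFunc.coe_mapRingHom_eq_coe_map]
  simpa using this

theorem ratFuncMap_X : ratFuncMap k L RatFunc.X = RatFunc.X := by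
  rw [← RatFunc.algebraMap_X, ratFuncMap_algebraMap_polynomial, map_X, RatFunc.algebraMap_X]

theorem ratFuncMap_algebraMap (a : k) :
    ratFuncMap k L (algebraMap k (RatFunc k) a) =
      algebraMap L (RatFunc L) (algebraMap k L a) := by
  rw [RatFunc.algebraMap_eq_C, RatFunc.algebraMap_eq_C, ← RatFunc.algebraMap_C,
    ratFuncMap_algebraMap_polynomial, map_C, RatFunc.algebraMap_C]

variable {F : Type*} [Field F] [Algebra (RatFunc k) F] [Algebra k F] [IsScalarTower k (RatFunc k) F]
  [Normal (RatFunc k) F]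

variable (L) in
/-- A generator of `F` over `k` generates `FL` over `L`, with the same expression of `T`. -/
theorem exists_generator_compositum {x : F} (hx : IntermediateField.adjoin k {x} = ⊤) {p q : k[X]}
    (hT : algebraMap (RatFunc k) F RatFunc.X * aeval x q = aeval x p) :
    ∃ y : compositum k F L, Transcendental L y ∧ IntermediateField.adjoin L {y} = ⊤ ∧
      algebraMap (RatFunc L) (compositum k F L) RatFunc.X *
        aeval y (q.map (algebraMap k L)) = aeval y (p.map (algebraMap k L)) := by
  obtain ⟨ι, hι, hM⟩ := exists_embedding_compositum k F L
  have hιT : ι (algebraMap (RatFunc k) F RatFunc.X) =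
      algebraMap (RatFunc L) (AlgebraicClosure (RatFunc L)) RatFunc.X := by
    have := RingHom.congr_fun hι RatFunc.X
    rwa [RingHom.comp_apply, RingHom.comp_apply, ratFuncMap_X] at this
  have hιk : ∀ a : k, ι (algebraMap k F a) =
      algebraMap L (AlgebraicClosure (RatFunc L)) (algebraMap k L a) := fun a ↦ by
    have := RingHom.congr_fun hι (algebraMap k (RatFunc k) a)
    rw [RingHom.comp_apply, RingHom.comp_apply, ratFuncMap_algebraMap] at this
    rw [IsScalarTower.algebraMap_apply k (RatFunc k) F, this,
      IsScalarTower.algebraMap_apply L (RatFunc L) (AlgebraicClosure (RatFunc L))]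
  have hιp : ∀ r : k[X], ι (aeval x r) = aeval (ι x) (r.map (algebraMap k L)) := fun r ↦ by
    rw [aeval_def, hom_eval₂, aeval_def, eval₂_map]
    congr 1
    exact RingHom.ext hιk
  -- `L(ι x)` contains `L(T)` and the image of `F`
  let J := IntermediateField.adjoin L {ι x}
  have hxJ : ι x ∈ J := IntermediateField.mem_adjoin_simple_self L _
  have hpJ : ∀ r : L[X], aeval (ι x) r ∈ J := fun r ↦ by
    have := aeval_algHom_apply J.val ⟨ι x, hxJ⟩ r
    rw [show ι x = J.val ⟨ι x, hxJ⟩ from rfl, this]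
    exact (aeval (⟨ι x, hxJ⟩ : J) r).2
  have hFJ : ∀ f : F, ι f ∈ J := fun f ↦ by
    have hf : f ∈ IntermediateField.adjoin k {x} := hx ▸ trivial
    obtain ⟨r, s, rfl⟩ := IntermediateField.mem_adjoin_simple_iff k f |>.1 hf
    rw [map_div₀, hιp, hιp]
    exact div_mem (hpJ _) (hpJ _)
  have hTJ : ∀ r : RatFunc L, algebraMap (RatFunc L) (AlgebraicClosure (RatFunc L)) r ∈ J := by
    intro r
    have hr : r ∈ IntermediateField.adjoin L {(RatFunc.X : RatFunc L)} :=
      RatFunc.adjoin_X (K := L) ▸ trivial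
    have h1 : (IntermediateField.adjoin L {(RatFunc.X : RatFunc L)}) ≤
        J.comap (IsScalarTower.toAlgHom L (RatFunc L) (AlgebraicClosure (RatFunc L))) := by
      rw [IntermediateField.adjoin_simple_le_iff]
      change algebraMap (RatFunc L) (AlgebraicClosure (RatFunc L)) RatFunc.X ∈ J
      rw [← hιT]
      exact hFJ _
    exact h1 hr
  let J' : IntermediateField (RatFunc L) (AlgebraicClosure (RatFunc L)) :=
    { J.toSubfield with algebraMap_mem' := hTJ }
  have hMJ : ∀ m ∈ compositum k F L, m ∈ J := by
    have : compositum k F L ≤ J' := by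
      rw [hM, IntermediateField.adjoin_le_iff]
      rintro _ ⟨f, rfl⟩
      exact hFJ f
    exact fun m hm ↦ this hm
  have hxM : ι x ∈ compositum k F L := by
    rw [hM]; exact IntermediateField.subset_adjoin _ _ ⟨x, rfl⟩
  let y : compositum k F L := ⟨ι x, hxM⟩
  have hy : ∀ r : L[X], ((aeval y r : compositum k F L) : AlgebraicClosure (RatFunc L)) =
      aeval (ι x) r := fun r ↦
    (aeval_algHom_apply ((compositum k F L).val.restrictScalars L) y r).symm
  have htop : IntermediateField.adjoin L {y} = ⊤ := by
    rw [eq_top_iff]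
    intro m _
    obtain ⟨r, s, hrs⟩ := IntermediateField.mem_adjoin_simple_iff L (α := ι x)
      (m : AlgebraicClosure (RatFunc L)) |>.1 (hMJ m m.2)
    refine IntermediateField.mem_adjoin_simple_iff L m |>.2 ⟨r, s, Subtype.ext ?_⟩
    rw [hrs, ← hy, ← hy]
    rfl
  refine ⟨y, transcendental_of_adjoin_eq_top htop, htop, Subtype.ext ?_⟩
  change algebraMap (RatFunc L) (AlgebraicClosure (RatFunc L)) RatFunc.X * _ = _
  rw [hy, hy, ← hιp, ← hιp, ← hιT, ← hT, map_mul]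

end BaseChange

/-! ### Specializations of an extension with a linear coordinate -/

section Specializations

variable {k : Type*} [Field k] {F : Type*} [Field F] [Algebra (RatFunc k) F]
  [Algebra k F] [IsScalarTower k (RatFunc k) F]
  [FiniteDimensional (RatFunc k) F] [IsGalois (RatFunc k) F]

/-- The polynomial whose roots are the fixed points of the fractional linear substitution with
matrix `A`. -/
noncomputable def fixedPointPoly (A : Matrix (Fin 2) (Fin 2) k) : k[X] :=
  C (A 0 1) * X ^ 2 + C (A 1 1 - A 0 0) * X - C (A 1 0)

theorem aeval_fixedPointPoly {R : Type*} [Field R] [Algebra k R]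
    (A : Matrix (Fin 2) (Fin 2) k) {u u' : Fin 2 → R} (hu : u 1 ≠ 0) (hu' : u' 1 ≠ 0)
    (h : ∀ j, u' j = ∑ i, algebraMap k R (A i j) * u i) :
    aeval (u 0 / u 1) (fixedPointPoly A) = (u' 1 / u 1) * (u 0 / u 1 - u' 0 / u' 1) := by
  have e : (u' 1 / u 1) * (u 0 / u 1 - u' 0 / u' 1) = (u' 1 * u 0 - u' 0 * u 1) / u 1 ^ 2 := by
    field_simp
  rw [e, h 0, h 1, fixedPointPoly]
  simp only [map_sub, map_add, map_mul, aeval_C, map_pow, aeval_X, Fin.sum_univ_two]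
  field_simp
  ring

/-- If `F = k(x)` with a linearizable action of `Gal(F/k(T))`, then every extension of `L` whose
group embeds into `Gal(F/k(T))` is a specialization of `FL` at infinitely many points: the
equivariant points of the twisted `x`-line provide them. -/
theorem HasLinearCoordinate.infinite_specializations [CharZero k] (h : HasLinearCoordinate k F)
    (L : Type*) [Field L] [Algebra k L] (E : Type*) [Field E] [Algebra L E]
    [FiniteDimensional L E] [IsGalois L E] (f : Gal(E/L) →* Gal(F/RatFunc k))
    (hf : Function.Injective f) :
    {t₀ : OnePoint L | IsSpecializationAt (compositum k F L) t₀ E}.Infinite := by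
  obtain ⟨v, hv1, hx, hstab⟩ := h
  have htr := transcendental_of_adjoin_eq_top hx
  obtain ⟨A, hA, hA1, hAmul⟩ := exists_matrix_of_linear hv1 htr hstab
  set x := v 0 / v 1 with hxdef
  have hgv1 : ∀ g : Gal(F/RatFunc k), g (v 1) ≠ 0 := fun g ↦ by simpa using hv1
  have hgx : ∀ g : Gal(F/RatFunc k), g x = g (v 0) / g (v 1) := fun g ↦ map_div₀ g _ _
  have hne : ∀ s : k[X], s ≠ 0 → aeval x s ≠ 0 := fun s hs h ↦ htr ⟨s, hs, h⟩
  have hTtr : Transcendental k (algebraMap (RatFunc k) F RatFunc.X) :=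
    transcendental_algebraMap_X
  obtain ⟨p, q, hT⟩ : ∃ p q : k[X], algebraMap (RatFunc k) F RatFunc.X = aeval x p / aeval x q :=
    IntermediateField.mem_adjoin_simple_iff k _ |>.1 (hx ▸ trivial)
  have hq : aeval x q ≠ 0 := fun h0 ↦ by
    rw [h0, div_zero] at hT
    exact hTtr (hT ▸ isAlgebraic_zero)
  replace hT : algebraMap (RatFunc k) F RatFunc.X * aeval x q = aeval x p := by
    rw [hT, div_mul_cancel₀ _ hq]
  obtain ⟨y, hy, hytop, hyT⟩ := exists_generator_compositum L hx hT
  have hgp : ∀ (g : Gal(F/RatFunc k)) (r : k[X]), aeval (g x) r = g (aeval x r) := fun g r ↦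
    aeval_algHom_apply (g.toAlgHom.restrictScalars k) x r
  -- invariance of `T` as an identity of polynomials
  have hinv : ∀ g, invarianceNumerator p q (A g) = 0 := fun g ↦ by
    by_contra h0
    apply hne _ h0
    rw [hxdef, aeval_invarianceNumerator p q (A g) hv1 (hgv1 g) (hA g), ← hgx, ← hxdef]
    rw [hgp, hgp, ← hT, map_mul, AlgEquiv.commutes]
    ring
  have hfixed : ∀ g ≠ 1, fixedPointPoly (A g) ≠ 0 := fun g hg h0 ↦ hg (by
    have := aeval_fixedPointPoly (A g) hv1 (hgv1 g) (hA g)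
    rw [h0, map_zero, ← hgx, ← hxdef, eq_comm, mul_eq_zero, or_iff_right
      (div_ne_zero (hgv1 g) hv1), sub_eq_zero] at this
    ext a
    have ha : a ∈ IntermediateField.adjoin k {x} := hx ▸ trivial
    obtain ⟨r, s, rfl⟩ := IntermediateField.mem_adjoin_simple_iff k a |>.1 ha
    rw [map_div₀, ← hgp, ← hgp, ← this, AlgEquiv.one_apply])
  -- the points of the `x`-line to be avoided are roots of a nonzero polynomial
  let d := max p.natDegree q.natDegree
  have hq0 : q ≠ 0 := fun h0 ↦ hq (by rw [h0, map_zero])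
  have hp0 : p ≠ 0 := fun h0 ↦ by
    rw [h0, map_zero, mul_eq_zero, or_iff_left hq] at hT
    exact hTtr (hT ▸ isAlgebraic_zero)
  have hlin : ∀ a b : k, C a * p = C b * q → a = 0 ∧ b = 0 := fun a b hab ↦ by
    have h1 := congrArg (aeval x) hab
    rw [map_mul, map_mul, ← hT, aeval_C, aeval_C, ← mul_assoc] at h1
    replace h1 := mul_right_cancel₀ hq h1
    have ha : a = 0 := by
      by_contra ha
      apply hTtr
      have : algebraMap (RatFunc k) F RatFunc.X = algebraMap k F (b / a) := by
        rw [map_div₀, ← h1, mul_div_cancel_left₀ _ (by simpa using ha)]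
      rw [this]
      exact isAlgebraic_algebraMap _
    exact ⟨ha, by simpa [ha] using h1.symm⟩
  let B : k[X] := C (q.coeff d) * p - C (p.coeff d) * q
  have hB : B ≠ 0 := fun h0 ↦ by
    obtain ⟨h1, h2⟩ := hlin _ _ (sub_eq_zero.1 h0)
    rcases max_choice p.natDegree q.natDegree with h3 | h3
    · exact hp0 (leadingCoeff_eq_zero.1 (by rw [← h2]; simp only [d, h3, leadingCoeff]))
    · exact hq0 (leadingCoeff_eq_zero.1 (by rw [← h1]; simp only [d, h3, leadingCoeff]))
  classical
  let bad : k[X] := q * B * ∏ g ∈ Finset.univ.filter (· ≠ (1 : Gal(F/RatFunc k))),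
    fixedPointPoly (A g)
  have hbad : bad ≠ 0 := by
    refine mul_ne_zero (mul_ne_zero hq0 hB) (Finset.prod_ne_zero_iff.2 fun g hg ↦ hfixed g ?_)
    exact (Finset.mem_filter.1 hg).2
  let _ : Algebra k E := ((algebraMap L E).comp (algebraMap k L)).toAlgebra
  have : IsScalarTower k L E := IsScalarTower.of_algebraMap_eq' rfl
  have : CharZero L := charZero_of_injective_algebraMap (algebraMap k L).injective
  have hrootsfin : ∀ r : k[X], r ≠ 0 → {y : E | aeval y r = 0}.Finite := fun r hr ↦
    (r.rootSet_finite E).subset fun y hy ↦ (mem_rootSet.2 ⟨hr, hy⟩)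
  have hinf := (infinite_equivariant_ratio (E := E) (fun σ ↦ (A (f σ)).map (algebraMap k L))
    (by rw [map_one, hA1]; simp) (fun σ τ ↦ by rw [map_mul, hAmul, Matrix.map_mul])).sdiff
      (hrootsfin bad hbad)
  set S := {y : E | _} \ {y : E | aeval y bad = 0} with hS
  -- each remaining equivariant point lies over a rational point of the `T`-line
  have hspec : ∀ x₀ ∈ S, ∃ t₀ : L, aeval x₀ p = algebraMap L E t₀ * aeval x₀ q ∧
      IsSpecializationAt (compositum k F L) (t₀ : OnePoint L) E := by
    rintro x₀ ⟨⟨w, hw1, hx₀, hw⟩, hgood⟩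
    simp only [Set.mem_ofPred_eq, bad, map_mul, mul_eq_zero, not_or, map_prod,
      Finset.prod_eq_zero_iff, not_exists, not_and] at hgood
    obtain ⟨⟨hq₀, hB₀⟩, hfix₀⟩ := hgood
    have hσw1 : ∀ σ : Gal(E/L), σ (w 1) ≠ 0 := fun σ ↦ by simpa using hw1
    have hσx : ∀ σ : Gal(E/L), σ x₀ = σ (w 0) / σ (w 1) := fun σ ↦ by rw [hx₀, map_div₀]
    have hw' : ∀ σ : Gal(E/L), ∀ j, σ (w j) = ∑ i, algebraMap k E (A (f σ) i j) * w i :=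
      fun σ j ↦ hw σ j
    have hσ : ∀ σ : Gal(E/L), ∀ r : k[X], aeval (σ x₀) r = σ (aeval x₀ r) := fun σ r ↦
      aeval_algHom_apply (σ.toAlgHom.restrictScalars k) x₀ r
    have hinvE : ∀ σ : Gal(E/L), σ (aeval x₀ p / aeval x₀ q) = aeval x₀ p / aeval x₀ q := by
      intro σ
      have h0 := aeval_invarianceNumerator p q (A (f σ)) hw1 (hσw1 σ) (hw' σ)
      rw [hinv, map_zero, ← hσx, ← hx₀, eq_comm, mul_eq_zero, or_iff_right
        (pow_ne_zero _ (div_ne_zero (hσw1 σ) hw1)), sub_eq_zero, hσ, hσ] at h0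
      rw [map_div₀, div_eq_div_iff (by simpa using hq₀) hq₀, h0]
    obtain ⟨t₀, ht₀⟩ := IsGalois.mem_bot_iff_fixed (F := L) (aeval x₀ p / aeval x₀ q) |>.2 hinvE
    have ht : aeval x₀ p = algebraMap L E t₀ * aeval x₀ q := by
      rw [show algebraMap L E t₀ = _ from ht₀, div_mul_cancel₀ _ hq₀]
    refine ⟨t₀, ht, ?_⟩
    refine isSpecializationAt_of_eval (x₀ := x₀) (d := d) hy hytop hyT ?_ ?_ ?_ ?_ ?_ ?_
    · -- only the identity fixes `x₀`
      have hbot : (IntermediateField.adjoin L {x₀}).fixingSubgroup = ⊥ := by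
        rw [eq_bot_iff]
        intro σ hσmem
        have hσx₀ : σ x₀ = x₀ :=
          (IntermediateField.mem_fixingSubgroup_iff _ σ).1 hσmem x₀
            (IntermediateField.mem_adjoin_simple_self L x₀)
        have h0 := aeval_fixedPointPoly (A (f σ)) hw1 (hσw1 σ) (hw' σ)
        rw [← hσx, ← hx₀, hσx₀, sub_self, mul_zero] at h0
        by_contra hσ1
        refine hfix₀ (f σ) (Finset.mem_filter.2 ⟨Finset.mem_univ _, fun h1 ↦ hσ1 ?_⟩) h0
        exact hf (h1.trans (map_one f).symm)
      rw [← IsGalois.fixedField_fixingSubgroup (IntermediateField.adjoin L {x₀}), hbot,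
        IntermediateField.fixedField_bot]
    · rwa [aeval_map_algebraMap]
    · rwa [aeval_map_algebraMap, aeval_map_algebraMap]
    · exact natDegree_map_le.trans (le_max_left _ _)
    · exact natDegree_map_le.trans (le_max_right _ _)
    · intro h0
      apply hB₀
      have h1 := congrArg (algebraMap L E) h0
      rw [coeff_map, coeff_map, map_sub, map_mul, map_zero, ← IsScalarTower.algebraMap_apply,
        ← IsScalarTower.algebraMap_apply] at h1
      simp only [B, map_sub, map_mul, aeval_C, ht]
      linear_combination (- aeval x₀ q) * h1
  -- finitely many values of `t₀` would leave finitely many points `x₀`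
  intro hfin
  have hfin' : {t₀ : L | IsSpecializationAt (compositum k F L) (t₀ : OnePoint L) E}.Finite :=
    hfin.preimage (OnePoint.coe_injective.injOn)
  refine hinf ((hfin'.biUnion (t := fun t₀ ↦ {x₀ : E | aeval x₀ p = algebraMap L E t₀ * aeval x₀ q})
    fun t₀ _ ↦ ?_).subset ?_)
  · have hne0 : p.map (algebraMap k L) - C t₀ * q.map (algebraMap k L) ≠ 0 := fun h0 ↦ by
      have hq1 : aeval y (q.map (algebraMap k L)) ≠ 0 := fun h1 ↦ hy ⟨_, by
        rwa [Ne, Polynomial.map_eq_zero], h1⟩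
      rw [sub_eq_zero.1 h0, map_mul, aeval_C] at hyT
      apply transcendental_algebraMap_X (k := L) (F := compositum k F L)
      rw [mul_right_cancel₀ hq1 hyT]
      exact isAlgebraic_algebraMap t₀
    refine (rootSet_finite _ E).subset fun x₀ hx₀ ↦ mem_rootSet.2 ⟨hne0, ?_⟩
    rw [map_sub, map_mul, aeval_C, aeval_map_algebraMap, aeval_map_algebraMap]
    exact sub_eq_zero.2 hx₀
  · intro x₀ hx₀
    obtain ⟨t₀, h1, h2⟩ := hspec x₀ hx₀
    exact Set.mem_biUnion h2 h1

end Specializations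

/-! ### Regular extensions and linear disjointness -/

section Regular

variable {k : Type*} [Field k] {F : Type*} [Field F] [Algebra k F]
  {Ω : Type*} [Field Ω] [Algebra k Ω] [Algebra F Ω] [IsScalarTower k F Ω] [IsGalois F Ω]

/-- If `k` is algebraically closed in `F`, elements of `F` that are linearly independent over `k`
remain so over every normal algebraic extension `K` of `k`: the Galois group of `Ω / F` acts on the
coefficients of a shortest relation. -/
theorem linearIndependent_algebraMap_of_regular (hreg : algebraicClosure k F = ⊥)
    (K : Type*) [Field K] [Algebra k K] [Algebra K Ω] [IsScalarTower k K Ω] [Normal k K]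
    {ι : Type*} {b : ι → F} (hb : LinearIndependent k b) :
    LinearIndependent K (fun i ↦ algebraMap F Ω (b i)) := by
  classical
  rw [linearIndependent_iff']
  intro s
  induction s using Finset.induction_on with
  | empty => simp
  | insert a s ha ih =>
    -- the general case reduces to the vanishing of the first coefficient
    intro c hc
    suffices hca : c a = 0 by
      rw [Finset.sum_insert ha, hca, zero_smul, zero_add] at hc
      intro i hi
      rcases Finset.mem_insert.1 hi with rfl | hi
      exacts [hca, ih c hc i hi]
    by_contra hca
    let d : ι → K := fun i ↦ -(c a)⁻¹ * c i
    have hd : algebraMap F Ω (b a) = ∑ i ∈ s, d i • algebraMap F Ω (b i) := by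
      have h1 := congrArg (fun z ↦ (c a)⁻¹ • z) hc
      simp only [Finset.sum_insert ha, smul_add, Finset.smul_sum, smul_smul, smul_zero,
        inv_mul_cancel₀ hca, one_smul] at h1
      rw [eq_neg_of_add_eq_zero_left h1, ← Finset.sum_neg_distrib]
      exact Finset.sum_congr rfl fun i _ ↦ by rw [← neg_smul, ← neg_mul]
    have hfix : ∀ i ∈ s, ∀ φ : Gal(Ω/F), φ (algebraMap K Ω (d i)) = algebraMap K Ω (d i) := by
      intro i hi φ
      let φK := (φ.restrictScalars k).restrictNormal K
      have hφK : ∀ a : K, algebraMap K Ω (φK a) = φ (algebraMap K Ω a) :=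
        (φ.restrictScalars k).restrictNormal_commutes K
      have h1 : ∑ i ∈ s, (φK (d i) - d i) • algebraMap F Ω (b i) = 0 := by
        simp only [sub_smul, Finset.sum_sub_distrib, ← hd]
        rw [sub_eq_zero, ← φ.commutes (b a), hd, map_sum]
        exact Finset.sum_congr rfl fun i _ ↦ by
          rw [Algebra.smul_def, Algebra.smul_def, map_mul φ, hφK, φ.commutes]
      rw [← hφK, sub_eq_zero.1 (ih _ h1 i hi)]
    -- coefficients fixed by the Galois group lie in `F` and are algebraic, so they lie in `k`
    have hk : ∀ i ∈ s, ∃ e : k, algebraMap k K e = d i := by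
      intro i hi
      obtain ⟨g, hg⟩ := InfiniteGalois.mem_bot_iff_fixed (k := F) _ |>.2 (hfix i hi)
      replace hg : algebraMap F Ω g = algebraMap K Ω (d i) := hg
      have halg : IsAlgebraic k g := by
        rw [← isAlgebraic_algebraMap_iff (algebraMap F Ω).injective, hg]
        exact (Algebra.IsAlgebraic.isAlgebraic (d i)).algebraMap
      rw [← mem_algebraicClosure_iff, hreg] at halg
      obtain ⟨e, rfl⟩ := halg
      refine ⟨e, (algebraMap K Ω).injective ?_⟩
      rw [← hg, ← IsScalarTower.algebraMap_apply]
      exact IsScalarTower.algebraMap_apply k F Ω e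
    choose! e he using hk
    have h2 : b a = ∑ i ∈ s, e i • b i := by
      apply (algebraMap F Ω).injective
      rw [hd, map_sum]
      refine Finset.sum_congr rfl fun i hi ↦ ?_
      rw [← he i hi, algebraMap_smul, Algebra.smul_def, Algebra.smul_def, map_mul,
        ← IsScalarTower.algebraMap_apply]
    have h3 := linearIndependent_iff'.1 hb (insert a s) (fun i ↦ if i = a then -1 else e i) (by
      rw [Finset.sum_insert ha, if_pos rfl, h2, neg_one_smul, neg_add_eq_zero]
      exact Finset.sum_congr rfl fun i hi ↦ by
        rw [if_neg (show i ≠ a from fun h ↦ ha (h ▸ hi))]) a (Finset.mem_insert_self _ _)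
    simp at h3

variable {K : Type*} [Field K] [Algebra k K] [Algebra K Ω] [IsScalarTower k K Ω] [Normal k K]

/-- Membership in a `k`-span can be tested over `K`. -/
theorem mem_span_of_algebraMap_mem_span (hreg : algebraicClosure k F = ⊥) {ι : Type*} {v : ι → F}
    (hv : LinearIndependent k v) {f : F}
    (hf : algebraMap F Ω f ∈ Submodule.span K (Set.range fun i ↦ algebraMap F Ω (v i))) :
    f ∈ Submodule.span k (Set.range v) := by
  by_contra hcon
  have h1 := linearIndependent_algebraMap_of_regular (Ω := Ω) hreg K (hv.option hcon)
  rw [linearIndependent_option] at h1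
  exact h1.2 hf

/-- The symmetric form of linear disjointness. -/
theorem linearIndependent_of_regular [IsAlgClosed Ω] (hreg : algebraicClosure k F = ⊥)
    {ι : Type*} {e : ι → K}
    (he : LinearIndependent k e) : LinearIndependent F (fun i ↦ algebraMap K Ω (e i)) := by
  have : IsAlgClosure k (algebraicClosure k Ω) := inferInstance
  have : Normal k (algebraicClosure k Ω) := IsAlgClosure.normal _ _
  have hdisj : (algebraicClosure k Ω).LinearDisjoint F := by
    refine IntermediateField.LinearDisjoint.of_basis_right' (Module.Basis.ofVectorSpace k F) ?_
    exact linearIndependent_algebraMap_of_regular hreg _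
      (Module.Basis.ofVectorSpace k F).linearIndependent
  have hmem : ∀ i, algebraMap K Ω (e i) ∈ algebraicClosure k Ω := fun i ↦
    mem_algebraicClosure_iff.2 (Algebra.IsAlgebraic.isAlgebraic (e i)).algebraMap
  refine hdisj.linearIndependent_left (a := fun i ↦ ⟨algebraMap K Ω (e i), hmem i⟩) ?_
  rw [← LinearMap.linearIndependent_iff_of_injOn (algebraicClosure k Ω).val.toLinearMap
    Subtype.val_injective.injOn]
  exact (LinearMap.linearIndependent_iff_of_injOn (IsScalarTower.toAlgHom k K Ω).toLinearMap
    (algebraMap K Ω).injective.injOn).2 he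

/-- An element of `F` that is a rational function of `x ∈ F` over `K` is already a rational
function of `x` over `k`. -/
theorem mem_adjoin_simple_of_regular [IsAlgClosed Ω] (hreg : algebraicClosure k F = ⊥)
    {x f : F} {P Q : K[X]}
    (hQ : aeval (algebraMap F Ω x) Q ≠ 0)
    (hf : algebraMap F Ω f * aeval (algebraMap F Ω x) Q = aeval (algebraMap F Ω x) P) :
    f ∈ IntermediateField.adjoin k {x} := by
  classical
  let e := Module.Basis.ofVectorSpace k K
  have he := linearIndependent_of_regular (F := F) (Ω := Ω) hreg e.linearIndependent
  -- splitting a polynomial over `K` into its coordinate polynomials over `k`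
  have hsplit : ∀ R : K[X], ∃ r : Module.Basis.ofVectorSpaceIndex k K →₀ F,
      (∀ i, r i ∈ IntermediateField.adjoin k {x}) ∧
      aeval (algebraMap F Ω x) R = r.sum fun i c ↦ c • algebraMap K Ω (e i) := by
    intro R
    induction R using Polynomial.induction_on' with
    | add p q hp hq =>
      obtain ⟨r, hr, hr'⟩ := hp
      obtain ⟨s, hs, hs'⟩ := hq
      refine ⟨r + s, fun i ↦ add_mem (hr i) (hs i), ?_⟩
      rw [map_add, hr', hs', Finsupp.sum_add_index' (by simp) (by intros; rw [add_smul])]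
    | monomial n a =>
      refine ⟨(e.repr a).mapRange (fun c ↦ algebraMap k F c * x ^ n) (by simp), fun i ↦ ?_, ?_⟩
      · rw [Finsupp.mapRange_apply]
        exact mul_mem (IntermediateField.algebraMap_mem _ _)
          (pow_mem (IntermediateField.mem_adjoin_simple_self k x) n)
      · rw [Finsupp.sum_mapRange_index (by simp), aeval_monomial]
        conv_lhs => rw [← e.linearCombination_repr a]
        rw [Finsupp.linearCombination_apply, Finsupp.sum, map_sum, Finset.sum_mul, Finsupp.sum]
        refine Finset.sum_congr rfl fun i _ ↦ ?_
        rw [Algebra.smul_def, Algebra.smul_def, map_mul, map_mul, map_pow,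
          ← IsScalarTower.algebraMap_apply, ← IsScalarTower.algebraMap_apply]
        ring
  obtain ⟨r, hr, hr'⟩ := hsplit Q
  obtain ⟨s, hs, hs'⟩ := hsplit P
  have hr0 : r ≠ 0 := fun h ↦ hQ (by rw [hr', h, Finsupp.sum_zero_index])
  obtain ⟨i, hi⟩ := Finsupp.ne_iff.1 hr0
  have hrel : f • r = s := by
    apply he
    rw [Finsupp.linearCombination_apply, Finsupp.linearCombination_apply, ← hs', ← hf, hr',
      Finsupp.sum_smul_index (by simp), Finsupp.sum, Finsupp.sum, Finset.mul_sum]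
    exact Finset.sum_congr rfl fun i _ ↦ by rw [mul_smul, Algebra.smul_def f]
  have : f = s i / r i := by
    rw [← hrel, Finsupp.smul_apply, smul_eq_mul, mul_div_cancel_right₀ _ hi]
  rw [this]
  exact div_mem (hs i) (hr i)

end Regular

/-! ### Descent of stable planes -/

section Descent

variable {k : Type*} [Field k] {F : Type*} [Field F] [Algebra k F]
  {Ω : Type*} [Field Ω] [Algebra k Ω] [Algebra F Ω] [IsScalarTower k F Ω] [IsGalois F Ω]
  {K : Type*} [Field K] [Algebra k K] [Algebra K Ω] [IsScalarTower k K Ω] [Normal k K]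

/-- The compositum `K F` is spanned over `K` by `F`. -/
theorem mem_span_of_mem_adjoin {z : Ω}
    (hz : z ∈ IntermediateField.adjoin K (Set.range (algebraMap F Ω))) :
    z ∈ Submodule.span K (Set.range (algebraMap F Ω)) := by
  let S : IntermediateField F Ω := IntermediateField.adjoin F (Set.range (algebraMap K Ω))
  let S' : IntermediateField K Ω :=
    { S.toSubfield with
      algebraMap_mem' := fun a ↦ IntermediateField.subset_adjoin F _ ⟨a, rfl⟩ }
  have hle : IntermediateField.adjoin K (Set.range (algebraMap F Ω)) ≤ S' := by
    rw [IntermediateField.adjoin_le_iff]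
    rintro _ ⟨f, rfl⟩
    exact S.algebraMap_mem f
  have hzS : z ∈ S.toSubalgebra := hle hz
  rw [IntermediateField.adjoin_toSubalgebra_of_isAlgebraic
    (fun x _ ↦ Algebra.IsAlgebraic.isAlgebraic x), ← Subalgebra.mem_toSubmodule,
    Algebra.adjoin_eq_span] at hzS
  have hcl : Submonoid.closure (Set.range (algebraMap K Ω)) =
      MonoidHom.mrange (algebraMap K Ω : K →* Ω) := by
    rw [show Set.range (algebraMap K Ω) = (MonoidHom.mrange (algebraMap K Ω : K →* Ω) : Set Ω)
      from rfl, Submonoid.closure_eq]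
  rw [hcl] at hzS
  clear hz
  induction hzS using Submodule.span_induction with
  | mem x hx =>
    obtain ⟨a, rfl⟩ := hx
    have := Submodule.smul_mem (Submodule.span K (Set.range (algebraMap F Ω))) a
      (Submodule.subset_span ⟨1, rfl⟩)
    rwa [map_one, Algebra.smul_def, mul_one] at this
  | zero => exact zero_mem _
  | add x y _ _ hx hy => exact add_mem hx hy
  | smul f x hxs hx =>
    clear hxs
    induction hx using Submodule.span_induction with
    | mem y hy =>
      obtain ⟨g, rfl⟩ := hy
      exact Submodule.subset_span ⟨f * g, by rw [map_mul, Algebra.smul_def]⟩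
    | zero => rw [smul_zero]; exact zero_mem _
    | add y z _ _ hy hz => rw [smul_add]; exact add_mem hy hz
    | smul a y _ hy =>
      rw [show f • a • y = a • f • y by simp only [Algebra.smul_def]; ring]
      exact Submodule.smul_mem _ _ hy

/-- Galois descent for planes: a plane over `K` in `K F` that is stable under `Gal(Ω/F)` has a
basis in `F`, namely the basis dual to two coordinates with respect to a `k`-basis of `F`. -/
theorem exists_basis_of_stable_plane (hreg : algebraicClosure k F = ⊥) {p q : Ω}
    (hp : p ∈ IntermediateField.adjoin K (Set.range (algebraMap F Ω)))
    (hq : q ∈ IntermediateField.adjoin K (Set.range (algebraMap F Ω)))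
    (hind : LinearIndependent K ![p, q])
    (hstab : ∀ φ : Gal(Ω/F), ∃ a b c d : K, φ p = a • p + b • q ∧ φ q = c • p + d • q) :
    ∃ (v : Fin 2 → F) (a b c d : K), a * d - b * c ≠ 0 ∧
      algebraMap F Ω (v 0) = a • p + b • q ∧ algebraMap F Ω (v 1) = c • p + d • q := by
  let b := Module.Basis.ofVectorSpace k F
  have hb := linearIndependent_algebraMap_of_regular (Ω := Ω) hreg K b.linearIndependent
  have hspan : ∀ z ∈ IntermediateField.adjoin K (Set.range (algebraMap F Ω)),
      ∃ c, Finsupp.linearCombination K (fun i ↦ algebraMap F Ω (b i)) c = z := by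
    intro z hz
    have h1 : Submodule.span K (Set.range (algebraMap F Ω)) ≤
        Submodule.span K (Set.range fun i ↦ algebraMap F Ω (b i)) := by
      rw [Submodule.span_le]
      rintro _ ⟨f, rfl⟩
      rw [SetLike.mem_coe, ← b.linearCombination_repr f, Finsupp.linearCombination_apply,
        Finsupp.sum, map_sum]
      refine sum_mem fun i _ ↦ ?_
      rw [Algebra.smul_def, map_mul, ← IsScalarTower.algebraMap_apply,
        IsScalarTower.algebraMap_apply k K Ω, ← Algebra.smul_def]
      exact Submodule.smul_mem _ _ (Submodule.subset_span ⟨i, rfl⟩)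
    exact Finsupp.mem_span_range_iff_exists_finsupp.1 (h1 (mem_span_of_mem_adjoin hz))
  obtain ⟨P, hP⟩ := hspan p hp
  obtain ⟨Q, hQ⟩ := hspan q hq
  set Λ := Finsupp.linearCombination K (fun i ↦ algebraMap F Ω (b i)) with hΛ
  rw [LinearIndependent.pair_iff] at hind
  -- two coordinates that separate the points of the plane
  obtain ⟨i, j, hD⟩ : ∃ i j, P i * Q j - P j * Q i ≠ 0 := by
    by_contra! hcon
    have hP0 : P ≠ 0 := fun h ↦ by
      have := hind 1 0 (by rw [← hP, h, map_zero]; simp)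
      exact one_ne_zero this.1
    obtain ⟨i, hi⟩ := Finsupp.ne_iff.1 hP0
    have h1 : Q i • P = P i • Q := Finsupp.ext fun j ↦ by
      simp only [Finsupp.smul_apply, smul_eq_mul]
      linear_combination -hcon i j
    have h2 := hind (Q i) (- P i) (by
      rw [neg_smul, ← sub_eq_add_neg, sub_eq_zero, ← hP, ← hQ, ← map_smul, ← map_smul, h1])
    exact hi (neg_eq_zero.1 h2.2)
  -- an element of the plane whose two coordinates lie in `k` is fixed by `Gal(Ω/F)`
  have key : ∀ s t : K, ∀ x y : k, s * P i + t * Q i = algebraMap k K x →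
      s * P j + t * Q j = algebraMap k K y → ∃ f : F, algebraMap F Ω f = s • p + t • q := by
    intro s t x y hx hy
    refine InfiniteGalois.mem_bot_iff_fixed (k := F) (s • p + t • q) |>.2 fun φ ↦ ?_
    let φK := (φ.restrictScalars k).restrictNormal K
    have hφK : ∀ a : K, algebraMap K Ω (φK a) = φ (algebraMap K Ω a) :=
      (φ.restrictScalars k).restrictNormal_commutes K
    have hφs : ∀ (a : K) (z : Ω), φ (a • z) = φK a • φ z := fun a z ↦ by
      rw [Algebra.smul_def, Algebra.smul_def, map_mul φ, hφK]
    have hφΛ : ∀ c, φ (Λ c) = Λ (c.mapRange φK (map_zero φK)) := fun c ↦ by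
      rw [hΛ, Finsupp.linearCombination_apply, Finsupp.linearCombination_apply,
        Finsupp.sum_mapRange_index (by simp), Finsupp.sum, Finsupp.sum, map_sum]
      exact Finset.sum_congr rfl fun i _ ↦ by rw [hφs, φ.commutes]
    obtain ⟨α, β, γ, δ, h1, h2⟩ := hstab φ
    have h3 : s • p + t • q = Λ (s • P + t • Q) := by rw [map_add, map_smul, map_smul, hP, hQ]
    have h4 : φ (s • p + t • q) =
        Λ ((φK s * α + φK t * γ) • P + (φK s * β + φK t * δ) • Q) := by
      rw [map_add, hφs, hφs, h1, h2, map_add, map_smul, map_smul, hP, hQ]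
      module
    have h5 : (s • P + t • Q).mapRange φK (map_zero φK) =
        (φK s * α + φK t * γ) • P + (φK s * β + φK t * δ) • Q :=
      hb (by rw [← hΛ, ← hφΛ, ← h3, h4])
    set u := φK s * α + φK t * γ
    set w := φK s * β + φK t * δ
    have h6 := DFunLike.congr_fun h5 i
    have h7 := DFunLike.congr_fun h5 j
    simp only [Finsupp.mapRange_apply, Finsupp.add_apply, Finsupp.smul_apply, smul_eq_mul, hx, hy,
      AlgEquiv.commutes] at h6 h7
    rw [← hx] at h6
    rw [← hy] at h7
    have hu : u = s := by
      apply mul_right_cancel₀ hD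
      linear_combination (-Q j) * h6 + Q i * h7
    have hw : w = t := by
      apply mul_right_cancel₀ hD
      linear_combination (P j) * h6 - P i * h7
    rw [h4, hu, hw, h3]
  set D := P i * Q j - P j * Q i
  obtain ⟨f, hf⟩ := key (Q j / D) (- P j / D) 1 0
    (by rw [map_one]; field_simp; simp only [D]; ring) (by rw [map_zero]; field_simp; ring)
  obtain ⟨g, hg⟩ := key (- Q i / D) (P i / D) 0 1
    (by rw [map_zero]; field_simp; ring) (by rw [map_one]; field_simp; simp only [D]; ring)
  refine ⟨![f, g], _, _, _, _, ?_, hf, hg⟩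
  have : Q j / D * (P i / D) - - P j / D * (- Q i / D) = D⁻¹ := by
    field_simp; simp only [D]; ring
  rw [this]
  exact inv_ne_zero hD

end Descent

section LinearCoordinate

variable {k : Type*} [Field k] {F : Type*} [Field F] [Algebra (RatFunc k) F] [Algebra k F]
  [IsScalarTower k (RatFunc k) F]
  {Ω : Type*} [Field Ω] [Algebra k Ω] [Algebra F Ω] [IsScalarTower k F Ω] [IsGalois F Ω]
  [Algebra (RatFunc k) Ω] [IsScalarTower (RatFunc k) F Ω] [Normal (RatFunc k) Ω] [IsAlgClosed Ω]
  {K : Type*} [Field K] [Algebra k K] [Algebra K Ω] [IsScalarTower k K Ω] [Normal k K]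

/-- If `K F = K(p / q)` for a plane spanned by `p` and `q` over `K` that is stable under the
automorphisms of `Ω` over `k(T)`, then `F` has a linear coordinate: the plane descends to `F`. -/
theorem hasLinearCoordinate_of_stable_plane (hreg : algebraicClosure k F = ⊥) {p q : Ω}
    (hp : p ∈ IntermediateField.adjoin K (Set.range (algebraMap F Ω)))
    (hq : q ∈ IntermediateField.adjoin K (Set.range (algebraMap F Ω)))
    (hind : LinearIndependent K ![p, q])
    (hF : ∀ f : F, algebraMap F Ω f ∈ IntermediateField.adjoin K {p / q})
    (hstab : ∀ φ : Gal(Ω/RatFunc k),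
      ∃ a b c d : K, φ p = a • p + b • q ∧ φ q = c • p + d • q) :
    HasLinearCoordinate k F := by
  obtain ⟨v, a, b, c, d, hdet, h0, h1⟩ := exists_basis_of_stable_plane (K := K) hreg hp hq hind
    (fun φ ↦ hstab (φ.restrictScalars (RatFunc k)))
  have hpq := LinearIndependent.pair_iff.1 hind
  have hq0 : q ≠ 0 := fun h ↦ one_ne_zero (hpq 0 1 (by rw [h]; simp)).2
  set D := a * d - b * c with hD
  have hpv : D • p = d • algebraMap F Ω (v 0) - b • algebraMap F Ω (v 1) := by
    rw [h0, h1, hD]; module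
  have hqv : D • q = a • algebraMap F Ω (v 1) - c • algebraMap F Ω (v 0) := by
    rw [h0, h1, hD]; module
  have hvind : LinearIndependent K (fun j ↦ algebraMap F Ω (v j)) := by
    rw [Fintype.linearIndependent_iff]
    intro g hg
    simp only [Fin.sum_univ_two, h0, h1] at hg
    obtain ⟨h2, h3⟩ := hpq (g 0 * a + g 1 * c) (g 0 * b + g 1 * d) (by rw [← hg]; module)
    have e0 : g 0 * D = 0 := by rw [hD]; linear_combination d * h2 - c * h3
    have e1 : g 1 * D = 0 := by rw [hD]; linear_combination a * h3 - b * h2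
    intro j
    fin_cases j
    exacts [(mul_eq_zero.1 e0).resolve_right hdet, (mul_eq_zero.1 e1).resolve_right hdet]
  have hv1 : v 1 ≠ 0 := fun h ↦ hvind.ne_zero 1 (by simp [h])
  have hvk : LinearIndependent k v := by
    have : LinearIndependent k (fun j ↦ algebraMap F Ω (v j)) := hvind.restrict_scalars (by
      intro x y hxy
      simpa [Algebra.smul_def] using hxy)
    exact LinearIndependent.of_comp (IsScalarTower.toAlgHom k F Ω).toLinearMap this
  refine ⟨v, hv1, ?_, fun g j ↦ ?_⟩
  · rw [eq_top_iff]
    intro f _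
    -- `p / q` is a fractional linear function of `v₀ / v₁`
    have hsub : IntermediateField.adjoin K {p / q} ≤
        IntermediateField.adjoin K {algebraMap F Ω (v 0 / v 1)} := by
      rw [IntermediateField.adjoin_simple_le_iff]
      set x := algebraMap F Ω (v 0 / v 1) with hx
      have hv1' : algebraMap F Ω (v 1) ≠ 0 := by simpa using hv1
      have hDK : algebraMap K Ω D ≠ 0 := by simpa using hdet
      have : p / q = (algebraMap K Ω d * x - algebraMap K Ω b) /
          (algebraMap K Ω a - algebraMap K Ω c * x) := by
        have e : x * algebraMap F Ω (v 1) = algebraMap F Ω (v 0) := by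
          rw [hx, ← map_mul, div_mul_cancel₀ _ hv1]
        rw [← mul_div_mul_left p q hDK, ← Algebra.smul_def, ← Algebra.smul_def, hpv, hqv,
          ← mul_div_mul_right (algebraMap K Ω d * x - algebraMap K Ω b) _ hv1', sub_mul, sub_mul,
          mul_assoc, mul_assoc, e]
        simp only [Algebra.smul_def]
      rw [this]
      have hxm := IntermediateField.mem_adjoin_simple_self K x
      exact div_mem (sub_mem (mul_mem (IntermediateField.algebraMap_mem _ _) hxm)
        (IntermediateField.algebraMap_mem _ _)) (sub_mem (IntermediateField.algebraMap_mem _ _)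
          (mul_mem (IntermediateField.algebraMap_mem _ _) hxm))
    obtain ⟨P, Q, hPQ⟩ := IntermediateField.mem_adjoin_simple_iff K _ |>.1 (hsub (hF f))
    by_cases hQ : aeval (algebraMap F Ω (v 0 / v 1)) Q = 0
    · rw [hQ, div_zero, map_eq_zero] at hPQ
      rw [hPQ]
      exact zero_mem _
    · exact mem_adjoin_simple_of_regular hreg hQ (by rw [hPQ, div_mul_cancel₀ _ hQ])
  · apply mem_span_of_algebraMap_mem_span (K := K) (Ω := Ω) hreg hvk
    let φ : Gal(Ω/RatFunc k) := g.liftNormal Ω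
    have hφ : ∀ f, φ (algebraMap F Ω f) = algebraMap F Ω (g f) := g.liftNormal_commutes Ω
    have : IsScalarTower k (RatFunc k) Ω := IsScalarTower.of_algebraMap_eq fun a ↦ by
      rw [IsScalarTower.algebraMap_apply k F Ω, IsScalarTower.algebraMap_apply k (RatFunc k) F,
        ← IsScalarTower.algebraMap_apply (RatFunc k) F Ω]
    let φK := (φ.restrictScalars k).restrictNormal K
    have hφK : ∀ a : K, algebraMap K Ω (φK a) = φ (algebraMap K Ω a) :=
      (φ.restrictScalars k).restrictNormal_commutes K
    have hφs : ∀ (a : K) (z : Ω), φ (a • z) = φK a • φ z := fun a z ↦ by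
      rw [Algebra.smul_def, Algebra.smul_def, map_mul φ, hφK]
    set W := Submodule.span K (Set.range fun j ↦ algebraMap F Ω (v j))
    have hvW : ∀ j, algebraMap F Ω (v j) ∈ W := fun j ↦ Submodule.subset_span ⟨j, rfl⟩
    have hpW : p ∈ W := by
      rw [← inv_smul_smul₀ hdet p, hpv]
      exact W.smul_mem _ (W.sub_mem (W.smul_mem _ (hvW 0)) (W.smul_mem _ (hvW 1)))
    have hqW : q ∈ W := by
      rw [← inv_smul_smul₀ hdet q, hqv]
      exact W.smul_mem _ (W.sub_mem (W.smul_mem _ (hvW 1)) (W.smul_mem _ (hvW 0)))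
    obtain ⟨α, β, γ, δ, hφp, hφq⟩ := hstab φ
    have hφpq : ∀ s t : K, φ (s • p + t • q) ∈ W := fun s t ↦ by
      rw [map_add, hφs, hφs, hφp, hφq]
      exact W.add_mem (W.smul_mem _ (W.add_mem (W.smul_mem _ hpW) (W.smul_mem _ hqW)))
        (W.smul_mem _ (W.add_mem (W.smul_mem _ hpW) (W.smul_mem _ hqW)))
    rw [← hφ]
    fin_cases j
    · simp only [Fin.zero_eta, h0]
      exact hφpq a b
    · simp only [Fin.mk_one, h1]
      exact hφpq c d

end LinearCoordinate

/-! ### Linear coordinates from monomial actions -/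

section MonomialAction

theorem transcendental_of_mem_adjoin {k F Ω K : Type*} [Field k] [Field F] [Algebra (RatFunc k) F]
    [Algebra k F] [IsScalarTower k (RatFunc k) F] [Field Ω] [Algebra k Ω] [Algebra F Ω]
    [IsScalarTower k F Ω] [Field K] [Algebra k K] [Algebra K Ω] [IsScalarTower k K Ω]
    [Algebra.IsAlgebraic k K] {y : Ω}
    (hF : ∀ f : F, algebraMap F Ω f ∈ IntermediateField.adjoin K {y}) : Transcendental K y := by
  intro halg
  have h1 := IntermediateField.isAlgebraic_adjoin_simple halg.isIntegral
  have h2 : IsAlgebraic K (⟨_, hF (algebraMap (RatFunc k) F RatFunc.X)⟩ :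
      IntermediateField.adjoin K {y}) := h1.isAlgebraic _
  have h3 : IsAlgebraic K (algebraMap F Ω (algebraMap (RatFunc k) F RatFunc.X)) :=
    h2.algHom (IntermediateField.adjoin K {y}).val
  have h4 := h3.restrictScalars k
  rw [isAlgebraic_algebraMap_iff (algebraMap F Ω).injective] at h4
  exact transcendental_algebraMap_X (k := k) h4

variable {k : Type*} [Field k] {F : Type*} [Field F] [Algebra (RatFunc k) F] [Algebra k F]
  [IsScalarTower k (RatFunc k) F]
  {Ω : Type*} [Field Ω] [Algebra k Ω] [Algebra F Ω] [IsScalarTower k F Ω] [IsGalois F Ω]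
  [Algebra (RatFunc k) Ω] [IsScalarTower (RatFunc k) F Ω] [Normal (RatFunc k) Ω] [IsAlgClosed Ω]
  {K : Type*} [Field K] [Algebra k K] [Algebra K Ω] [IsScalarTower k K Ω] [Normal k K]

/-- If the automorphisms of `Ω` over `k(T)` act on a generator `y` of `K F` by scalars, the plane
spanned by `y` and `1` provides a linear coordinate. -/
theorem hasLinearCoordinate_of_scaling (hreg : algebraicClosure k F = ⊥) {y : Ω}
    (hy : y ∈ IntermediateField.adjoin K (Set.range (algebraMap F Ω)))
    (hF : ∀ f : F, algebraMap F Ω f ∈ IntermediateField.adjoin K {y})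
    (hact : ∀ φ : Gal(Ω/RatFunc k), ∃ c : K, φ y = c • y) :
    HasLinearCoordinate k F := by
  have htr := transcendental_of_mem_adjoin (k := k) hF
  refine hasLinearCoordinate_of_stable_plane (K := K) (p := y) (q := 1) hreg hy (one_mem _) ?_
    (by simpa using hF) fun φ ↦ ?_
  · rw [LinearIndependent.pair_symm_iff, LinearIndependent.pair_iff' one_ne_zero]
    intro a ha
    rw [Algebra.smul_def, mul_one] at ha
    exact htr (ha ▸ isAlgebraic_algebraMap a)
  · obtain ⟨c, hc⟩ := hact φ
    exact ⟨c, 0, 0, 1, by simp [hc], by simp⟩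

/-- If the automorphisms of `Ω` over `k(T)` map a generator `y` of `K F` to some `c y` or `c / y`,
where `c ^ (2 j + 1) = 1`, the plane spanned by `y ^ (j + 1) + y ^ (- j)` and
`y ^ j + y ^ (- (j + 1))` provides a linear coordinate: on it the roots of unity of odd order act
through their square roots. -/
theorem hasLinearCoordinate_of_dihedral (hreg : algebraicClosure k F = ⊥) {y : Ω} (j : ℕ)
    (hy : y ∈ IntermediateField.adjoin K (Set.range (algebraMap F Ω)))
    (hF : ∀ f : F, algebraMap F Ω f ∈ IntermediateField.adjoin K {y})
    (hact : ∀ φ : Gal(Ω/RatFunc k), ∃ c : K, c ^ (2 * j + 1) = 1 ∧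
      (φ y = c • y ∨ φ y = c • y⁻¹)) :
    HasLinearCoordinate k F := by
  have htr := transcendental_of_mem_adjoin (k := k) hF
  have hy0 : y ≠ 0 := fun h ↦ htr (h ▸ isAlgebraic_zero)
  set p := y ^ (j + 1) + (y ^ j)⁻¹ with hp
  set q := y ^ j + (y ^ (j + 1))⁻¹ with hq
  have hq0 : q ≠ 0 := by
    intro h0
    refine htr ⟨X ^ (2 * j + 1) + C 1, (monic_X_pow_add_C 1 (by omega)).ne_zero, ?_⟩
    have : aeval y (X ^ (2 * j + 1) + C 1 : K[X]) = q * y ^ (j + 1) := by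
      rw [hq, add_mul, inv_mul_cancel₀ (pow_ne_zero _ hy0)]
      simp only [map_add, map_pow, aeval_X, map_one]
      ring
    rw [this, h0, zero_mul]
  have hpq : p = y * q := by rw [hp, hq]; field_simp; ring
  refine hasLinearCoordinate_of_stable_plane (K := K) (p := p) (q := q) hreg ?_ ?_ ?_ ?_ fun φ ↦ ?_
  · exact add_mem (pow_mem hy _) (inv_mem (pow_mem hy _))
  · exact add_mem (pow_mem hy _) (inv_mem (pow_mem hy _))
  · rw [LinearIndependent.pair_symm_iff, LinearIndependent.pair_iff' hq0]
    intro a ha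
    rw [hpq, Algebra.smul_def] at ha
    exact htr (mul_right_cancel₀ hq0 ha ▸ isAlgebraic_algebraMap a)
  · rwa [hpq, mul_div_cancel_right₀ _ hq0]
  · obtain ⟨c, hc, h⟩ := hact φ
    set e := algebraMap K Ω c with he
    have hc0 : e ≠ 0 := fun h0 ↦ by
      have h1 := congrArg (algebraMap K Ω) hc
      rw [map_pow, ← he, h0, zero_pow (by omega), map_one] at h1
      exact zero_ne_one h1
    have he1 : e ^ (j + 1) * e ^ j = 1 := by
      rw [← pow_add, show j + 1 + j = 2 * j + 1 by omega, he, ← map_pow, hc, map_one]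
    -- the inverse of `c ^ j` is `c ^ (j + 1)`
    have e1 : (e ^ j)⁻¹ = e ^ (j + 1) := inv_eq_of_mul_eq_one_left he1
    have e2 : (e ^ (j + 1))⁻¹ = e ^ j := inv_eq_of_mul_eq_one_right he1
    have hφp : φ p = φ y ^ (j + 1) + (φ y ^ j)⁻¹ := by rw [hp, map_add, map_inv₀, map_pow, map_pow]
    have hφq : φ q = φ y ^ j + (φ y ^ (j + 1))⁻¹ := by rw [hq, map_add, map_inv₀, map_pow, map_pow]
    rcases h with h | h
    · refine ⟨c ^ (j + 1), 0, 0, c ^ j, ?_, ?_⟩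
      · rw [hφp, h, zero_smul, add_zero, Algebra.smul_def, Algebra.smul_def, map_pow, ← he, mul_pow,
          mul_pow, mul_inv, e1, hp]
        ring
      · rw [hφq, h, zero_smul, zero_add, Algebra.smul_def, Algebra.smul_def, map_pow, ← he, mul_pow,
          mul_pow, mul_inv, e2, hq]
        ring
    · refine ⟨0, c ^ (j + 1), c ^ j, 0, ?_, ?_⟩
      · rw [hφp, h, zero_smul, zero_add, Algebra.smul_def, Algebra.smul_def, map_pow, ← he, mul_pow,
          mul_pow, mul_inv, e1, hq, inv_pow, inv_pow, inv_inv]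
        ring
      · rw [hφq, h, zero_smul, add_zero, Algebra.smul_def, Algebra.smul_def, map_pow, ← he, mul_pow,
          mul_pow, mul_inv, e2, hp, inv_pow, inv_pow, inv_inv]
        ring

end MonomialAction

/-! ### Orders of vanishing of polynomials -/

section Valuations

variable {K : Type*} [Field K] {M : Type*} [Field M] [Algebra K M]

open WithZero in
/-- For a discrete valuation with uniformizer `S - θ` the value of a polynomial in `S` is given by
its order of vanishing at `θ`. -/
theorem valuation_aeval (v : Valuation M (WithZero (Multiplicative ℤ)))
    (hvK : ∀ a : K, a ≠ 0 → v (algebraMap K M a) = 1) {S : M} {θ : K}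
    (hS : v (S - algebraMap K M θ) = exp (-1 : ℤ)) {P : K[X]} (hP : P ≠ 0) :
    v (aeval S P) = exp (-(P.rootMultiplicity θ : ℤ)) := by
  have hvK' : ∀ a : K, v (algebraMap K M a) ≤ 1 := fun a ↦ by
    by_cases ha : a = 0
    · simp [ha]
    · exact (hvK a ha).le
  have hlt : (exp (-1 : ℤ) : WithZero (Multiplicative ℤ)) < 1 := by
    rw [← exp_zero, exp_lt_exp]; norm_num
  have hS1 : v S ≤ 1 := by
    have : S = (S - algebraMap K M θ) + algebraMap K M θ := by ring
    rw [this]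
    exact (v.map_add _ _).trans (max_le (hS ▸ hlt.le) (hvK' θ))
  have hpoly : ∀ R : K[X], v (aeval S R) ≤ 1 := by
    intro R
    rw [aeval_eq_sum_range]
    refine v.map_sum_le fun i _ ↦ ?_
    rw [Algebra.smul_def, map_mul, map_pow]
    exact mul_le_one' (hvK' _) (pow_le_one' hS1 _)
  set n := P.rootMultiplicity θ
  have h1 := P.pow_mul_divByMonic_rootMultiplicity_eq θ
  set R := P /ₘ (X - C θ) ^ P.rootMultiplicity θ
  have hR : R.eval θ ≠ 0 := eval_divByMonic_pow_rootMultiplicity_ne_zero θ hP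
  have hvR : v (aeval S R) = 1 := by
    have h2 := R.modByMonic_add_div (X - C θ)
    rw [modByMonic_X_sub_C_eq_C_eval] at h2
    rw [← h2, map_add, aeval_C, map_mul, map_sub, aeval_X, aeval_C]
    rw [v.map_add_eq_of_lt_left, hvK _ hR]
    rw [hvK _ hR, map_mul, hS]
    exact (mul_le_of_le_one_right' (hpoly _)).trans_lt hlt
  rw [← h1, map_mul, map_mul, hvR, mul_one, map_pow, map_pow, map_sub, aeval_X, aeval_C, hS,
    ← exp_nsmul]
  simp [n]

open WithZero in
theorem dvd_rootMultiplicity_of_pow_eq (v : Valuation M (WithZero (Multiplicative ℤ)))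
    (hvK : ∀ a : K, a ≠ 0 → v (algebraMap K M a) = 1) {S : M} {θ : K}
    (hS : v (S - algebraMap K M θ) = exp (-1 : ℤ)) {P : K[X]} (hP : P ≠ 0) {z : M} {m : ℕ}
    (hz : z ^ m = aeval S P) : m ∣ P.rootMultiplicity θ := by
  have h1 := valuation_aeval v hvK hS hP
  rw [← hz, map_pow] at h1
  by_cases hm : m = 0
  · rw [hm, pow_zero, ← exp_zero] at h1
    have := exp_injective h1
    simp only [zero_eq_neg, Nat.cast_eq_zero] at this
    rw [this]; exact dvd_zero _
  have hv0 : v z ≠ 0 := fun h0 ↦ by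
    rw [h0, zero_pow hm] at h1
    exact exp_ne_zero h1.symm
  rw [← exp_log hv0, ← exp_nsmul] at h1
  have := exp_injective h1
  rw [nsmul_eq_mul] at this
  exact Int.natCast_dvd_natCast.1 ⟨-log (v z), by linear_combination this⟩

end Valuations

/-! ### Kummer theory over a rational function field -/

section Kummer

/-- Over an algebraically closed field, a polynomial whose nonzero roots have multiplicities
divisible by `m` is an `m`-th power up to a power of `X`. -/
theorem exists_eq_X_pow_mul_pow {K : Type*} [Field K] [IsAlgClosed K] {P : K[X]} (hP : P ≠ 0)
    {m : ℕ} (hm : 0 < m) (h : ∀ θ ≠ 0, m ∣ P.rootMultiplicity θ) :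
    ∃ (e : ℕ) (Q : K[X]), Q ≠ 0 ∧ P = X ^ e * Q ^ m := by
  classical
  obtain ⟨c, hc⟩ := IsAlgClosed.exists_pow_nat_eq P.leadingCoeff hm
  have hc0 : c ≠ 0 := fun h0 ↦ by
    rw [h0, zero_pow hm.ne'] at hc
    exact leadingCoeff_ne_zero.2 hP hc.symm
  refine ⟨P.rootMultiplicity 0, C c * ∏ θ ∈ (insert 0 P.roots.toFinset).erase 0,
    (X - C θ) ^ (P.rootMultiplicity θ / m), ?_, ?_⟩
  · refine mul_ne_zero (C_ne_zero.2 hc0) (Finset.prod_ne_zero_iff.2 fun θ _ ↦ ?_)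
    exact pow_ne_zero _ (X_sub_C_ne_zero θ)
  · have h1 := (IsAlgClosed.splits P).eq_prod_roots
    rw [prod_multiset_root_eq_finset_root] at h1
    rw [mul_pow, ← C_pow, hc, ← Finset.prod_pow]
    have h2 : ∏ θ ∈ (insert 0 P.roots.toFinset).erase 0,
        ((X - C θ) ^ (P.rootMultiplicity θ / m)) ^ m =
        ∏ θ ∈ (insert 0 P.roots.toFinset).erase 0, (X - C θ) ^ P.rootMultiplicity θ :=
      Finset.prod_congr rfl fun θ hθ ↦ by
        rw [← pow_mul, Nat.div_mul_cancel (h θ (Finset.ne_of_mem_erase hθ))]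
    have h3 : X ^ P.rootMultiplicity 0 * ∏ θ ∈ (insert 0 P.roots.toFinset).erase 0,
        (X - C θ) ^ P.rootMultiplicity θ = ∏ θ ∈ P.roots.toFinset,
          (X - C θ) ^ P.rootMultiplicity θ := by
      have h4 := Finset.mul_prod_erase (insert 0 P.roots.toFinset)
        (fun θ ↦ (X - C θ) ^ P.rootMultiplicity θ) (Finset.mem_insert_self _ _)
      rw [C_0, sub_zero] at h4
      rw [h4]
      refine Finset.prod_insert_of_eq_one_if_notMem fun h0 ↦ ?_
      rw [rootMultiplicity_eq_zero, pow_zero]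
      intro hr
      exact h0 (Multiset.mem_toFinset.2 ((mem_roots hP).2 hr))
    rw [h2, mul_left_comm, h3]
    exact h1

variable {K : Type*} [Field K] [IsAlgClosed K]
  {N : Type*} [Field N] [Algebra K N] {M : Type*} [Field M] [Algebra K M] [Algebra N M]
  [IsScalarTower K N M] [FiniteDimensional N M]

/-- Kummer theory over a rational function field `N = K(S)`: a cyclic extension is generated by a
root of a polynomial in `S`. -/
theorem exists_pow_eq_aeval [CharZero K] [IsGalois N M] [IsCyclic Gal(M/N)] {S : N}
    (hS : IntermediateField.adjoin K {S} = ⊤) :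
    ∃ (z : M) (P : K[X]), P ≠ 0 ∧ z ^ Module.finrank N M = aeval (algebraMap N M S) P ∧
      IntermediateField.adjoin N {z} = ⊤ := by
  set m := Module.finrank N M with hm
  have hm0 : 0 < m := Module.finrank_pos
  have hroots : (primitiveRoots m N).Nonempty := by
    have : NeZero (m : K) := ⟨Nat.cast_ne_zero.2 hm0.ne'⟩
    obtain ⟨ζ, hζ⟩ := HasEnoughRootsOfUnity.exists_primitiveRoot K m
    exact ⟨algebraMap K N ζ, (mem_primitiveRoots hm0).2
      (hζ.map_of_injective (algebraMap K N).injective)⟩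
  obtain ⟨z, ⟨a, ha⟩, hz⟩ := exists_root_adjoin_eq_top_of_isCyclic N M hroots
  rw [← hm] at ha
  have haS : a ∈ IntermediateField.adjoin K {S} := hS ▸ trivial
  obtain ⟨r, s, hrs⟩ := IntermediateField.mem_adjoin_simple_iff K a |>.1 haS
  by_cases ha0 : a = 0
  · refine ⟨1, 1, one_ne_zero, by simp, ?_⟩
    rw [ha0, map_zero, eq_comm, pow_eq_zero_iff hm0.ne'] at ha
    rw [ha, IntermediateField.adjoin_zero] at hz
    rw [IntermediateField.adjoin_one, hz]
  · have hr : aeval S r ≠ 0 := fun h ↦ ha0 (by rw [hrs, h, zero_div])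
    have hs : aeval S s ≠ 0 := fun h ↦ ha0 (by rw [hrs, h, div_zero])
    refine ⟨z * algebraMap N M (aeval S s), r * s ^ (m - 1), ?_, ?_, ?_⟩
    · exact mul_ne_zero (fun h ↦ hr (by rw [h, map_zero]))
        (pow_ne_zero _ fun h ↦ hs (by rw [h, map_zero]))
    · rw [mul_pow, ← ha, ← map_pow, ← map_mul, aeval_algebraMap_apply]
      congr 1
      rw [map_mul, map_pow, hrs, ← Nat.sub_add_cancel hm0, pow_succ, Nat.add_sub_cancel]
      field_simp
    · rw [eq_top_iff, ← hz, IntermediateField.adjoin_simple_le_iff]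
      have h1 := div_mem (IntermediateField.mem_adjoin_simple_self N
        (z * algebraMap N M (aeval S s))) (IntermediateField.algebraMap_mem _ (aeval S s))
      rwa [mul_div_cancel_right₀ _ (by simpa using hs)] at h1

/-- If the multiplicities of the polynomial `P` at the points other than `0` are divisible by the
degree `m` of the Kummer extension generated by `P(S) ^ (1 / m)`, then this extension is generated
by an `m`-th root of `S`. -/
theorem exists_pow_eq_of_dvd_rootMultiplicity {S : N} (hS : IntermediateField.adjoin K {S} = ⊤)
    (hStr : Transcendental K S) {z : M} {P : K[X]} (hP : P ≠ 0)
    (hzP : z ^ Module.finrank N M = aeval (algebraMap N M S) P)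
    (hz : IntermediateField.adjoin N {z} = ⊤)
    (hdvd : ∀ θ ≠ 0, Module.finrank N M ∣ P.rootMultiplicity θ) :
    ∃ y : M, y ^ Module.finrank N M = algebraMap N M S ∧ IntermediateField.adjoin K {y} = ⊤ := by
  set m := Module.finrank N M with hm
  have hm0 : 0 < m := Module.finrank_pos
  obtain ⟨e, Q, hQ, rfl⟩ := exists_eq_X_pow_mul_pow hP hm0 hdvd
  have hS0 : S ≠ 0 := fun h ↦ hStr (h ▸ isAlgebraic_zero)
  set s := algebraMap N M S with hs
  have hs0 : s ≠ 0 := by simpa [hs] using hS0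
  have hQS : aeval S Q ≠ 0 := fun h ↦ hStr ⟨Q, hQ, h⟩
  have hQs : algebraMap N M (aeval S Q) ≠ 0 := by simpa using hQS
  set z₁ := z / algebraMap N M (aeval S Q) with hz₁
  have hz₁m : z₁ ^ m = s ^ e := by
    rw [hz₁, div_pow, hzP, map_mul, map_pow, map_pow, aeval_X, aeval_algebraMap_apply,
      mul_div_cancel_right₀ _ (pow_ne_zero _ hQs)]
  have hz₁top : IntermediateField.adjoin N {z₁} = ⊤ := by
    rw [eq_top_iff, ← hz, IntermediateField.adjoin_simple_le_iff]
    have h1 := mul_mem (IntermediateField.mem_adjoin_simple_self N z₁)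
      (IntermediateField.algebraMap_mem _ (aeval S Q))
    rwa [hz₁, div_mul_cancel₀ _ hQs] at h1
  have hz₁0 : z₁ ≠ 0 := fun h ↦ by
    rw [h, zero_pow hm0.ne'] at hz₁m
    exact pow_ne_zero _ hs0 hz₁m.symm
  -- a common divisor of `e` and `m` would lower the degree of `z₁` over `N`
  have hcop : Nat.Coprime e m := by
    set d := Nat.gcd e m with hd
    have hd0 : 0 < d := Nat.gcd_pos_of_pos_right _ hm0
    obtain ⟨m', hm'⟩ : d ∣ m := Nat.gcd_dvd_right _ _
    obtain ⟨e', he'⟩ : d ∣ e := Nat.gcd_dvd_left _ _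
    have hm'0 : 0 < m' := Nat.pos_of_mul_pos_left (hm' ▸ hm0)
    have h1 : (z₁ ^ m' / s ^ e') ^ d = 1 := by
      rw [div_pow, ← pow_mul, ← pow_mul, mul_comm m', mul_comm e', ← hm', ← he', hz₁m,
        div_self (pow_ne_zero _ hs0)]
    -- roots of unity are constants
    obtain ⟨ω, hω⟩ : ∃ ω : K, algebraMap K M ω = z₁ ^ m' / s ^ e' := by
      have : IsIntegral K (z₁ ^ m' / s ^ e') := ⟨X ^ d - C 1, monic_X_pow_sub_C 1 hd0.ne', by
        rw [← aeval_def]; simp [h1]⟩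
      have h2 := IsAlgClosed.degree_eq_one_of_irreducible K (minpoly.irreducible this)
      exact minpoly.mem_range_of_degree_eq_one K _ h2
    have h2 : z₁ ^ m' = algebraMap N M (algebraMap K N ω * S ^ e') := by
      rw [map_mul, ← IsScalarTower.algebraMap_apply, hω, map_pow, div_mul_cancel₀ _
        (pow_ne_zero _ hs0)]
    have h3 : m ≤ m' := by
      have hint : IsIntegral N z₁ := IsIntegral.of_finite N z₁
      rw [hm, ← IntermediateField.finrank_top', ← hz₁top, IntermediateField.adjoin.finrank hint]
      rw [← natDegree_X_pow_sub_C (n := m') (r := algebraMap K N ω * S ^ e')]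
      refine natDegree_le_of_dvd (minpoly.dvd _ _ ?_) (monic_X_pow_sub_C _ hm'0.ne').ne_zero
      rw [map_sub, map_pow, aeval_X, aeval_C, h2, sub_self]
    have h4 : d * m' ≤ 1 * m' := by rw [one_mul, ← hm']; exact h3
    have h5 := Nat.le_of_mul_le_mul_right h4 hm'0
    exact le_antisymm h5 hd0
  obtain ⟨a, b, hab⟩ := Nat.isCoprime_iff_coprime.2 hcop
  set y := z₁ ^ a * s ^ b with hy
  have hym : y ^ m = s := by
    have : y ^ m = (z₁ ^ m) ^ a * s ^ (b * m) := by
      rw [hy, mul_pow, ← zpow_natCast, ← zpow_natCast, ← zpow_mul, ← zpow_mul, ← zpow_natCast,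
        ← zpow_mul, mul_comm a]
    rw [this, hz₁m, ← zpow_natCast, ← zpow_mul, ← zpow_add₀ hs0, mul_comm (e : ℤ), hab, zpow_one]
  have hye : y ^ e = z₁ := by
    have h1 : y ^ e = z₁ ^ (a * e) * s ^ (b * e) := by
      rw [hy, mul_pow, ← zpow_natCast, ← zpow_natCast, ← zpow_mul, ← zpow_mul]
    have h2 : z₁ ^ (a * e) = z₁ * ((z₁ ^ m) ^ b)⁻¹ := by
      rw [show a * e = 1 - m * b by linear_combination hab, zpow_sub₀ hz₁0, zpow_one, zpow_mul,
        zpow_natCast, div_eq_mul_inv]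
    rw [h1, h2, hz₁m, ← zpow_natCast, ← zpow_mul, mul_comm (e : ℤ), mul_assoc,
      inv_mul_cancel₀ (zpow_ne_zero _ hs0), mul_one]
  refine ⟨y, hym, ?_⟩
  let J := IntermediateField.adjoin K {y}
  have hyJ : y ∈ J := IntermediateField.mem_adjoin_simple_self K y
  have hNJ : ∀ n : N, algebraMap N M n ∈ J := by
    intro n
    have h1 : IntermediateField.adjoin K {S} ≤ J.comap (IsScalarTower.toAlgHom K N M) := by
      rw [IntermediateField.adjoin_simple_le_iff]
      change s ∈ J
      rw [← hym]
      exact pow_mem hyJ m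
    exact h1 (hS ▸ trivial : n ∈ IntermediateField.adjoin K {S})
  let J' : IntermediateField N M := { J.toSubfield with algebraMap_mem' := hNJ }
  have h1 : IntermediateField.adjoin N {z₁} ≤ J' := by
    rw [IntermediateField.adjoin_simple_le_iff]
    change z₁ ∈ J
    rw [← hye]
    exact pow_mem hyJ e
  rw [hz₁top] at h1
  exact eq_top_iff.2 fun x _ ↦ h1 trivial

end Kummer

/-! ### Cyclic extensions unramified outside two points -/

section Coordinates

variable {K : Type*} [Field K] (M : Type*) [Field M] [Algebra K M]

/-- The element `S - θ` of `M` is a uniformizer of some discrete valuation of `M` that is trivial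
on the field of constants `K`. -/
def IsUniformizable (S : M) (θ : K) : Prop :=
  ∃ v : Valuation M (WithZero (Multiplicative ℤ)),
    (∀ a : K, a ≠ 0 → v (algebraMap K M a) = 1) ∧
      v (S - algebraMap K M θ) = WithZero.exp (-1 : ℤ)

variable {M}

theorem IsUniformizable.dvd_rootMultiplicity {S : M} {θ : K} (h : IsUniformizable M S θ)
    {P : K[X]} (hP : P ≠ 0) {z : M} {m : ℕ} (hz : z ^ m = aeval S P) :
    m ∣ P.rootMultiplicity θ := by
  obtain ⟨v, hvK, hv⟩ := h
  exact dvd_rootMultiplicity_of_pow_eq v hvK hv hP hz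

/-- A cyclic extension of the rational function field `K(S)` that is unramified outside `0` and `∞`
is generated by a root of `S`. -/
theorem exists_pow_eq_of_isCyclic [IsAlgClosed K] [CharZero K] {N : Type*} [Field N] [Algebra K N]
    [Algebra N M] [IsScalarTower K N M] [FiniteDimensional N M] [IsGalois N M]
    [IsCyclic Gal(M/N)] {S : N} (hS : IntermediateField.adjoin K {S} = ⊤)
    (hStr : Transcendental K S) (hunif : ∀ θ : K, θ ≠ 0 → IsUniformizable M (algebraMap N M S) θ) :
    ∃ y : M, y ^ Module.finrank N M = algebraMap N M S ∧ IntermediateField.adjoin K {y} = ⊤ := by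
  obtain ⟨z, P, hP, hzP, hz⟩ := exists_pow_eq_aeval (M := M) hS
  exact exists_pow_eq_of_dvd_rootMultiplicity hS hStr hP hzP hz fun θ hθ ↦
    (hunif θ hθ).dvd_rootMultiplicity hP hzP

end Coordinates

/-! ### Reversed polynomials -/

section Reverse

/-- The substitution `X ↦ 1 / X` fixes `1` and `-1`, so reversing a polynomial preserves its orders
of vanishing there. -/
theorem rootMultiplicity_reverse {K : Type*} [Field K] {P : K[X]} (hP : P ≠ 0) {θ : K}
    (hθ : θ * θ = 1) : P.reverse.rootMultiplicity θ = P.rootMultiplicity θ := by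
  have hθ0 : θ ≠ 0 := fun h ↦ by simp [h] at hθ
  have h1 := P.pow_mul_divByMonic_rootMultiplicity_eq θ
  set R := P /ₘ (X - C θ) ^ P.rootMultiplicity θ
  set n := P.rootMultiplicity θ
  have hR : R.eval θ ≠ 0 := eval_divByMonic_pow_rootMultiplicity_ne_zero θ hP
  have hR0 : R ≠ 0 := fun h ↦ hR (by rw [h, eval_zero])
  have hlin : (X - C θ).reverse = C (-θ) * (X - C θ) := by
    have : (X - C θ : K[X]).natDegree = 1 := natDegree_X_sub_C θ
    rw [reverse, this, reflect_sub, reflect_C]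
    simp only [reflect_one_X, C_neg, mul_sub, neg_mul, ← C_mul, hθ, pow_one, map_one]
    ring
  have hpow : ∀ i : ℕ, ((X - C θ) ^ i).reverse = C (-θ) ^ i * (X - C θ) ^ i := by
    intro i
    induction i with
    | zero => rw [pow_zero, pow_zero, one_mul, ← C_1, reverse_C]
    | succ i ih => rw [pow_succ, reverse_mul_of_domain, ih, hlin]; ring
  have hrev : R.reverse.eval θ ≠ 0 := by
    let _ : Invertible θ := invertibleOfNonzero hθ0
    have h2 := eval₂_reverse_mul_pow (RingHom.id K) θ R
    have h3 : (⅟θ : K) = θ := by rw [invOf_eq_inv]; exact inv_eq_of_mul_eq_one_left hθ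
    rw [h3] at h2
    intro h0
    rw [eval] at h0
    rw [h0, zero_mul] at h2
    exact hR h2.symm
  have hRrev0 : R.reverse ≠ 0 := fun h ↦ hrev (by rw [h, eval_zero])
  rw [← h1, reverse_mul_of_domain, hpow, mul_assoc, ← C_pow]
  have hne : (X - C θ) ^ n * R.reverse ≠ 0 := mul_ne_zero (pow_ne_zero _ (X_sub_C_ne_zero θ)) hRrev0
  rw [rootMultiplicity_mul (mul_ne_zero (C_ne_zero.2 (pow_ne_zero _ (neg_ne_zero.2 hθ0))) hne),
    rootMultiplicity_C, zero_add, rootMultiplicity_mul hne, rootMultiplicity_X_sub_C_pow,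
    rootMultiplicity_eq_zero (fun h ↦ hrev h), add_zero]

end Reverse

/-! ### Dihedral extensions unramified outside three points -/

section Dihedral

variable {K : Type*} [Field K] [CharZero K] {M : Type*} [Field M] [Algebra K M]

/-- An element some power of which is a constant is itself constant. -/
theorem exists_algebraMap_eq_of_pow_eq_one {K M : Type*} [Field K] [IsAlgClosed K] [Field M]
    [Algebra K M] {x : M} {m : ℕ} (hm : m ≠ 0) (hx : x ^ m = 1) :
    ∃ a : K, algebraMap K M a = x ∧ a ^ m = 1 := by
  have hint : IsIntegral K x := ⟨X ^ m - C 1, monic_X_pow_sub_C 1 hm, by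
    rw [← aeval_def]; simp [hx]⟩
  have h2 := IsAlgClosed.degree_eq_one_of_irreducible K (minpoly.irreducible hint)
  obtain ⟨a, ha⟩ := minpoly.mem_range_of_degree_eq_one K _ h2
  exact ⟨a, ha, (algebraMap K M).injective (by rw [map_pow, ha, hx, map_one])⟩

/-- Let `S` have branch points `0`, `∞` and `c`, and let `s² = S`. Over each point `β'` of the
`s`-line whose square is not a branch point, `s - β'` is a uniformizer of `M`. -/
theorem isUniformizable_sqrt {N : Type*} [Field N] [Algebra K N] [Algebra N M]
    [IsScalarTower K N M] {S : N} {c : K}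
    (hunif : ∀ θ : K, θ ≠ 0 → θ ≠ c → IsUniformizable M (algebraMap N M S) θ) {s : M}
    (hs : s ^ 2 = algebraMap N M S) {h : Gal(M/N)} (hh : h s = -s) {β : K} (hβ0 : β ≠ 0)
    (hβc : β ^ 2 ≠ c) : IsUniformizable M s β := by
  obtain ⟨v, hvK, hv⟩ := hunif (β ^ 2) (pow_ne_zero 2 hβ0) hβc
  have hlt : (WithZero.exp (-1 : ℤ) : WithZero (Multiplicative ℤ)) < 1 := by
    rw [← WithZero.exp_zero, WithZero.exp_lt_exp]; norm_num
  rw [← hs, map_pow] at hv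
  have hprod : v (s - algebraMap K M β) * v (s + algebraMap K M β) = WithZero.exp (-1 : ℤ) := by
    rw [← map_mul, ← hv]; congr 1; ring
  have hvβ := hvK β hβ0
  have hs1 : v s ≤ 1 := by
    have h1 : v (s ^ 2) ≤ 1 := by
      have e : s ^ 2 = (s ^ 2 - algebraMap K M β ^ 2) + algebraMap K M β ^ 2 := by ring
      rw [e]
      refine (v.map_add _ _).trans (max_le (hv ▸ hlt.le) ?_)
      rw [map_pow, hvβ, one_pow]
    rw [map_pow] at h1
    exact (pow_le_one_iff two_ne_zero).1 h1
  have h1 : v (s - algebraMap K M β) ≤ 1 := (v.map_sub _ _).trans (max_le hs1 hvβ.le)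
  have h2 : v (s + algebraMap K M β) ≤ 1 := (v.map_add _ _).trans (max_le hs1 hvβ.le)
  by_cases hlt1 : v (s + algebraMap K M β) = 1
  · exact ⟨v, hvK, by rw [← hprod, hlt1, mul_one]⟩
  · -- otherwise the conjugate valuation does it
    have h3 : v (s - algebraMap K M β) = 1 := by
      by_contra h4
      have h5 : v (algebraMap K M (2 * β)) < 1 := by
        have e : algebraMap K M (2 * β) = (s + algebraMap K M β) - (s - algebraMap K M β) := by
          rw [map_mul, map_ofNat]; ring
        rw [e]
        exact (v.map_sub _ _).trans_lt (max_lt (lt_of_le_of_ne h2 hlt1) (lt_of_le_of_ne h1 h4))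
      rw [hvK _ (mul_ne_zero two_ne_zero hβ0)] at h5
      exact lt_irrefl _ h5
    have hhK : ∀ a : K, h (algebraMap K M a) = algebraMap K M a := fun a ↦ by
      rw [IsScalarTower.algebraMap_apply K N M, h.commutes]
    refine ⟨v.comap (h : M →+* M), fun a ha ↦ ?_, ?_⟩
    · change v (h _) = 1
      rw [hhK, hvK a ha]
    · change v (h _) = _
      rw [map_sub, hh, hhK, ← hprod, h3, one_mul, ← v.map_neg]
      congr 1; ring

/-- The Cayley transform `(s - β) / (s + β)` carries uniformizers to uniformizers. -/
theorem IsUniformizable.cayley {s : M} {β θ : K} (hβ : β ≠ 0) (hθ : θ ≠ 1)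
    (h : IsUniformizable M s (β * (1 + θ) / (1 - θ))) :
    IsUniformizable M ((s - algebraMap K M β) / (s + algebraMap K M β)) θ := by
  have hθ1 : 1 - θ ≠ 0 := sub_ne_zero.2 (Ne.symm hθ)
  obtain ⟨v, hvK, hv⟩ := h
  set β' := β * (1 + θ) / (1 - θ) with hβ'
  have hsum : β' + β ≠ 0 := by
    have : β' + β = 2 * β / (1 - θ) := by rw [hβ']; field_simp; ring
    rw [this]
    exact div_ne_zero (mul_ne_zero two_ne_zero hβ) hθ1
  have h1 : v (s + algebraMap K M β) = 1 := by
    have e : s + algebraMap K M β = (s - algebraMap K M β') + algebraMap K M (β' + β) := by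
      rw [map_add]; ring
    rw [e, v.map_add_eq_of_lt_right, hvK _ hsum]
    rw [hvK _ hsum, hv, ← WithZero.exp_zero, WithZero.exp_lt_exp]
    norm_num
  have h0 : s + algebraMap K M β ≠ 0 := fun h0 ↦ by simp [h0] at h1
  have e : (s - algebraMap K M β) / (s + algebraMap K M β) - algebraMap K M θ =
      algebraMap K M (1 - θ) * (s - algebraMap K M β') / (s + algebraMap K M β) := by
    have h2 : algebraMap K M (1 - θ) * algebraMap K M β' =
        algebraMap K M β * (1 + algebraMap K M θ) := by
      rw [← map_mul, hβ', mul_div_cancel₀ _ hθ1, map_mul, map_add, map_one]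
    rw [div_sub' h0, mul_sub, h2, map_sub, map_one]
    congr 1; ring
  refine ⟨v, hvK, ?_⟩
  rw [e, map_div₀, map_mul, hvK _ hθ1, h1, one_mul, div_one, hv]

/-- The analogue of `exists_pow_eq_of_isCyclic` for a generalized dihedral extension of odd degree
`m` over its quadratic subextension: with branch points `0`, `∞` and `c = β²` on the `S`-line, it is
generated by an `m`-th root of `(s - β) / (s + β)`, where `s² = S`. -/
theorem exists_pow_eq_of_dihedral [IsAlgClosed K] {N : Type*} [Field N] [Algebra K N]
    [Algebra N M] [IsScalarTower K N M] [FiniteDimensional N M] [IsGalois N M]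
    {S : N} (hS : IntermediateField.adjoin K {S} = ⊤)
    (hStr : Transcendental K S) {c : K} (hc : c ≠ 0)
    (hunif : ∀ θ : K, θ ≠ 0 → θ ≠ c → IsUniformizable M (algebraMap N M S) θ) {s : M}
    (hs : s ^ 2 = algebraMap N M S)
    (hcyc : ∀ R : Subgroup Gal(M/N), (∀ σ ∈ R, σ s = s) → IsCyclic R ∧ Odd (Nat.card R))
    (hinv : ∀ σ h : Gal(M/N), σ s = s → h s ≠ s → h⁻¹ * σ * h = σ⁻¹)
    (hex : ∃ h : Gal(M/N), h s ≠ s) :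
    ∃ (β : K) (j : ℕ) (y : M), β ^ 2 = c ∧
      y ^ (2 * j + 1) = (s - algebraMap K M β) / (s + algebraMap K M β) ∧
      IntermediateField.adjoin K {y} = ⊤ := by
  obtain ⟨β, hβ⟩ := IsAlgClosed.exists_pow_nat_eq c two_pos
  have hβ0 : β ≠ 0 := fun h0 ↦ hc (by rw [← hβ, h0]; simp)
  have hpm : ∀ σ : Gal(M/N), σ s = s ∨ σ s = -s := fun σ ↦ by
    rw [← sq_eq_sq_iff_eq_or_eq_neg, ← map_pow, hs, σ.commutes]
  obtain ⟨h, hh'⟩ := hex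
  have hh : h s = -s := (hpm h).resolve_left hh'
  have hKfix : ∀ (σ : Gal(M/N)) (a : K), σ (algebraMap K M a) = algebraMap K M a := fun σ a ↦ by
    rw [IsScalarTower.algebraMap_apply K N M, σ.commutes]
  have hstr : Transcendental K s := fun halg ↦ hStr (by
    have := halg.pow 2
    rwa [hs, isAlgebraic_algebraMap_iff (algebraMap N M).injective] at this)
  have hsne : ∀ a : K, s ≠ algebraMap K M a := fun a ha ↦ hstr (ha ▸ isAlgebraic_algebraMap a)
  -- the quadratic subextension and its coordinate `Z`
  let N₁ : IntermediateField N M := IntermediateField.adjoin N {s}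
  have hmemfix : ∀ σ : Gal(M/N), σ ∈ N₁.fixingSubgroup ↔ σ s = s := fun σ ↦ by
    rw [IntermediateField.mem_fixingSubgroup_iff]
    constructor
    · exact fun hσ ↦ hσ s (IntermediateField.mem_adjoin_simple_self N s)
    · intro hσ x hx
      have h1 : N₁ ≤ IntermediateField.fixedField (Subgroup.zpowers σ) := by
        rw [IntermediateField.adjoin_simple_le_iff, IntermediateField.mem_fixedField_iff]
        intro f hf
        have h2 : Subgroup.zpowers σ ≤ MulAction.stabilizer Gal(M/N) s := by
          rw [Subgroup.zpowers_le]; exact hσ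
        exact h2 hf
      exact (IntermediateField.mem_fixedField_iff _ x).1 (h1 hx) σ (Subgroup.mem_zpowers σ)
  obtain ⟨hcycN, hoddN⟩ := hcyc N₁.fixingSubgroup fun σ hσ ↦ (hmemfix σ).1 hσ
  have : IsCyclic Gal(M/N₁) :=
    isCyclic_of_surjective (IntermediateField.fixingSubgroupEquiv N₁)
      (IntermediateField.fixingSubgroupEquiv N₁).surjective
  have hodd : Odd (Module.finrank N₁ M) := by
    rwa [← IsGalois.card_fixingSubgroup_eq_finrank]
  obtain ⟨j, hj⟩ := hodd
  have hsN₁ : s ∈ N₁ := IntermediateField.mem_adjoin_simple_self N s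
  have hKN₁ : ∀ a : K, algebraMap K M a ∈ N₁ := fun a ↦ by
    rw [IsScalarTower.algebraMap_apply K N M]
    exact N₁.algebraMap_mem _
  have hden : s + algebraMap K M β ≠ 0 := fun h0 ↦
    hsne (-β) (by rw [map_neg]; exact eq_neg_of_add_eq_zero_left h0)
  have hnum : s - algebraMap K M β ≠ 0 := fun h0 ↦ hsne β (sub_eq_zero.1 h0)
  set ζ := (s - algebraMap K M β) / (s + algebraMap K M β) with hζ
  have hζ0 : ζ ≠ 0 := div_ne_zero hnum hden
  have : IsScalarTower K N₁ M := IsScalarTower.of_algebraMap_eq fun _ ↦ rfl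
  let Z : N₁ := ⟨ζ, div_mem (sub_mem hsN₁ (hKN₁ β)) (add_mem hsN₁ (hKN₁ β))⟩
  have hZM : algebraMap N₁ M Z = ζ := rfl
  have hhζ : h ζ = ζ⁻¹ := by
    rw [hζ, map_div₀, map_sub, map_add, hh, hKfix, inv_div, ← neg_div_neg_eq]
    congr 1 <;> ring
  have hβM : algebraMap K M β ≠ 0 := by simpa using hβ0
  have hsζ : s = algebraMap K M β * (1 + ζ) / (1 - ζ) := by
    have h1 : 1 + ζ = 2 * s / (s + algebraMap K M β) := by rw [hζ]; field_simp; ring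
    have h2 : 1 - ζ = 2 * algebraMap K M β / (s + algebraMap K M β) := by
      rw [hζ]; field_simp; ring
    have : (2 : M) ≠ 0 := by
      have : CharZero M := charZero_of_injective_algebraMap (algebraMap K M).injective
      exact two_ne_zero
    rw [h1, h2]; field_simp
  have hsJ : s ∈ IntermediateField.adjoin K {ζ} := by
    have hζJ := IntermediateField.mem_adjoin_simple_self K ζ
    have := div_mem (mul_mem ((IntermediateField.adjoin K {ζ}).algebraMap_mem β)
      (add_mem (one_mem _) hζJ)) (sub_mem (one_mem _) hζJ)
    rwa [← hsζ] at this
  have hZtop : IntermediateField.adjoin K {Z} = ⊤ := by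
    let J := IntermediateField.adjoin K {ζ}
    have hNJ : ∀ n : N, algebraMap N M n ∈ J := by
      intro n
      have h1 : IntermediateField.adjoin K {S} ≤ J.comap (IsScalarTower.toAlgHom K N M) := by
        rw [IntermediateField.adjoin_simple_le_iff]
        change algebraMap N M S ∈ J
        rw [← hs]
        exact pow_mem hsJ 2
      exact h1 (hS ▸ trivial : n ∈ IntermediateField.adjoin K {S})
    let J' : IntermediateField N M := { J.toSubfield with algebraMap_mem' := hNJ }
    have h1 : N₁ ≤ J' := by
      rw [IntermediateField.adjoin_simple_le_iff]
      exact hsJ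
    refine eq_top_iff.2 fun x _ ↦ ?_
    have h2 : (IntermediateField.adjoin K {Z}).map (IsScalarTower.toAlgHom K N₁ M) = J := by
      rw [IntermediateField.adjoin_map, Set.image_singleton]
      rfl
    have h3 : (x : M) ∈ J := h1 x.2
    rw [← h2] at h3
    obtain ⟨x', hx', hxx'⟩ := h3
    exact (Subtype.ext hxx' : x' = x) ▸ hx'
  have hζtr : Transcendental K ζ := fun halg ↦ hstr (by
    have : Algebra.IsAlgebraic K (IntermediateField.adjoin K {ζ}) :=
      IntermediateField.isAlgebraic_adjoin fun x hx ↦ by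
        rw [Set.mem_singleton_iff.1 hx]; exact halg.isIntegral
    exact IntermediateField.isAlgebraic_iff.1
      (Algebra.IsAlgebraic.isAlgebraic (⟨s, hsJ⟩ : IntermediateField.adjoin K {ζ})))
  have hZtr : Transcendental K Z := fun halg ↦ hζtr (halg.algebraMap (A := M))
  obtain ⟨z, P, hP, hzP, hz⟩ := exists_pow_eq_aeval (M := M) hZtop
  rw [hZM, hj] at hzP
  have hne : ∀ {Q : K[X]}, Q ≠ 0 → aeval ζ Q ≠ 0 := fun hQ h0 ↦ hζtr ⟨_, hQ, h0⟩
  have haev : ∀ (σ : Gal(M/N)) (x : M) (Q : K[X]), σ (aeval x Q) = aeval (σ x) Q := fun σ x Q ↦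
    (aeval_algHom_apply ((σ : M →ₐ[N] M).restrictScalars K) x Q).symm
  have hz0 : z ≠ 0 := fun h0 ↦ hne hP (by rw [← hzP, h0, zero_pow (by simp)])
  have hz0' : h z ≠ 0 := by simpa using hz0
  -- `z * h z` is fixed by the automorphisms over the quadratic subextension
  have hw : z * h z ∈ N₁ := by
    rw [← IsGalois.fixedField_fixingSubgroup N₁, IntermediateField.mem_fixedField_iff]
    intro σ hσ
    have hσζ : σ ζ = ζ := (IntermediateField.mem_fixingSubgroup_iff N₁ σ).1 hσ ζ Z.2
    obtain ⟨ω, hω, -⟩ : ∃ ω : K, algebraMap K M ω = σ z / z ∧ ω ^ (2 * j + 1) = 1 :=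
      exists_algebraMap_eq_of_pow_eq_one (Nat.succ_ne_zero _) (by
        rw [div_pow, ← map_pow, hzP, haev, hσζ, div_self (hne hP)])
    have h1 : σ z = algebraMap K M ω * z := by rw [hω, div_mul_cancel₀ _ hz0]
    have hω0 : algebraMap K M ω ≠ 0 := by
      rw [hω]; exact div_ne_zero (by simpa using hz0) hz0
    have h2 : σ⁻¹ z = (algebraMap K M ω)⁻¹ * z := by
      rw [eq_inv_mul_iff_mul_eq₀ hω0, ← hKfix σ⁻¹ ω, ← map_mul, ← h1]
      exact AlgEquiv.symm_apply_apply σ z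
    have h3 : σ (h z) = h (σ⁻¹ z) := by
      rw [← hinv σ h ((hmemfix σ).1 hσ) hh', AlgEquiv.mul_apply, AlgEquiv.mul_apply]
      exact (AlgEquiv.apply_symm_apply h _).symm
    rw [map_mul, h3, h1, h2, map_mul, map_inv₀, hKfix]
    field_simp
  have hhP : h (aeval ζ P) * ζ ^ P.natDegree = aeval ζ P.reverse := by
    let _ : Invertible ζ⁻¹ := invertibleOfNonzero (inv_ne_zero hζ0)
    have h1 := eval₂_reverse_mul_pow (algebraMap K M) ζ⁻¹ P
    rw [invOf_eq_inv, inv_inv, ← aeval_def, ← aeval_def, inv_pow] at h1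
    rw [haev, hhζ, ← h1, inv_mul_cancel_right₀ (pow_ne_zero _ hζ0)]
  -- Dividing `z` by its conjugate makes the multiplicities at `ζ = 1` and `ζ = -1` divisible by the
  -- degree. These points lie over the branch points `0` and `∞`, where no valuation is at hand.
  set z' := z / h z * aeval ζ P.reverse with hz'
  have hrev : P.reverse ≠ 0 := by simpa using hP
  have hP' : P * X ^ P.natDegree * P.reverse ^ (2 * j) ≠ 0 :=
    mul_ne_zero (mul_ne_zero hP (pow_ne_zero _ X_ne_zero)) (pow_ne_zero _ hrev)
  have hz'P : z' ^ (2 * j + 1) = aeval ζ (P * X ^ P.natDegree * P.reverse ^ (2 * j)) := by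
    rw [hz', mul_pow, div_pow, ← map_pow, hzP, map_mul, map_mul, map_pow, map_pow, aeval_X,
      pow_succ _ (2 * j)]
    nth_rewrite 2 [← hhP]
    have : h (aeval ζ P) ≠ 0 := by simpa using hne hP
    field_simp
  have hz'top : IntermediateField.adjoin N₁ {z'} = ⊤ := by
    rw [eq_top_iff, ← hz, IntermediateField.adjoin_simple_le_iff]
    set J := IntermediateField.adjoin N₁ {z'}
    have hζJ : ∀ Q : K[X], aeval ζ Q ∈ J := fun Q ↦ by
      rw [← hZM, aeval_algebraMap_apply]
      exact J.algebraMap_mem _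
    have h1 : z / h z ∈ J := by
      have := div_mem (IntermediateField.mem_adjoin_simple_self N₁ z') (hζJ P.reverse)
      rwa [hz', mul_div_cancel_right₀ _ (hne hrev)] at this
    have h2 : z ^ 2 ∈ J := by
      have := mul_mem h1 (J.algebraMap_mem ⟨_, hw⟩)
      change z / h z * (z * h z) ∈ J at this
      convert this using 1
      field_simp
    have h3 : z = aeval ζ P / (z ^ 2) ^ j := by
      rw [← hzP]; field_simp; ring
    rw [h3]
    exact div_mem (hζJ P) (pow_mem h2 j)
  obtain ⟨y, hy, hytop⟩ := exists_pow_eq_of_dvd_rootMultiplicity hZtop hZtr hP'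
    (by rw [hj]; exact hz'P) hz'top fun θ hθ ↦ by
      rw [hj]
      by_cases hθ1 : θ * θ = 1
      · classical
        have hpow : (P.reverse ^ (2 * j)).rootMultiplicity θ = 2 * j * P.rootMultiplicity θ := by
          rw [← count_roots, roots_pow, Multiset.count_nsmul, count_roots,
            rootMultiplicity_reverse hP hθ1]
        rw [rootMultiplicity_mul hP', rootMultiplicity_mul (mul_ne_zero hP
          (pow_ne_zero _ X_ne_zero)), hpow, rootMultiplicity_eq_zero (p := X ^ _) (by simp [hθ])]
        exact ⟨P.rootMultiplicity θ, by ring⟩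
      · have h1 : θ ≠ 1 := fun h0 ↦ hθ1 (by rw [h0, one_mul])
        have h2 : 1 - θ ≠ 0 := sub_ne_zero.2 (Ne.symm h1)
        have h3 : 1 + θ ≠ 0 := fun h0 ↦ hθ1 (by rw [eq_neg_of_add_eq_zero_right h0]; ring)
        refine ((isUniformizable_sqrt hunif hs hh (div_ne_zero (mul_ne_zero hβ0 h3) h2)
          fun h0 ↦ hθ ?_).cayley hβ0 h1).dvd_rootMultiplicity hP' hz'P
        rw [← hβ, div_pow, mul_pow, div_eq_iff (pow_ne_zero 2 h2)] at h0
        have h4 : β ^ 2 * 4 * θ = 0 := by linear_combination h0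
        simpa [hβ0] using h4
  exact ⟨β, j, y, hβ, by rw [← hj, hy, hZM], hytop⟩

end Dihedral

/-! ### Coordinates on the projective line and branch points -/

section PointForms

variable {K : Type*} [Field K]

/-- The linear form `T - t U` (or `U`, for `t = ∞`) that vanishes at the point `t` of `ℙ¹(K)`,
dehomogenized at `U = 1`. With this choice no point plays a special role in `pointRatio`. -/
noncomputable def pointForm : OnePoint K → RatFunc K
  | ∞ => 1
  | (t : K) => RatFunc.X - RatFunc.C t

theorem pointForm_infty : pointForm (∞ : OnePoint K) = 1 := rfl

theorem pointForm_coe (t : K) : pointForm (t : OnePoint K) = RatFunc.X - RatFunc.C t := rfl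

/-- The coordinate on `ℙ¹(K)` with its zero at `b₁` and its pole at `b₂`. -/
noncomputable def pointRatio (b₁ b₂ : OnePoint K) : RatFunc K := pointForm b₁ / pointForm b₂

theorem eq_zero_of_C_mul_X_add_C {p q : K} (h : RatFunc.C p * RatFunc.X + RatFunc.C q = 0) :
    p = 0 ∧ q = 0 := by
  have h1 : algebraMap K[X] (RatFunc K) (C p * X + C q) = 0 := by
    simpa [RatFunc.algebraMap_C, RatFunc.algebraMap_X] using h
  have h2 : C p * X + C q = 0 := (map_eq_zero_iff _ (RatFunc.algebraMap_injective K)).1 h1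
  constructor
  · simpa using congrArg (coeff · 1) h2
  · simpa using congrArg (coeff · 0) h2

theorem pointForm_ne_zero (t : OnePoint K) : pointForm t ≠ 0 := by
  induction t using OnePoint.rec with
  | infty => exact one_ne_zero
  | coe x =>
    intro h
    refine one_ne_zero (eq_zero_of_C_mul_X_add_C (p := (1 : K)) (q := -x) ?_).1
    rw [← h, pointForm_coe, map_one, map_neg]; ring

theorem eq_of_pointForm_eq_mul {b b' : OnePoint K} {a : K}
    (h : pointForm b = RatFunc.C a * pointForm b') : b = b' := by
  induction b using OnePoint.rec with
  | infty =>
    induction b' using OnePoint.rec with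
    | infty => rfl
    | coe y =>
      rw [pointForm_infty, pointForm_coe] at h
      obtain ⟨h1, h2⟩ := eq_zero_of_C_mul_X_add_C (p := a) (q := -(a * y) - 1) (by
        rw [map_sub, map_neg, map_mul, map_one]; linear_combination -h)
      simp [h1] at h2
  | coe x =>
    induction b' using OnePoint.rec with
    | infty =>
      rw [pointForm_infty, pointForm_coe] at h
      exact absurd (eq_zero_of_C_mul_X_add_C (p := 1) (q := -x - a) (by
        rw [map_sub, map_neg, map_one]; linear_combination h)).1 one_ne_zero
    | coe y =>
      rw [pointForm_coe, pointForm_coe] at h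
      obtain ⟨h1, h2⟩ := eq_zero_of_C_mul_X_add_C (p := 1 - a) (q := -x + a * y) (by
        rw [map_sub, map_add, map_neg, map_mul, map_one]; linear_combination h)
      rw [OnePoint.coe_eq_coe]
      rw [sub_eq_zero] at h1
      rw [← h1] at h2
      linear_combination -h2

/-- Every member of the pencil spanned by two point forms is again a point form, up to a scalar. -/
theorem exists_pointForm_sub_eq {b₁ b₂ : OnePoint K} (hb : b₁ ≠ b₂) (θ : K) :
    ∃ (t : OnePoint K) (a : K), a ≠ 0 ∧
      pointForm b₁ - RatFunc.C θ * pointForm b₂ = RatFunc.C a * pointForm t := by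
  have hC : ∀ a : K, a ≠ 0 → RatFunc.C a ≠ 0 := fun a ha ↦ by simpa using ha
  induction b₁ using OnePoint.rec with
  | infty =>
    induction b₂ using OnePoint.rec with
    | infty => exact absurd rfl hb
    | coe y =>
      by_cases hθ : θ = 0
      · exact ⟨∞, 1, one_ne_zero, by simp [hθ]⟩
      refine ⟨((y + θ⁻¹ : K) : OnePoint K), -θ, neg_ne_zero.2 hθ, ?_⟩
      have := hC θ hθ
      simp only [pointForm_infty, pointForm_coe, map_neg, map_add, map_inv₀]
      field_simp; ring
  | coe x =>
    induction b₂ using OnePoint.rec with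
    | infty =>
      refine ⟨((x + θ : K) : OnePoint K), 1, one_ne_zero, ?_⟩
      simp only [pointForm_infty, pointForm_coe, map_one, map_add]
      ring
    | coe y =>
      by_cases hθ : θ = 1
      · refine ⟨∞, y - x, sub_ne_zero.2 fun h ↦ hb (by rw [h]), ?_⟩
        simp only [pointForm_infty, pointForm_coe, map_sub, hθ, map_one]
        ring
      · have hθ' : 1 - θ ≠ 0 := sub_ne_zero.2 (Ne.symm hθ)
        refine ⟨(((x - θ * y) / (1 - θ) : K) : OnePoint K), 1 - θ, hθ', ?_⟩
        have := hC _ hθ'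
        simp only [pointForm_coe, mul_sub, ← map_mul, mul_div_cancel₀ _ hθ']
        simp only [map_sub, map_mul, map_one]
        ring

/-- The value of the coordinate with zero `b₁` and pole `b₂` at a third point. -/
theorem exists_pointForm_sub_eq_of_ne {b₁ b₂ b₃ : OnePoint K} (h12 : b₁ ≠ b₂) (h13 : b₁ ≠ b₃)
    (h23 : b₂ ≠ b₃) : ∃ c a : K, c ≠ 0 ∧ a ≠ 0 ∧
      pointForm b₁ - RatFunc.C c * pointForm b₂ = RatFunc.C a * pointForm b₃ := by
  suffices h : ∃ c a : K,
      pointForm b₁ - RatFunc.C c * pointForm b₂ = RatFunc.C a * pointForm b₃ by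
    obtain ⟨c, a, h⟩ := h
    refine ⟨c, a, fun hc ↦ h13 (eq_of_pointForm_eq_mul (a := a) ?_),
      fun ha ↦ h12 (eq_of_pointForm_eq_mul (a := c) ?_), h⟩
    · rw [← h, hc]; simp
    · rw [← sub_eq_zero, h, ha]; simp
  induction b₃ using OnePoint.rec with
  | infty =>
    induction b₁ using OnePoint.rec with
    | infty => exact absurd rfl h13
    | coe x =>
      induction b₂ using OnePoint.rec with
      | infty => exact absurd rfl h23
      | coe y =>
        refine ⟨1, y - x, ?_⟩
        simp only [pointForm_infty, pointForm_coe, map_sub, map_one]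
        ring
  | coe z =>
    -- the value of a point form at `z`
    let ev : OnePoint K → K := OnePoint.rec 1 fun x ↦ z - x
    have hev : ∀ b : OnePoint K, ∃ a : K, pointForm b = RatFunc.C (ev b) +
        RatFunc.C a * pointForm (z : OnePoint K) := fun b ↦ by
      induction b using OnePoint.rec with
      | infty => exact ⟨0, by
          change (1 : RatFunc K) = RatFunc.C 1 + _
          simp⟩
      | coe x => exact ⟨1, by
          change _ = RatFunc.C (z - x) + _
          rw [pointForm_coe, pointForm_coe, map_sub, map_one]; ring⟩
    obtain ⟨a₁, h1⟩ := hev b₁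
    obtain ⟨a₂, h2⟩ := hev b₂
    have h0 : ev b₂ ≠ 0 := fun h0 ↦ h23 (eq_of_pointForm_eq_mul (a := a₂) (by
      rw [h2, h0, map_zero, zero_add]))
    refine ⟨ev b₁ / ev b₂, a₁ - ev b₁ / ev b₂ * a₂, ?_⟩
    rw [h1, h2, mul_add, ← map_mul, div_mul_cancel₀ _ h0, map_sub, map_mul]
    ring

theorem eq_of_pointForm_sub_eq {b₁ b₂ b₃ : OnePoint K} (h23 : b₂ ≠ b₃) {c c' a a' : K}
    (h : pointForm b₁ - RatFunc.C c * pointForm b₂ = RatFunc.C a * pointForm b₃)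
    (h' : pointForm b₁ - RatFunc.C c' * pointForm b₂ = RatFunc.C a' * pointForm b₃) : c = c' := by
  by_contra hne
  have h0 : RatFunc.C (c - c') ≠ 0 := (_root_.map_ne_zero _).2 (sub_ne_zero.2 hne)
  refine h23 (eq_of_pointForm_eq_mul (a := (a' - a) / (c - c')) ?_)
  rw [map_div₀, div_mul_eq_mul_div, eq_div_iff h0, map_sub, map_sub]
  linear_combination h' - h

theorem adjoin_pointRatio {b₁ b₂ : OnePoint K} (hb : b₁ ≠ b₂) :
    IntermediateField.adjoin K {pointRatio b₁ b₂} = ⊤ := by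
  set J := IntermediateField.adjoin K {pointRatio b₁ b₂}
  have hJ : pointRatio b₁ b₂ ∈ J := IntermediateField.mem_adjoin_simple_self K _
  have hC : ∀ a : K, RatFunc.C a ∈ J := fun a ↦ by
    rw [← RatFunc.algebraMap_eq_C]; exact J.algebraMap_mem a
  suffices h : RatFunc.X ∈ J by
    rw [eq_top_iff, ← RatFunc.adjoin_X, IntermediateField.adjoin_simple_le_iff]
    exact h
  induction b₂ using OnePoint.rec with
  | infty =>
    induction b₁ using OnePoint.rec with
    | infty => exact absurd rfl hb
    | coe x =>
      have := add_mem hJ (hC x)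
      simpa [pointRatio, pointForm_infty, pointForm_coe] using this
  | coe y =>
    -- the pole of the coordinate is finite: subtract its value at infinity and invert
    have h0 := pointForm_ne_zero (y : OnePoint K)
    obtain ⟨c, a, ha, h⟩ : ∃ c a : K, a ≠ 0 ∧ pointRatio b₁ (y : OnePoint K) =
        RatFunc.C c + RatFunc.C a / pointForm (y : OnePoint K) := by
      induction b₁ using OnePoint.rec with
      | infty => exact ⟨0, 1, one_ne_zero, by simp [pointRatio, pointForm_infty]⟩
      | coe x =>
        refine ⟨1, y - x, sub_ne_zero.2 fun h ↦ hb (by rw [h]), ?_⟩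
        rw [pointRatio, div_eq_iff h0, add_mul, div_mul_cancel₀ _ h0, pointForm_coe, pointForm_coe,
          map_sub, map_one]
        ring
    have ha' : RatFunc.C a ≠ 0 := by simpa using ha
    have h1 := add_mem (div_mem (hC a) (sub_mem hJ (hC c))) (hC y)
    rw [h, add_sub_cancel_left, div_div_cancel₀ ha', pointForm_coe, sub_add_cancel] at h1
    exact h1

theorem transcendental_pointRatio {b₁ b₂ : OnePoint K} (hb : b₁ ≠ b₂) :
    Transcendental K (pointRatio b₁ b₂) :=
  transcendental_of_adjoin_eq_top (adjoin_pointRatio hb)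

theorem ratFuncMap_pointForm {L : Type*} [Field L] [Algebra K L] (t : OnePoint K) :
    ratFuncMap K L (pointForm t) = pointForm (OnePoint.map (algebraMap K L) t) := by
  induction t using OnePoint.rec with
  | infty => exact map_one _
  | coe x =>
    rw [OnePoint.map_some, pointForm_coe, pointForm_coe, map_sub, ratFuncMap_X,
      ← RatFunc.algebraMap_eq_C, ratFuncMap_algebraMap, RatFunc.algebraMap_eq_C]

section Unramified

open WithZero

variable {M : Type*} [Field M] [Algebra (RatFunc K) M] [Algebra K M] [IsScalarTower K (RatFunc K) M]

theorem valuation_pointRatio (v : Valuation M (WithZero (Multiplicative ℤ)))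
    (hvK : ∀ a : K, a ≠ 0 → v (algebraMap K M a) = 1) {t : OnePoint K}
    (hv : v (algebraMap (RatFunc K) M (unif t)) = exp (-1 : ℤ)) {b : OnePoint K} (hb : b ≠ t) :
    v (algebraMap (RatFunc K) M (pointRatio t b)) = exp (-1 : ℤ) := by
  have hlt : (exp (-1 : ℤ) : WithZero (Multiplicative ℤ)) < 1 := by
    rw [← exp_zero, exp_lt_exp]; norm_num
  have hC : ∀ a : K, algebraMap (RatFunc K) M (RatFunc.C a) = algebraMap K M a := fun a ↦ by
    rw [← RatFunc.algebraMap_eq_C, ← IsScalarTower.algebraMap_apply]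
  rw [pointRatio, map_div₀, map_div₀]
  induction t using OnePoint.rec with
  | infty =>
    induction b using OnePoint.rec with
    | infty => exact absurd rfl hb
    | coe y =>
      rw [unif_infty, map_inv₀, map_inv₀, inv_eq_iff_eq_inv, ← exp_neg, neg_neg] at hv
      have h1 : v (algebraMap K M y) < exp (1 : ℤ) := by
        have h2 : (1 : WithZero (Multiplicative ℤ)) < exp (1 : ℤ) := by
          rw [← exp_zero, exp_lt_exp]; norm_num
        by_cases hy : y = 0
        · simp [hy]
        · rwa [hvK y hy]
      rw [pointForm_infty, map_one, map_one, pointForm_coe, map_sub, hC,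
        v.map_sub_eq_of_lt_left (by rwa [hv]), hv, one_div, ← exp_neg]
  | coe x =>
    rw [unif_coe] at hv
    rw [pointForm_coe, hv]
    suffices h : v (algebraMap (RatFunc K) M (pointForm b)) = 1 by rw [h, div_one]
    induction b using OnePoint.rec with
    | infty => rw [pointForm_infty, map_one, map_one]
    | coe y =>
      have hxy : x - y ≠ 0 := sub_ne_zero.2 fun h ↦ hb (by rw [h])
      have e : algebraMap (RatFunc K) M (pointForm (y : OnePoint K)) =
          algebraMap (RatFunc K) M (RatFunc.X - RatFunc.C x) + algebraMap K M (x - y) := by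
        rw [pointForm_coe, ← hC, ← map_add, map_sub RatFunc.C]; congr 1; ring
      rw [e, v.map_add_eq_of_lt_right, hvK _ hxy]
      rwa [hvK _ hxy, hv]

variable [FiniteDimensional (RatFunc K) M] [Algebra.IsSeparable (RatFunc K) M]

/-- The hypothesis says that `M` is unramified over the point at which the coordinate takes the
value `θ`. -/
theorem isUniformizable_pointRatio {b₁ b₂ : OnePoint K} (hb : b₁ ≠ b₂) {θ : K}
    (h : ∀ (t : OnePoint K) (a : K), a ≠ 0 →
      pointForm b₁ - RatFunc.C θ * pointForm b₂ = RatFunc.C a * pointForm t →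
      ¬ IsRamifiedOver M t) :
    IsUniformizable M (algebraMap (RatFunc K) M (pointRatio b₁ b₂)) θ := by
  obtain ⟨t, a, ha, hta⟩ := exists_pointForm_sub_eq hb θ
  obtain ⟨v, hvK, hv⟩ := exists_valuation_of_not_isRamifiedOver M (h t a ha hta)
  have htb : b₂ ≠ t := fun h0 ↦ hb (eq_of_pointForm_eq_mul (a := θ + a) (by
    rw [← h0] at hta
    rw [map_add]; linear_combination hta))
  refine ⟨v, hvK, ?_⟩
  have e : algebraMap (RatFunc K) M (pointRatio b₁ b₂) - algebraMap K M θ =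
      algebraMap K M a * algebraMap (RatFunc K) M (pointRatio t b₂) := by
    rw [IsScalarTower.algebraMap_apply K (RatFunc K) M, IsScalarTower.algebraMap_apply K (RatFunc K)
      M a, ← map_mul, ← map_sub, RatFunc.algebraMap_eq_C, pointRatio, pointRatio, ← mul_div_assoc,
      ← hta, sub_div, mul_div_cancel_right₀ _ (pointForm_ne_zero b₂)]
  rw [e, map_mul, hvK a ha, one_mul, valuation_pointRatio v hvK hv htb]

theorem isUniformizable_pointRatio_of_two {b₁ b₂ : OnePoint K} (hb : b₁ ≠ b₂)
    (hM : {t | IsRamifiedOver M t} = {b₁, b₂}) {θ : K} (hθ : θ ≠ 0) :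
    IsUniformizable M (algebraMap (RatFunc K) M (pointRatio b₁ b₂)) θ := by
  refine isUniformizable_pointRatio hb fun t a ha hta hr ↦ ?_
  have ht : t ∈ ({b₁, b₂} : Set (OnePoint K)) := hM ▸ hr
  have hθ' : RatFunc.C θ ≠ 0 := by simpa using hθ
  rcases ht with rfl | rfl
  · refine hb (eq_of_pointForm_eq_mul (b := b₂) (a := (1 - a) / θ) ?_).symm
    rw [map_div₀, div_mul_eq_mul_div, eq_div_iff hθ', map_sub, map_one]
    linear_combination -hta
  · exact hb (eq_of_pointForm_eq_mul (a := θ + a) (by rw [map_add]; linear_combination hta))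

theorem isUniformizable_pointRatio_of_three {b₁ b₂ b₃ : OnePoint K} (h12 : b₁ ≠ b₂)
    (h23 : b₂ ≠ b₃) (hM : {t | IsRamifiedOver M t} = {b₁, b₂, b₃}) {c a : K}
    (hc : pointForm b₁ - RatFunc.C c * pointForm b₂ = RatFunc.C a * pointForm b₃) {θ : K}
    (hθ : θ ≠ 0) (hθc : θ ≠ c) :
    IsUniformizable M (algebraMap (RatFunc K) M (pointRatio b₁ b₂)) θ := by
  refine isUniformizable_pointRatio h12 fun t a ha hta hr ↦ ?_
  have ht : t ∈ ({b₁, b₂, b₃} : Set (OnePoint K)) := hM ▸ hr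
  have hθ' : RatFunc.C θ ≠ 0 := by simpa using hθ
  rcases ht with rfl | rfl | rfl
  · refine h12 (eq_of_pointForm_eq_mul (b := b₂) (a := (1 - a) / θ) ?_).symm
    rw [map_div₀, div_mul_eq_mul_div, eq_div_iff hθ', map_sub, map_one]
    linear_combination -hta
  · exact h12 (eq_of_pointForm_eq_mul (a := θ + a) (by rw [map_add]; linear_combination hta))
  · exact hθc (eq_of_pointForm_sub_eq h23 hta hc)

/-- If a coordinate has a root of degree `m ≠ 1` in `M`, then `M` is ramified over the zero of this
coordinate: an unramified zero would have order `1`, which is not divisible by `m`. -/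
theorem isRamifiedOver_of_pow_eq {b₁ b₂ : OnePoint K} (hb : b₁ ≠ b₂) {y : M} {m : ℕ} (hm : m ≠ 1)
    (hy : y ^ m = algebraMap (RatFunc K) M (pointRatio b₁ b₂)) : IsRamifiedOver M b₁ := by
  by_contra hr
  obtain ⟨v, hvK, hv⟩ := exists_valuation_of_not_isRamifiedOver M hr
  have h1 := valuation_pointRatio v hvK hv hb.symm
  rw [← hy, map_pow] at h1
  have hv0 : v y ≠ 0 := fun h0 ↦ by
    rcases eq_or_ne m 0 with rfl | hm0
    · rw [pow_zero, ← exp_zero] at h1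
      exact absurd (exp_injective h1) (by norm_num)
    · rw [h0, zero_pow hm0] at h1
      exact exp_ne_zero h1.symm
  rw [← exp_log hv0, ← exp_nsmul] at h1
  have h2 := exp_injective h1
  rw [nsmul_eq_mul] at h2
  have h3 : (m : ℤ) ∣ 1 := ⟨-log (v y), by linear_combination h2⟩
  exact hm (Nat.dvd_one.1 (Int.natCast_dvd_natCast.1 (by exact_mod_cast h3)))

end Unramified
end PointForms

/-! ### Automorphisms of the geometric extension -/

section GeometricExtension

set_option linter.unusedSectionVars false

variable {k : Type*} [Field k]
  {F : Type*} [Field F] [Algebra (RatFunc k) F] [Algebra k F] [IsScalarTower k (RatFunc k) F]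
  {K : Type*} [Field K] [Algebra k K]
  {Ω : Type*} [Field Ω] [Algebra k Ω] [Algebra (RatFunc k) Ω] [IsScalarTower k (RatFunc k) Ω]
  [Algebra F Ω] [IsScalarTower k F Ω] [IsScalarTower (RatFunc k) F Ω]
  [Algebra K Ω] [IsScalarTower k K Ω] [Algebra (RatFunc K) Ω] [IsScalarTower K (RatFunc K) Ω]

/-- An automorphism over `K(T)` is one over `k(T)`. -/
noncomputable def galRestrict (hcomp : ∀ r : RatFunc k,
      algebraMap (RatFunc K) Ω (ratFuncMap k K r) = algebraMap (RatFunc k) Ω r)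
    (σ : Gal(Ω/RatFunc K)) : Gal(Ω/RatFunc k) :=
  AlgEquiv.ofRingEquiv (f := σ.toRingEquiv) fun r ↦ by
    rw [← hcomp]; exact σ.commutes _

theorem galRestrict_apply (hcomp : ∀ r : RatFunc k,
      algebraMap (RatFunc K) Ω (ratFuncMap k K r) = algebraMap (RatFunc k) Ω r)
    (σ : Gal(Ω/RatFunc K)) (x : Ω) : galRestrict hcomp σ x = σ x := rfl

theorem algebraMap_ratFunc_mem {J : IntermediateField K Ω}
    (hT : algebraMap (RatFunc K) Ω RatFunc.X ∈ J) (r : RatFunc K) :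
    algebraMap (RatFunc K) Ω r ∈ J := by
  have h2 : IntermediateField.adjoin K {(RatFunc.X : RatFunc K)} ≤
      J.comap (IsScalarTower.toAlgHom K (RatFunc K) Ω) := by
    rw [IntermediateField.adjoin_simple_le_iff]; exact hT
  rw [RatFunc.adjoin_X] at h2
  exact h2 IntermediateField.mem_top

/-- The compositum of `F` and `K(T)` is generated by `F` over `K`, because `T` belongs to `F`. -/
theorem mem_adjoin_range_of_mem (hcomp : ∀ r : RatFunc k,
      algebraMap (RatFunc K) Ω (ratFuncMap k K r) = algebraMap (RatFunc k) Ω r) {x : Ω}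
    (hx : x ∈ IntermediateField.adjoin (RatFunc K) (Set.range (algebraMap F Ω))) :
    x ∈ IntermediateField.adjoin K (Set.range (algebraMap F Ω)) := by
  have hT : algebraMap (RatFunc K) Ω RatFunc.X ∈
      IntermediateField.adjoin K (Set.range (algebraMap F Ω)) := by
    rw [← ratFuncMap_X (k := k), hcomp, IsScalarTower.algebraMap_apply (RatFunc k) F Ω]
    exact IntermediateField.subset_adjoin _ _ ⟨_, rfl⟩
  refine IntermediateField.adjoin_induction (RatFunc K)
    (p := fun x _ ↦ x ∈ IntermediateField.adjoin K (Set.range (algebraMap F Ω))) ?_ ?_ ?_ ?_ ?_ hx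
  · exact fun y hy ↦ IntermediateField.subset_adjoin _ _ hy
  · exact algebraMap_ratFunc_mem hT
  · exact fun _ _ _ _ hx hy ↦ add_mem hx hy
  · exact fun _ _ hx ↦ inv_mem hx
  · exact fun _ _ _ _ hx hy ↦ mul_mem hx hy

theorem exists_constants_apply [Normal k K] (φ : Gal(Ω/RatFunc k)) :
    ∃ τ : Gal(K/k), ∀ a : K, φ (algebraMap K Ω a) = algebraMap K Ω (τ a) :=
  ⟨(φ.restrictScalars k).restrictNormal K, fun a ↦
    ((φ.restrictScalars k).restrictNormal_commutes K a).symm⟩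

theorem exists_extension_apply [Normal (RatFunc k) F] (φ : Gal(Ω/RatFunc k)) :
    ∃ g : Gal(F/RatFunc k), ∀ f : F, φ (algebraMap F Ω f) = algebraMap F Ω (g f) :=
  ⟨φ.restrictNormal F, fun f ↦ (φ.restrictNormal_commutes F f).symm⟩

theorem apply_pointForm (hcomp : ∀ r : RatFunc k,
      algebraMap (RatFunc K) Ω (ratFuncMap k K r) = algebraMap (RatFunc k) Ω r)
    (φ : Gal(Ω/RatFunc k)) {τ : Gal(K/k)}
    (hτ : ∀ a : K, φ (algebraMap K Ω a) = algebraMap K Ω (τ a)) (b : OnePoint K) :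
    φ (algebraMap (RatFunc K) Ω (pointForm b)) =
      algebraMap (RatFunc K) Ω (pointForm (OnePoint.map τ b)) := by
  have hC : ∀ a : K, algebraMap (RatFunc K) Ω (RatFunc.C a) = algebraMap K Ω a := fun a ↦ by
    rw [← RatFunc.algebraMap_eq_C, ← IsScalarTower.algebraMap_apply]
  induction b using OnePoint.rec with
  | infty => rw [OnePoint.map_infty, pointForm_infty, map_one, map_one]
  | coe x =>
    rw [OnePoint.map_some, pointForm_coe, pointForm_coe, map_sub, map_sub, map_sub, hC, hC, hτ,
      ← ratFuncMap_X (k := k), hcomp, φ.commutes]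

theorem apply_pointRatio (hcomp : ∀ r : RatFunc k,
      algebraMap (RatFunc K) Ω (ratFuncMap k K r) = algebraMap (RatFunc k) Ω r)
    (φ : Gal(Ω/RatFunc k)) {τ : Gal(K/k)}
    (hτ : ∀ a : K, φ (algebraMap K Ω a) = algebraMap K Ω (τ a)) (b₁ b₂ : OnePoint K) :
    φ (algebraMap (RatFunc K) Ω (pointRatio b₁ b₂)) =
      algebraMap (RatFunc K) Ω (pointRatio (OnePoint.map τ b₁) (OnePoint.map τ b₂)) := by
  rw [pointRatio, map_div₀, map_div₀, apply_pointForm hcomp φ hτ, apply_pointForm hcomp φ hτ,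
    ← map_div₀, pointRatio]

theorem map_eq_self_of_mem_range (τ : Gal(K/k)) {b : OnePoint K}
    (hb : b ∈ Set.range (OnePoint.map (algebraMap k K))) : OnePoint.map τ b = b := by
  obtain ⟨a, rfl⟩ := hb
  induction a using OnePoint.rec with
  | infty => rfl
  | coe x => rw [OnePoint.map_some, OnePoint.map_some, τ.commutes]

/-- Two elements with the same `m`-th power differ by a constant. -/
theorem exists_eq_smul_of_pow_eq [IsAlgClosed K] {x y : Ω} {m : ℕ} (hm : m ≠ 0) (hy : y ≠ 0)
    (h : x ^ m = y ^ m) : ∃ c : K, c ^ m = 1 ∧ x = c • y := by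
  obtain ⟨c, hc, hc1⟩ := exists_algebraMap_eq_of_pow_eq_one (K := K) (x := x / y) hm
    (by rw [div_pow, h, div_self (pow_ne_zero _ hy)])
  exact ⟨c, hc1, by rw [Algebra.smul_def, hc, div_mul_cancel₀ _ hy]⟩

variable {M : IntermediateField (RatFunc K) Ω}

theorem algebraMap_mem (hM : M = IntermediateField.adjoin (RatFunc K) (Set.range (algebraMap F Ω)))
    (f : F) : algebraMap F Ω f ∈ M := by
  rw [hM]; exact IntermediateField.subset_adjoin _ _ ⟨f, rfl⟩

theorem coe_mem_adjoin (hcomp : ∀ r : RatFunc k,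
      algebraMap (RatFunc K) Ω (ratFuncMap k K r) = algebraMap (RatFunc k) Ω r)
    (hM : M = IntermediateField.adjoin (RatFunc K) (Set.range (algebraMap F Ω))) (y : M) :
    (y : Ω) ∈ IntermediateField.adjoin K (Set.range (algebraMap F Ω)) :=
  mem_adjoin_range_of_mem hcomp (hM ▸ y.2)

theorem mem_adjoin_coe {y : M} (hy : IntermediateField.adjoin K {y} = ⊤) {x : Ω} (hx : x ∈ M) :
    x ∈ IntermediateField.adjoin K {(y : Ω)} := by
  have h1 : (IntermediateField.adjoin K {y}).map (M.val.restrictScalars K) =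
      IntermediateField.adjoin K {(y : Ω)} := by
    rw [IntermediateField.adjoin_map, Set.image_singleton]; rfl
  rw [← h1, hy]
  exact ⟨⟨x, hx⟩, trivial, rfl⟩

/-- The compositum is stable under the automorphisms over `k(T)`. -/
theorem apply_mem_of_mem [Normal k K] [Normal (RatFunc k) F] (hcomp : ∀ r : RatFunc k,
      algebraMap (RatFunc K) Ω (ratFuncMap k K r) = algebraMap (RatFunc k) Ω r)
    (hM : M = IntermediateField.adjoin (RatFunc K) (Set.range (algebraMap F Ω)))
    (φ : Gal(Ω/RatFunc k)) {x : Ω} (hx : x ∈ M) : φ x ∈ M := by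
  obtain ⟨τ, hτ⟩ := exists_constants_apply (K := K) φ
  obtain ⟨g, hg⟩ := exists_extension_apply (F := F) φ
  have hK : ∀ a : K, algebraMap K Ω a ∈ M := fun a ↦ by
    rw [IsScalarTower.algebraMap_apply K (RatFunc K) Ω]; exact M.algebraMap_mem _
  refine IntermediateField.adjoin_induction K (p := fun x _ ↦ φ x ∈ M) ?_ ?_ ?_ ?_ ?_
    (coe_mem_adjoin hcomp hM ⟨x, hx⟩)
  · rintro _ ⟨f, rfl⟩
    rw [hg]; exact algebraMap_mem hM _
  · intro a
    rw [hτ]; exact hK _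
  · intro x y _ _ hx hy
    rw [map_add]; exact add_mem hx hy
  · intro x _ hx
    rw [map_inv₀]; exact inv_mem hx
  · intro x y _ _ hx hy
    rw [map_mul]; exact mul_mem hx hy

theorem finiteDimensional_compositum [FiniteDimensional (RatFunc k) F] (hcomp : ∀ r : RatFunc k,
      algebraMap (RatFunc K) Ω (ratFuncMap k K r) = algebraMap (RatFunc k) Ω r)
    (hM : M = IntermediateField.adjoin (RatFunc K) (Set.range (algebraMap F Ω))) :
    FiniteDimensional (RatFunc K) M := by
  let b := Module.finBasis (RatFunc k) F
  have hint : ∀ f : F, IsIntegral (RatFunc K) (algebraMap F Ω f) := fun f ↦ by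
    obtain ⟨p, hp, hpf⟩ := IsIntegral.of_finite (RatFunc k) f
    refine ⟨p.map (ratFuncMap k K), hp.map _, ?_⟩
    rw [eval₂_map, show (algebraMap (RatFunc K) Ω).comp (ratFuncMap k K) =
      (algebraMap F Ω).comp (algebraMap (RatFunc k) F) from RingHom.ext fun r ↦ by
        rw [RingHom.comp_apply, RingHom.comp_apply, hcomp, ← IsScalarTower.algebraMap_apply],
      ← hom_eval₂, hpf, map_zero]
  have h1 : M = IntermediateField.adjoin (RatFunc K)
      (Set.range fun i ↦ algebraMap F Ω (b i)) := by
    rw [hM]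
    refine le_antisymm (IntermediateField.adjoin_le_iff.2 ?_)
      (IntermediateField.adjoin.mono _ _ _ ?_)
    · rintro _ ⟨f, rfl⟩
      rw [← b.sum_repr f, map_sum]
      refine sum_mem fun i _ ↦ ?_
      rw [Algebra.smul_def, map_mul, ← IsScalarTower.algebraMap_apply, ← hcomp]
      exact mul_mem (IntermediateField.algebraMap_mem _ _)
        (IntermediateField.subset_adjoin _ _ ⟨i, rfl⟩)
    · rintro _ ⟨i, rfl⟩
      exact ⟨b i, rfl⟩
  rw [h1]
  exact IntermediateField.finiteDimensional_adjoin fun x hx ↦ by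
    obtain ⟨i, rfl⟩ := hx
    exact hint _

theorem isGalois_compositum [CharZero K] [FiniteDimensional (RatFunc k) F] [Normal k K]
    [Normal (RatFunc k) F] [Normal (RatFunc K) Ω] (hcomp : ∀ r : RatFunc k,
      algebraMap (RatFunc K) Ω (ratFuncMap k K r) = algebraMap (RatFunc k) Ω r)
    (hM : M = IntermediateField.adjoin (RatFunc K) (Set.range (algebraMap F Ω))) :
    IsGalois (RatFunc K) M := by
  have := finiteDimensional_compositum hcomp hM
  have : CharZero (RatFunc K) :=
    charZero_of_injective_algebraMap (algebraMap K (RatFunc K)).injective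
  have : Normal (RatFunc K) M := by
    rw [IntermediateField.normal_iff_forall_map_le']
    rintro σ _ ⟨x, hx, rfl⟩
    exact apply_mem_of_mem hcomp hM (galRestrict hcomp σ) hx
  exact ⟨⟩

/-- The restriction of automorphisms from the compositum of `F` and `K(T)` to `F`. -/
theorem exists_galois_hom_injective [Normal (RatFunc k) F] [Normal (RatFunc K) Ω]
    [Normal (RatFunc K) M] (hcomp : ∀ r : RatFunc k,
      algebraMap (RatFunc K) Ω (ratFuncMap k K r) = algebraMap (RatFunc k) Ω r)
    (hM : M = IntermediateField.adjoin (RatFunc K) (Set.range (algebraMap F Ω))) :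
    ∃ ρ : Gal(M/RatFunc K) →* Gal(F/RatFunc k), Function.Injective ρ ∧
      ∀ (σ : Gal(M/RatFunc K)) (f : F), σ ⟨algebraMap F Ω f, algebraMap_mem hM f⟩ =
        ⟨algebraMap F Ω (ρ σ f), algebraMap_mem hM _⟩ := by
  have h1 : ∀ σ : Gal(M/RatFunc K), ∃ g : Gal(F/RatFunc k),
      ∀ f, σ ⟨algebraMap F Ω f, algebraMap_mem hM f⟩ =
        ⟨algebraMap F Ω (g f), algebraMap_mem hM _⟩ := fun σ ↦ by
    obtain ⟨g, hg⟩ := exists_extension_apply (F := F) (galRestrict hcomp (σ.liftNormal Ω))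
    refine ⟨g, fun f ↦ Subtype.ext ?_⟩
    refine Eq.trans ?_ (hg f)
    rw [galRestrict_apply]
    exact (σ.liftNormal_commutes Ω ⟨algebraMap F Ω f, algebraMap_mem hM f⟩).symm
  choose ρ hρ using h1
  have hmul : ∀ σ τ, ρ (σ * τ) = ρ σ * ρ τ := fun σ τ ↦ AlgEquiv.ext fun f ↦ by
    have h2 := hρ (σ * τ) f
    rw [AlgEquiv.mul_apply, hρ, hρ] at h2
    exact ((algebraMap F Ω).injective (congrArg Subtype.val h2)).symm
  refine ⟨MonoidHom.mk' ρ hmul, ?_, hρ⟩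
  rw [injective_iff_map_eq_one]
  intro σ hσ
  have h2 : ∀ f, σ ⟨algebraMap F Ω f, algebraMap_mem hM f⟩ =
      ⟨algebraMap F Ω f, algebraMap_mem hM f⟩ := fun f ↦ by
    rw [hρ]; congr 2
    exact DFunLike.congr_fun (show ρ σ = 1 from hσ) f
  have h3 : IntermediateField.adjoin (RatFunc K) (Set.range (algebraMap F Ω)) ≤
      (IntermediateField.fixedField (Subgroup.zpowers σ)).map M.val := by
    refine IntermediateField.adjoin_le_iff.2 ?_
    rintro _ ⟨f, rfl⟩
    refine ⟨⟨_, algebraMap_mem hM f⟩, ?_, rfl⟩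
    refine (IntermediateField.mem_fixedField_iff _ _).2 fun g hg ↦ ?_
    have h4 : Subgroup.zpowers σ ≤ MulAction.stabilizer Gal(M/RatFunc K)
        (⟨_, algebraMap_mem hM f⟩ : M) := by
      rw [Subgroup.zpowers_le]; exact h2 f
    exact h4 hg
  refine AlgEquiv.ext fun x ↦ ?_
  rw [← hM] at h3
  obtain ⟨x', hx', hxx'⟩ := h3 x.2
  obtain rfl : x' = x := Subtype.ext hxx'
  exact (IntermediateField.mem_fixedField_iff _ x').1 hx' σ (Subgroup.mem_zpowers σ)

end GeometricExtension

/-! ### Cyclic extensions with two branch points -/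

section CyclicExtension

variable {k : Type*} [Field k]
  {F : Type*} [Field F] [Algebra (RatFunc k) F] [Algebra k F] [IsScalarTower k (RatFunc k) F]
  [FiniteDimensional (RatFunc k) F] [IsGalois (RatFunc k) F]
  {K : Type*} [Field K] [Algebra k K] [IsAlgClosed K] [CharZero K] [Normal k K]
  {Ω : Type*} [Field Ω] [IsAlgClosed Ω] [Algebra k Ω] [Algebra (RatFunc k) Ω]
  [IsScalarTower k (RatFunc k) Ω] [Normal (RatFunc k) Ω]
  [Algebra F Ω] [IsScalarTower k F Ω] [IsScalarTower (RatFunc k) F Ω] [IsGalois F Ω]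
  [Algebra K Ω] [IsScalarTower k K Ω] [Algebra (RatFunc K) Ω] [IsScalarTower K (RatFunc K) Ω]
  [Normal (RatFunc K) Ω] {M : IntermediateField (RatFunc K) Ω}

/-- A cyclic extension of `k(T)` with two branch points, both rational, is geometrically generated
by a root `y` of a coordinate defined over `k`. -/
theorem hasLinearCoordinate_of_isCyclic_of_rational (hreg : algebraicClosure k F = ⊥)
    (hcomp : ∀ r : RatFunc k,
      algebraMap (RatFunc K) Ω (ratFuncMap k K r) = algebraMap (RatFunc k) Ω r)
    (hM : M = IntermediateField.adjoin (RatFunc K) (Set.range (algebraMap F Ω)))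
    (hcyc : IsCyclic Gal(F/RatFunc k)) {b₁ b₂ : OnePoint K} (hb : b₁ ≠ b₂)
    (hbranch : {t | IsRamifiedOver M t} = {b₁, b₂})
    (hrat : {t | IsRamifiedOver M t} ⊆ Set.range (OnePoint.map (algebraMap k K))) :
    HasLinearCoordinate k F := by
  have := finiteDimensional_compositum hcomp hM
  have := isGalois_compositum hcomp hM
  obtain ⟨ρ, hρ, -⟩ := exists_galois_hom_injective hcomp hM
  have : IsCyclic Gal(M/RatFunc K) := isCyclic_of_injective ρ hρ
  obtain ⟨y, hy, hytop⟩ := exists_pow_eq_of_isCyclic (M := M) (adjoin_pointRatio hb)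
    (transcendental_pointRatio hb) fun θ hθ ↦ isUniformizable_pointRatio_of_two hb hbranch hθ
  have hm : Module.finrank (RatFunc K) M ≠ 0 := Module.finrank_pos.ne'
  have hy' : (y : Ω) ^ Module.finrank (RatFunc K) M =
      algebraMap (RatFunc K) Ω (pointRatio b₁ b₂) := congrArg Subtype.val hy
  have hF : ∀ f : F, algebraMap F Ω f ∈ IntermediateField.adjoin K {(y : Ω)} := fun f ↦
    mem_adjoin_coe hytop (algebraMap_mem hM f)
  have hy0 : (y : Ω) ≠ 0 := fun h ↦
    transcendental_of_mem_adjoin (k := k) hF (h ▸ isAlgebraic_zero)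
  refine hasLinearCoordinate_of_scaling hreg (coe_mem_adjoin hcomp hM y) hF fun φ ↦ ?_
  obtain ⟨τ, hτ⟩ := exists_constants_apply (K := K) φ
  obtain ⟨c, -, hc⟩ := exists_eq_smul_of_pow_eq (K := K) (x := φ y) hm hy0 (by
    rw [← map_pow, hy', apply_pointRatio hcomp φ hτ,
      map_eq_self_of_mem_range τ (hrat (hbranch ▸ Or.inl rfl)),
      map_eq_self_of_mem_range τ (hrat (hbranch ▸ Or.inr rfl))])
  exact ⟨c, hc⟩

/-- In a cyclic extension of odd degree with two branch points the automorphisms over `k(T)` may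
interchange the branch points, and then replace the generator `y` by its inverse. -/
theorem hasLinearCoordinate_of_isCyclic_of_odd (hreg : algebraicClosure k F = ⊥)
    (hcomp : ∀ r : RatFunc k,
      algebraMap (RatFunc K) Ω (ratFuncMap k K r) = algebraMap (RatFunc k) Ω r)
    (hM : M = IntermediateField.adjoin (RatFunc K) (Set.range (algebraMap F Ω)))
    (hcyc : IsCyclic Gal(F/RatFunc k)) (hodd : Odd (Nat.card Gal(F/RatFunc k)))
    {b₁ b₂ : OnePoint K} (hb : b₁ ≠ b₂) (hbranch : {t | IsRamifiedOver M t} = {b₁, b₂}) :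
    HasLinearCoordinate k F := by
  have := finiteDimensional_compositum hcomp hM
  have := isGalois_compositum hcomp hM
  obtain ⟨ρ, hρ, -⟩ := exists_galois_hom_injective hcomp hM
  have : IsCyclic Gal(M/RatFunc K) := isCyclic_of_injective ρ hρ
  obtain ⟨y, hy, hytop⟩ := exists_pow_eq_of_isCyclic (M := M) (adjoin_pointRatio hb)
    (transcendental_pointRatio hb) fun θ hθ ↦ isUniformizable_pointRatio_of_two hb hbranch hθ
  have hmodd : Odd (Module.finrank (RatFunc K) M) := by
    rw [← IsGalois.card_aut_eq_finrank]
    exact hodd.of_dvd_nat (Subgroup.card_dvd_of_injective ρ hρ)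
  generalize Module.finrank (RatFunc K) M = m at hy hmodd
  have hF : ∀ f : F, algebraMap F Ω f ∈ IntermediateField.adjoin K {(y : Ω)} := fun f ↦
    mem_adjoin_coe hytop (algebraMap_mem hM f)
  have hy0 : (y : Ω) ≠ 0 := fun h ↦
    transcendental_of_mem_adjoin (k := k) hF (h ▸ isAlgebraic_zero)
  have hy' : (y : Ω) ^ m = algebraMap (RatFunc K) Ω (pointRatio b₁ b₂) := congrArg Subtype.val hy
  by_cases hm1 : m = 1
  · -- the extension is geometrically trivial, and `T` itself is a coordinate
    have hT : (algebraMap (RatFunc K) Ω RatFunc.X) =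
        ((algebraMap (RatFunc K) M RatFunc.X : M) : Ω) := rfl
    refine hasLinearCoordinate_of_scaling (K := K) (y := algebraMap (RatFunc K) Ω RatFunc.X) hreg
      (by rw [hT]; exact coe_mem_adjoin hcomp hM _) (fun f ↦ ?_) fun φ ↦ ⟨1, ?_⟩
    · have h1 : IntermediateField.adjoin K {(y : Ω)} ≤
          IntermediateField.adjoin K {algebraMap (RatFunc K) Ω RatFunc.X} := by
        rw [IntermediateField.adjoin_simple_le_iff, ← pow_one (y : Ω), ← hm1, hy']
        exact algebraMap_ratFunc_mem (IntermediateField.mem_adjoin_simple_self K _) _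
      exact h1 (hF f)
    · rw [one_smul, ← ratFuncMap_X (k := k), hcomp, φ.commutes]
  obtain ⟨j, rfl⟩ := hmodd
  refine hasLinearCoordinate_of_dihedral hreg j (coe_mem_adjoin hcomp hM y) hF fun φ ↦ ?_
  obtain ⟨τ, hτ⟩ := exists_constants_apply (K := K) φ
  have hφ : φ y ^ (2 * j + 1) =
      algebraMap (RatFunc K) Ω (pointRatio (OnePoint.map τ b₁) (OnePoint.map τ b₂)) := by
    rw [← map_pow, hy', apply_pointRatio hcomp φ hτ]
  have hne : OnePoint.map τ b₁ ≠ OnePoint.map τ b₂ := fun h ↦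
    hb (Option.map_injective τ.injective h)
  have h1 : OnePoint.map τ b₁ ∈ ({b₁, b₂} : Set (OnePoint K)) := by
    rw [← hbranch]
    exact isRamifiedOver_of_pow_eq (y := (⟨φ y, apply_mem_of_mem hcomp hM φ y.2⟩ : M)) hne hm1
      (Subtype.ext hφ)
  have h2 : OnePoint.map τ b₂ ∈ ({b₁, b₂} : Set (OnePoint K)) := by
    rw [← hbranch]
    refine isRamifiedOver_of_pow_eq (y := (⟨φ y, apply_mem_of_mem hcomp hM φ y.2⟩ : M)⁻¹) hne.symm
      hm1 (Subtype.ext ?_)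
    change (φ y)⁻¹ ^ (2 * j + 1) = algebraMap (RatFunc K) Ω _
    rw [inv_pow, hφ, ← map_inv₀, pointRatio, inv_div, pointRatio]
  have hswap : (y : Ω)⁻¹ ^ (2 * j + 1) = algebraMap (RatFunc K) Ω (pointRatio b₂ b₁) := by
    rw [inv_pow, hy', ← map_inv₀, pointRatio, inv_div, pointRatio]
  have hcases : φ y ^ (2 * j + 1) = (y : Ω) ^ (2 * j + 1) ∨
      φ y ^ (2 * j + 1) = (y : Ω)⁻¹ ^ (2 * j + 1) := by
    rw [hφ, hy', hswap]
    rcases h1 with h1 | h1 <;> rcases h2 with h2 | h2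
    · exact absurd (h1.trans h2.symm) hne
    · left; rw [h1, h2]
    · right; rw [h1, h2]
    · exact absurd (h1.trans h2.symm) hne
  rcases hcases with h | h
  · obtain ⟨c, hc, h3⟩ := exists_eq_smul_of_pow_eq (K := K) (by omega) hy0 h
    exact ⟨c, hc, Or.inl h3⟩
  · obtain ⟨c, hc, h3⟩ := exists_eq_smul_of_pow_eq (K := K) (by omega) (inv_ne_zero hy0) h
    exact ⟨c, hc, Or.inr h3⟩

end CyclicExtension

/-! ### The sign character of a dihedral group -/

section DihedralGroup

/-- The sign character of a dihedral group of order `2 n`, `n` odd, whose kernel consists of the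
rotations. -/
theorem exists_sign_of_mulEquiv_dihedralGroup {G : Type*} [Group G] {n : ℕ} (hn : Odd n)
    (e : G ≃* DihedralGroup n) :
    ∃ ε : G →* ℤˣ, (∃ η, ε η = -1) ∧ (∀ γ η, ε γ = 1 → ε η = -1 → η⁻¹ * γ * η = γ⁻¹) ∧
      IsCyclic ε.ker ∧ Odd (Nat.card ε.ker) := by
  let sgn : DihedralGroup n → ℤˣ := fun
    | .r _ => 1
    | .sr _ => -1
  have hsgn : ∀ a b, sgn (a * b) = sgn a * sgn b := by
    rintro (i | i) (j | j) <;> simp [sgn]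
  let ε : G →* ℤˣ := (MonoidHom.mk' sgn hsgn).comp e.toMonoidHom
  have hε : ∀ g, ε g = sgn (e g) := fun _ ↦ rfl
  have hker : ∀ g, ε g = 1 → ∃ i, e g = DihedralGroup.r i := fun g hg ↦ by
    rw [hε] at hg
    rcases h : e g with i | i
    · exact ⟨i, rfl⟩
    · rw [h] at hg; exact absurd hg (by simp [sgn])
  let f : ε.ker →* Subgroup.zpowers (DihedralGroup.r 1 : DihedralGroup n) :=
    (e.toMonoidHom.comp ε.ker.subtype).codRestrict _ fun x ↦ by
      obtain ⟨i, hi⟩ := hker x x.2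
      change e x ∈ _
      rw [hi]
      exact ⟨(i.cast : ℤ), by simp⟩
  have hf : Function.Injective f := fun a b hab ↦
    Subtype.ext (e.injective (congrArg Subtype.val hab))
  refine ⟨ε, ⟨e.symm (.sr 0), by simp [hε, sgn]⟩, fun γ η hγ hη ↦ ?_,
    isCyclic_of_injective f hf, ?_⟩
  · obtain ⟨i, hi⟩ := hker γ hγ
    obtain ⟨j, hj⟩ : ∃ j, e η = DihedralGroup.sr j := by
      rw [hε] at hη
      rcases h : e η with j | j
      · rw [h] at hη; exact absurd hη (by simp [sgn])
      · exact ⟨j, rfl⟩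
    apply e.injective
    simp [hi, hj]
  · have h1 := Subgroup.card_dvd_of_injective f hf
    rw [Nat.card_zpowers, DihedralGroup.orderOf_r_one] at h1
    exact hn.of_dvd_nat h1

end DihedralGroup

/-! ### Quadratic subextensions -/

section QuadraticSubextension

/-- A character `G → {±1}` of a Galois group is realized by the action on some element. -/
theorem exists_apply_eq_sign_smul {k F : Type*} [Field k] [Field F] [Algebra k F]
    [FiniteDimensional k F] (ε : Gal(F/k) →* ℤˣ) :
    ∃ δ : F, δ ≠ 0 ∧ ∀ γ, γ δ = ((ε γ : ℤ) : F) * δ := by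
  by_contra! hcon
  let δ : F → F := fun θ ↦ ∑ γ : Gal(F/k), ((ε γ : ℤ) : F) * γ θ
  have hδ : ∀ θ γ, γ (δ θ) = ((ε γ : ℤ) : F) * δ θ := by
    intro θ γ
    have hsq : ((ε γ : ℤ) : F) * ((ε γ : ℤ) : F) = 1 := by
      rw [← Int.cast_mul, ← Units.val_mul, Int.units_mul_self]; simp
    rw [map_sum, ← Equiv.sum_comp (Equiv.mulLeft γ⁻¹), Finset.mul_sum]
    refine Finset.sum_congr rfl fun η _ ↦ ?_
    simp only [Equiv.coe_mulLeft, map_mul, map_intCast, map_inv, Units.val_mul, Int.cast_mul,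
      Int.units_inv_eq_self]
    rw [← AlgEquiv.mul_apply, mul_inv_cancel_left, mul_assoc]
  have hzero : ∀ θ, δ θ = 0 := fun θ ↦ by
    by_contra h
    obtain ⟨γ, hγ⟩ := hcon (δ θ) h
    exact hγ (hδ θ γ)
  have hind := Fintype.linearIndependent_iff.1
    ((linearIndependent_monoidHom F F).comp
      (fun γ : Gal(F/k) ↦ (γ : F ≃* F).toMonoidHom) (fun σ τ h ↦ by
        ext x
        exact DFunLike.congr_fun h x))
    (fun γ ↦ ((ε γ : ℤ) : F)) (by
      ext θ
      simp only [Finset.sum_apply, Pi.smul_apply, smul_eq_mul, Function.comp_apply, Pi.zero_apply]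
      exact hzero θ) 1
  simp at hind

/-- Over an algebraically closed field, a polynomial whose roots other than `0` and `c` have even
multiplicity is a square up to factors `X` and `X - c`. -/
theorem exists_eq_mul_sq {K : Type*} [Field K] [IsAlgClosed K] {P : K[X]} (hP : P ≠ 0) {c : K}
    (h : ∀ θ, θ ≠ 0 → θ ≠ c → 2 ∣ P.rootMultiplicity θ) :
    ∃ (e f : ℕ) (Q : K[X]), e < 2 ∧ f < 2 ∧ Q ≠ 0 ∧ P = X ^ e * (X - C c) ^ f * Q ^ 2 := by
  set f := P.rootMultiplicity c
  have h1 := P.pow_mul_divByMonic_rootMultiplicity_eq c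
  set R := P /ₘ (X - C c) ^ P.rootMultiplicity c
  have hRc : R.eval c ≠ 0 := eval_divByMonic_pow_rootMultiplicity_ne_zero c hP
  have hR : R ≠ 0 := fun h0 ↦ hRc (by rw [h0, eval_zero])
  have hRθ : ∀ θ ≠ 0, 2 ∣ R.rootMultiplicity θ := fun θ hθ ↦ by
    by_cases hθc : θ = c
    · rw [hθc, rootMultiplicity_eq_zero hRc]; exact dvd_zero _
    · have h2 := h θ hθ hθc
      rwa [← h1, rootMultiplicity_mul (h1.symm ▸ hP), rootMultiplicity_eq_zero (p := _ ^ _)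
        (by simp [sub_eq_zero, hθc]), zero_add] at h2
  obtain ⟨e, Q, hQ, hRQ⟩ := exists_eq_X_pow_mul_pow hR two_pos hRθ
  refine ⟨e % 2, f % 2, X ^ (e / 2) * (X - C c) ^ (f / 2) * Q, Nat.mod_lt _ two_pos,
    Nat.mod_lt _ two_pos, mul_ne_zero (mul_ne_zero (pow_ne_zero _ X_ne_zero)
      (pow_ne_zero _ (X_sub_C_ne_zero c))) hQ, ?_⟩
  have he : (X : K[X]) ^ e = X ^ (e % 2) * (X ^ (e / 2)) ^ 2 := by
    rw [← pow_mul, ← pow_add, mul_comm (e / 2), Nat.mod_add_div]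
  have hf : (X - C c : K[X]) ^ f = (X - C c) ^ (f % 2) * ((X - C c) ^ (f / 2)) ^ 2 := by
    rw [← pow_mul, ← pow_add, mul_comm (f / 2), Nat.mod_add_div]
  rw [← h1, hRQ, show (X - C c : K[X]) ^ rootMultiplicity c P = _ from hf, he]
  ring

variable {K : Type*} [Field K] [IsAlgClosed K] {M : Type*} [Field M] [Algebra (RatFunc K) M]
  [Algebra K M] [IsScalarTower K (RatFunc K) M] [FiniteDimensional (RatFunc K) M]
  [Algebra.IsSeparable (RatFunc K) M]

/-- A quadratic extension of `K(T)` inside an extension with three branch points is generated by the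
square root of a coordinate whose zero and pole are branch points. -/
theorem exists_sq_eq_pointRatio {b₁ b₂ b₃ : OnePoint K} (h12 : b₁ ≠ b₂) (h13 : b₁ ≠ b₃)
    (h23 : b₂ ≠ b₃) (hM : {t | IsRamifiedOver M t} = {b₁, b₂, b₃}) {δ : M} {q : RatFunc K}
    (hδ : δ ^ 2 = algebraMap (RatFunc K) M q)
    (hδ' : δ ∉ Set.range (algebraMap (RatFunc K) M)) :
    ∃ (c₁ c₂ c₃ : OnePoint K) (r : RatFunc K), c₁ ≠ c₂ ∧ c₁ ≠ c₃ ∧ c₂ ≠ c₃ ∧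
      ({b₁, b₂, b₃} : Set (OnePoint K)) = {c₁, c₂, c₃} ∧ r ≠ 0 ∧ r ^ 2 * q = pointRatio c₁ c₂ := by
  obtain ⟨c, a, -, ha, hca⟩ := exists_pointForm_sub_eq_of_ne h12 h13 h23
  set S := pointRatio b₁ b₂ with hS
  have hStr : Transcendental K S := transcendental_pointRatio h12
  have hne : ∀ {Q : K[X]}, Q ≠ 0 → aeval S Q ≠ 0 := fun hQ h0 ↦ hStr ⟨_, hQ, h0⟩
  have hq0 : q ≠ 0 := fun h0 ↦ by
    rw [h0, map_zero, sq_eq_zero_iff] at hδ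
    exact hδ' ⟨0, by rw [hδ, map_zero]⟩
  have hqS : q ∈ IntermediateField.adjoin K {S} := adjoin_pointRatio h12 ▸ trivial
  obtain ⟨A, B, hAB⟩ := IntermediateField.mem_adjoin_simple_iff K q |>.1 hqS
  have hA : A ≠ 0 := fun h ↦ hq0 (by rw [hAB, h, map_zero, zero_div])
  have hB : B ≠ 0 := fun h ↦ hq0 (by rw [hAB, h, map_zero, div_zero])
  have hqAB : aeval S B ^ 2 * q = aeval S (A * B) := by
    have := hne hB
    rw [hAB, map_mul]; field_simp
  obtain ⟨e, f, Q, he, hf, hQ, hABQ⟩ := exists_eq_mul_sq (mul_ne_zero hA hB) fun θ hθ hθc ↦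
    (isUniformizable_pointRatio_of_three (M := M) h12 h23 hM hca hθ hθc).dvd_rootMultiplicity
      (mul_ne_zero hA hB) (z := algebraMap (RatFunc K) M (aeval S B) * δ) (by
        rw [mul_pow, hδ, ← map_pow, ← map_mul, hqAB, aeval_algebraMap_apply])
  have hQS := hne hQ
  set r := aeval S B / aeval S Q with hr
  have hr0 : r ≠ 0 := div_ne_zero (hne hB) hQS
  have hrq : r ^ 2 * q = S ^ e * (S - RatFunc.C c) ^ f := by
    rw [hr, div_pow, div_mul_eq_mul_div, hqAB, hABQ]
    simp only [map_mul, map_pow, map_sub, aeval_X, aeval_C, RatFunc.algebraMap_eq_C]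
    field_simp
  have hf1 := pointForm_ne_zero b₁
  have hf2 := pointForm_ne_zero b₂
  have hf3 := pointForm_ne_zero b₃
  have hSc : S - RatFunc.C c = RatFunc.C a * pointForm b₃ / pointForm b₂ := by
    rw [← hca, hS, pointRatio]; field_simp
  obtain ⟨d, hd⟩ := IsAlgClosed.exists_pow_nat_eq a two_pos
  have hd0 : RatFunc.C d ≠ 0 := fun h0 ↦ ha (by
    rw [← hd, (map_eq_zero _).1 h0]; simp)
  have had : RatFunc.C a = RatFunc.C d ^ 2 := by rw [← hd, map_pow]
  interval_cases e <;> interval_cases f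
  · -- the element `δ` would lie in `K(T)`
    exfalso
    rw [pow_zero, pow_zero, one_mul] at hrq
    have h1 : δ ^ 2 = algebraMap (RatFunc K) M r⁻¹ ^ 2 := by
      rw [hδ, ← map_pow]; congr 1
      rw [inv_pow]; exact eq_inv_of_mul_eq_one_right hrq
    rcases sq_eq_sq_iff_eq_or_eq_neg.1 h1 with h1 | h1
    · exact hδ' ⟨_, h1.symm⟩
    · exact hδ' ⟨-r⁻¹, by rw [map_neg, h1]⟩
  · refine ⟨b₃, b₂, b₁, r / RatFunc.C d, h23.symm, h13.symm, h12.symm, ?_, div_ne_zero hr0 hd0, ?_⟩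
    · ext; simp only [Set.mem_insert_iff, Set.mem_singleton_iff]; tauto
    · rw [div_pow, div_mul_eq_mul_div, hrq, hSc, had, pointRatio]
      field_simp
  · refine ⟨b₁, b₂, b₃, r, h12, h13, h23, rfl, hr0, ?_⟩
    rw [hrq, pow_one, pow_zero, mul_one]
  · refine ⟨b₁, b₃, b₂, r * pointForm b₂ / (RatFunc.C d * pointForm b₃), h13, h12, h23.symm, ?_,
      div_ne_zero (mul_ne_zero hr0 hf2) (mul_ne_zero hd0 hf3), ?_⟩
    · ext; simp only [Set.mem_insert_iff, Set.mem_singleton_iff]; tauto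
    · have h1 : (r * pointForm b₂ / (RatFunc.C d * pointForm b₃)) ^ 2 * q =
          (pointForm b₂ / (RatFunc.C d * pointForm b₃)) ^ 2 * (r ^ 2 * q) := by ring
      rw [h1, hrq, hSc, had, hS, pointRatio, pointRatio]
      field_simp

end QuadraticSubextension

/-! ### Dihedral extensions with three branch points -/

section DihedralExtension

variable {k : Type*} [Field k]
  {F : Type*} [Field F] [Algebra (RatFunc k) F] [Algebra k F] [IsScalarTower k (RatFunc k) F]
  {K : Type*} [Field K] [Algebra k K] [Normal k K]
  {Ω : Type*} [Field Ω] [IsAlgClosed Ω] [Algebra k Ω] [Algebra (RatFunc k) Ω]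
  [Algebra F Ω] [IsScalarTower k F Ω] [IsScalarTower (RatFunc k) F Ω] [IsGalois F Ω]
  [Algebra K Ω] [IsScalarTower k K Ω] [Algebra (RatFunc K) Ω] [IsScalarTower K (RatFunc K) Ω]

/-- By regularity, the part of `F` inside `K(T)` is `k(T)`. -/
theorem mem_range_of_algebraMap_eq (hreg : algebraicClosure k F = ⊥)
    (hcomp : ∀ r : RatFunc k,
      algebraMap (RatFunc K) Ω (ratFuncMap k K r) = algebraMap (RatFunc k) Ω r)
    {f : F} {r : RatFunc K} (h : algebraMap F Ω f = algebraMap (RatFunc K) Ω r) :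
    f ∈ Set.range (algebraMap (RatFunc k) F) := by
  have hT : algebraMap F Ω (algebraMap (RatFunc k) F RatFunc.X) =
      algebraMap (RatFunc K) Ω RatFunc.X := by
    rw [← IsScalarTower.algebraMap_apply, ← hcomp, ratFuncMap_X]
  have haev : ∀ p : K[X], aeval (algebraMap F Ω (algebraMap (RatFunc k) F RatFunc.X)) p =
      algebraMap (RatFunc K) Ω (algebraMap K[X] (RatFunc K) p) := fun p ↦ by
    rw [hT, aeval_algebraMap_apply]
    congr 1
    rw [← RatFunc.algebraMap_X, aeval_algebraMap_apply, aeval_X_left_apply]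
  have hden : algebraMap K[X] (RatFunc K) r.denom ≠ 0 := by
    simpa using r.denom_ne_zero
  have h1 : f ∈ IntermediateField.adjoin k {algebraMap (RatFunc k) F RatFunc.X} := by
    refine mem_adjoin_simple_of_regular (Ω := Ω) hreg (P := r.num) (Q := r.denom) ?_ ?_
    · rw [haev]; simpa using r.denom_ne_zero
    · rw [haev, haev, h, ← map_mul]
      congr 1
      nth_rewrite 1 [← r.num_div_denom]
      exact div_mul_cancel₀ _ hden
  have h2 : IntermediateField.adjoin k {algebraMap (RatFunc k) F RatFunc.X} ≤
      (IsScalarTower.toAlgHom k (RatFunc k) F).fieldRange := by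
    rw [IntermediateField.adjoin_simple_le_iff]
    exact ⟨RatFunc.X, rfl⟩
  exact h2 h1

variable [CharZero k] [FiniteDimensional (RatFunc k) F] [IsGalois (RatFunc k) F]
  [IsAlgClosed K] [CharZero K] [IsScalarTower k (RatFunc k) Ω] [Normal (RatFunc k) Ω]
  [Normal (RatFunc K) Ω] {M : IntermediateField (RatFunc K) Ω}

/-- A dihedral extension of `k(T)` of odd degree over its quadratic subextension, with three
rational branch points, is geometrically generated by an element `y` which the automorphisms over
`k(T)` map to constant multiples of `y` or `1 / y`. -/
theorem hasLinearCoordinate_of_dihedralGroup (hreg : algebraicClosure k F = ⊥)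
    (hcomp : ∀ r : RatFunc k,
      algebraMap (RatFunc K) Ω (ratFuncMap k K r) = algebraMap (RatFunc k) Ω r)
    (hM : M = IntermediateField.adjoin (RatFunc K) (Set.range (algebraMap F Ω)))
    {n : ℕ} (hn : Odd n) (e : Gal(F/RatFunc k) ≃* DihedralGroup n)
    {b₁ b₂ b₃ : OnePoint K} (h12 : b₁ ≠ b₂) (h13 : b₁ ≠ b₃) (h23 : b₂ ≠ b₃)
    (hbranch : {t | IsRamifiedOver M t} = {b₁, b₂, b₃})
    (hrat : {t | IsRamifiedOver M t} ⊆ Set.range (OnePoint.map (algebraMap k K))) :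
    HasLinearCoordinate k F := by
  have := finiteDimensional_compositum hcomp hM
  have := isGalois_compositum hcomp hM
  obtain ⟨ρ, hρ, hρ'⟩ := exists_galois_hom_injective hcomp hM
  obtain ⟨ε, ⟨η, hη⟩, hconj, hkercyc, hkerodd⟩ := exists_sign_of_mulEquiv_dihedralGroup hn e
  have hchar : (2 : F) ≠ 0 := by
    have : CharZero F := charZero_of_injective_algebraMap (algebraMap k F).injective
    exact two_ne_zero
  obtain ⟨δ, hδ0, hδ⟩ := exists_apply_eq_sign_smul ε
  obtain ⟨q, hq⟩ : δ ^ 2 ∈ Set.range (algebraMap (RatFunc k) F) := by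
    rw [IsGalois.mem_range_algebraMap_iff_fixed]
    intro γ
    have hsq : ((ε γ : ℤ) : F) ^ 2 = 1 := by
      rw [← Int.cast_pow, ← Units.val_pow_eq_pow_val, Int.units_sq]; simp
    rw [map_pow, hδ, mul_pow, hsq, one_mul]
  let δ' : M := ⟨algebraMap F Ω δ, algebraMap_mem hM δ⟩
  have hδ'sq : δ' ^ 2 = algebraMap (RatFunc K) M (ratFuncMap k K q) := Subtype.ext (by
    change algebraMap F Ω δ ^ 2 = algebraMap (RatFunc K) Ω _
    rw [← map_pow, ← hq, hcomp, ← IsScalarTower.algebraMap_apply])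
  have hδ'K : δ' ∉ Set.range (algebraMap (RatFunc K) M) := by
    rintro ⟨r, hr⟩
    obtain ⟨r', hr'⟩ := mem_range_of_algebraMap_eq hreg hcomp
      (show algebraMap F Ω δ = algebraMap (RatFunc K) Ω r from (congrArg Subtype.val hr).symm)
    have h1 := hδ η
    rw [← hr', η.commutes, hη, hr'] at h1
    have h2 : 2 * δ = 0 := by
      push_cast at h1
      linear_combination h1
    exact (mul_ne_zero hchar hδ0) h2
  -- the quadratic subextension is `K(s)`, where `s ^ 2` is a coordinate defined over `k`
  obtain ⟨c₁, c₂, c₃, r, hc12, hc13, hc23, hset, hr0, hr⟩ :=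
    exists_sq_eq_pointRatio h12 h13 h23 hbranch hδ'sq hδ'K
  rw [hset] at hbranch
  rw [hbranch] at hrat
  set s : M := algebraMap (RatFunc K) M r * δ' with hs
  have hs2 : s ^ 2 = algebraMap (RatFunc K) M (pointRatio c₁ c₂) := by
    rw [hs, mul_pow, hδ'sq, ← map_pow, ← map_mul, hr]
  have hs0 : s ≠ 0 := by
    refine mul_ne_zero (by simpa using hr0) fun h0 ↦ hδ0 ?_
    exact (algebraMap F Ω).injective (by rw [map_zero]; exact congrArg Subtype.val h0)
  have hσs : ∀ σ : Gal(M/RatFunc K), σ s = s ↔ ε (ρ σ) = 1 := by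
    intro σ
    have h1 : σ s = ((ε (ρ σ) : ℤ) : M) * s := by
      have h2 : σ δ' = ((ε (ρ σ) : ℤ) : M) * δ' := by
        refine (hρ' σ δ).trans (Subtype.ext ?_)
        change algebraMap F Ω (ρ σ δ) = ((((ε (ρ σ) : ℤ) : M) * δ' : M) : Ω)
        rw [hδ, map_mul, map_intCast]
        push_cast
        rfl
      rw [hs, map_mul, h2, σ.commutes]; ring
    rw [h1, mul_eq_right₀ hs0]
    have : CharZero M := charZero_of_injective_algebraMap (algebraMap K M).injective
    rw [← Int.cast_one, Int.cast_inj, Units.val_eq_one]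
  have hε : ∀ γ, ε γ ≠ 1 → ε γ = -1 := fun γ hγ ↦ (Int.units_eq_one_or _).resolve_left hγ
  have hcoe : ∀ x : M, algebraMap M Ω x = x := fun _ ↦ rfl
  -- the value of the coordinate at the third branch point is an element of `k`
  obtain ⟨a₁, rfl⟩ := hrat (Or.inl rfl)
  obtain ⟨a₂, rfl⟩ := hrat (Or.inr (Or.inl rfl))
  obtain ⟨a₃, rfl⟩ := hrat (Or.inr (Or.inr rfl))
  obtain ⟨c, a, hc, -, hca⟩ := exists_pointForm_sub_eq_of_ne (b₁ := a₁) (b₂ := a₂) (b₃ := a₃)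
    (fun h ↦ hc12 (h ▸ rfl)) (fun h ↦ hc13 (h ▸ rfl)) (fun h ↦ hc23 (h ▸ rfl))
  have hcaK := congrArg (ratFuncMap k K) hca
  rw [map_sub, map_mul, map_mul, ratFuncMap_pointForm, ratFuncMap_pointForm, ratFuncMap_pointForm,
    ← RatFunc.algebraMap_eq_C, ratFuncMap_algebraMap, ratFuncMap_algebraMap,
    RatFunc.algebraMap_eq_C] at hcaK
  obtain ⟨β, j, y, hβ, hy, hytop⟩ := exists_pow_eq_of_dihedral (M := M) (s := s)
    (adjoin_pointRatio hc12) (transcendental_pointRatio hc12) (c := algebraMap k K c)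
    (by simpa using hc)
    (fun θ hθ hθc ↦ isUniformizable_pointRatio_of_three hc12 hc23 hbranch hcaK hθ hθc) hs2
    (fun R hR ↦ by
      let f : R →* ε.ker := (ρ.comp R.subtype).codRestrict _ fun σ ↦ (hσs σ).1 (hR σ σ.2)
      have hf : Function.Injective f := fun σ τ hστ ↦
        Subtype.ext (hρ (congrArg Subtype.val hστ))
      exact ⟨isCyclic_of_injective f hf, hkerodd.of_dvd_nat (Subgroup.card_dvd_of_injective f hf)⟩)
    (fun σ h hσ hh ↦ by
      apply hρ
      rw [map_mul, map_mul, map_inv, map_inv]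
      exact hconj _ _ ((hσs σ).1 hσ) (hε _ fun h1 ↦ hh ((hσs h).2 h1)))
    (by
      by_contra! hfix
      obtain ⟨x, hx⟩ := (IsGalois.mem_range_algebraMap_iff_fixed s).2 hfix
      refine hδ'K ⟨x / r, ?_⟩
      rw [map_div₀, hx, hs, mul_div_cancel_left₀]
      simpa using hr0)
  have hF : ∀ f : F, algebraMap F Ω f ∈ IntermediateField.adjoin K {(y : Ω)} := fun f ↦
    mem_adjoin_coe hytop (algebraMap_mem hM f)
  have hy0 : (y : Ω) ≠ 0 := fun h ↦
    transcendental_of_mem_adjoin (k := k) hF (h ▸ isAlgebraic_zero)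
  have hy' : (y : Ω) ^ (2 * j + 1) =
      ((s : Ω) - algebraMap K Ω β) / ((s : Ω) + algebraMap K Ω β) := congrArg Subtype.val hy
  refine hasLinearCoordinate_of_dihedral hreg j (coe_mem_adjoin hcomp hM y) hF fun φ ↦ ?_
  obtain ⟨τ, hτ⟩ := exists_constants_apply (K := K) φ
  have hφs : φ s = s ∨ φ s = -s := by
    have h1 : (s : Ω) ^ 2 = algebraMap (RatFunc K) Ω (pointRatio _ _) := congrArg Subtype.val hs2
    rw [← sq_eq_sq_iff_eq_or_eq_neg, ← map_pow, h1, apply_pointRatio hcomp φ hτ,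
      map_eq_self_of_mem_range τ ⟨_, rfl⟩, map_eq_self_of_mem_range τ ⟨_, rfl⟩]
  have hφβ : φ (algebraMap K Ω β) = algebraMap K Ω β ∨
      φ (algebraMap K Ω β) = -algebraMap K Ω β := by
    rw [← sq_eq_sq_iff_eq_or_eq_neg, ← map_pow, ← map_pow, hβ, hτ, τ.commutes]
  have hcases : φ y ^ (2 * j + 1) = (y : Ω) ^ (2 * j + 1) ∨
      φ y ^ (2 * j + 1) = (y : Ω)⁻¹ ^ (2 * j + 1) := by
    rw [← map_pow, inv_pow, hy', inv_div, map_div₀, map_sub, map_add]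
    rcases hφs with h1 | h1 <;> rcases hφβ with h2 | h2 <;> rw [h1, h2]
    · exact Or.inl rfl
    · right; congr 1 <;> ring
    · right; rw [← neg_div_neg_eq]; congr 1 <;> ring
    · left; rw [← neg_div_neg_eq]; congr 1 <;> ring
  rcases hcases with h | h
  · obtain ⟨c, hc, h3⟩ := exists_eq_smul_of_pow_eq (K := K) (by omega) hy0 h
    exact ⟨c, hc, Or.inl h3⟩
  · obtain ⟨c, hc, h3⟩ := exists_eq_smul_of_pow_eq (K := K) (by omega) (inv_ne_zero hy0) h
    exact ⟨c, hc, Or.inr h3⟩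

end DihedralExtension

/-! ### Linear coordinates from the branch points -/

section BranchPoints

theorem isAlgebraic_ratFuncMap (k K : Type*) [Field k] [Field K] [Algebra k K]
    [Algebra.IsAlgebraic k K] [Algebra (RatFunc k) (RatFunc K)]
    (h : algebraMap (RatFunc k) (RatFunc K) = ratFuncMap k K) :
    Algebra.IsAlgebraic (RatFunc k) (RatFunc K) := by
  have : IsScalarTower k (RatFunc k) (RatFunc K) := IsScalarTower.of_algebraMap_eq fun a ↦ by
    rw [h, ratFuncMap_algebraMap, ← IsScalarTower.algebraMap_apply]
  have hK : ∀ a : K, algebraMap K (RatFunc K) a ∈ algebraicClosure (RatFunc k) (RatFunc K) :=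
    fun a ↦ mem_algebraicClosure_iff.2
      (((Algebra.IsAlgebraic.isAlgebraic (R := k) a).algebraMap (A := RatFunc K)).tower_top _)
  let J : IntermediateField K (RatFunc K) :=
    { (algebraicClosure (RatFunc k) (RatFunc K)).toSubfield with algebraMap_mem' := hK }
  have hX : algebraMap (RatFunc K) (RatFunc K) RatFunc.X ∈ J := by
    change RatFunc.X ∈ algebraicClosure (RatFunc k) (RatFunc K)
    rw [← ratFuncMap_X (k := k), ← h]
    exact (algebraicClosure (RatFunc k) (RatFunc K)).algebraMap_mem _
  exact ⟨fun x ↦ mem_algebraicClosure_iff.1 (algebraMap_ratFunc_mem hX x)⟩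

theorem hasLinearCoordinate_of_branchPoints (k : Type*) [Field k] [CharZero k]
    (F : Type*) [Field F] [Algebra (RatFunc k) F] [Algebra k F] [IsScalarTower k (RatFunc k) F]
    [FiniteDimensional (RatFunc k) F] [IsGalois (RatFunc k) F]
    (hreg : algebraicClosure k F = ⊥)
    (hcases :
      (IsCyclic (F ≃ₐ[RatFunc k] F) ∧ (branchPoints k F).ncard = 2 ∧ BranchPointsRational k F) ∨
      (IsCyclic (F ≃ₐ[RatFunc k] F) ∧ Odd (Nat.card (F ≃ₐ[RatFunc k] F)) ∧
        (branchPoints k F).ncard = 2) ∨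
      ((∃ n : ℕ, Odd n ∧ Nonempty ((F ≃ₐ[RatFunc k] F) ≃* DihedralGroup n)) ∧
        (branchPoints k F).ncard = 3 ∧ BranchPointsRational k F)) :
    HasLinearCoordinate k F := by
  let K := AlgebraicClosure k
  let Ω := AlgebraicClosure (RatFunc K)
  obtain ⟨ι, hι, hM⟩ := exists_embedding_compositum k F K
  let _ : Algebra (RatFunc k) (RatFunc K) := (ratFuncMap k K).toAlgebra
  let _ : Algebra F Ω := ι.toAlgebra
  have hcomp : ∀ r : RatFunc k,
      algebraMap (RatFunc K) Ω (ratFuncMap k K r) = algebraMap (RatFunc k) Ω r := fun r ↦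
    (IsScalarTower.algebraMap_apply (RatFunc k) (RatFunc K) Ω r).symm
  have : IsScalarTower (RatFunc k) F Ω :=
    IsScalarTower.of_algebraMap_eq fun r ↦ (hcomp r).symm.trans (DFunLike.congr_fun hι r).symm
  have : IsScalarTower k K Ω := IsScalarTower.of_algebraMap_eq fun a ↦ by
    rw [IsScalarTower.algebraMap_apply k (RatFunc K) Ω,
      IsScalarTower.algebraMap_apply k K (RatFunc K),
      ← IsScalarTower.algebraMap_apply K (RatFunc K) Ω]
  have : IsScalarTower k (RatFunc k) Ω := IsScalarTower.of_algebraMap_eq fun a ↦ by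
    rw [← hcomp, ratFuncMap_algebraMap, ← IsScalarTower.algebraMap_apply K (RatFunc K) Ω,
      ← IsScalarTower.algebraMap_apply]
  have : IsScalarTower k F Ω := IsScalarTower.of_algebraMap_eq fun a ↦ by
    rw [IsScalarTower.algebraMap_apply k (RatFunc k) F,
      ← IsScalarTower.algebraMap_apply (RatFunc k),
      ← IsScalarTower.algebraMap_apply]
  have : Algebra.IsAlgebraic (RatFunc k) (RatFunc K) := isAlgebraic_ratFuncMap k K rfl
  have : Algebra.IsAlgebraic (RatFunc k) Ω := Algebra.IsAlgebraic.trans (RatFunc k) (RatFunc K) Ω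
  have : Algebra.IsAlgebraic F Ω := Algebra.IsAlgebraic.tower_top (K := RatFunc k) F
  have : CharZero K := charZero_of_injective_algebraMap (algebraMap k K).injective
  have : CharZero F := charZero_of_injective_algebraMap (algebraMap k F).injective
  have : IsAlgClosure (RatFunc k) Ω := ⟨inferInstance, inferInstance⟩
  have : IsAlgClosure F Ω := ⟨inferInstance, inferInstance⟩
  have : Normal k K := IsAlgClosure.normal k K
  have : Normal (RatFunc K) Ω := IsAlgClosure.normal (RatFunc K) Ω
  have : Normal (RatFunc k) Ω := IsAlgClosure.normal (RatFunc k) Ω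
  have : Normal F Ω := IsAlgClosure.normal F Ω
  have : IsGalois F Ω := ⟨⟩
  have hM' : compositum k F K =
      IntermediateField.adjoin (RatFunc K) (Set.range (algebraMap F Ω)) := hM
  rcases hcases with ⟨hcyc, hr, hrat⟩ | ⟨hcyc, hodd, hr⟩ | ⟨⟨n, hn, ⟨e⟩⟩, hr, hrat⟩
  · obtain ⟨b₁, b₂, hb, hset⟩ := Set.ncard_eq_two.1 hr
    exact hasLinearCoordinate_of_isCyclic_of_rational hreg hcomp hM' hcyc hb hset hrat
  · obtain ⟨b₁, b₂, hb, hset⟩ := Set.ncard_eq_two.1 hr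
    exact hasLinearCoordinate_of_isCyclic_of_odd hreg hcomp hM' hcyc hodd hb hset
  · obtain ⟨b₁, b₂, b₃, h12, h13, h23, hset⟩ := Set.ncard_eq_three.1 hr
    exact hasLinearCoordinate_of_dihedralGroup hreg hcomp hM' hn e h12 h13 h23 hset hrat

end BranchPoints

end RegExt

theorem mainTheorem8 (k : Type u₁) [Field k] [CharZero k]
    (F : Type u₂) [Field F] [Algebra (RatFunc k) F] [Algebra k F] [IsScalarTower k (RatFunc k) F]
    [FiniteDimensional (RatFunc k) F] [IsGalois (RatFunc k) F]
    -- `F / k(T)` is `k`-regular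
    (hreg : algebraicClosure k F = ⊥)
    (hcases :
      (IsCyclic (F ≃ₐ[RatFunc k] F) ∧ Even (Nat.card (F ≃ₐ[RatFunc k] F)) ∧
        (RegExt.branchPoints k F).ncard = 2 ∧ RegExt.BranchPointsRational k F) ∨
      (IsCyclic (F ≃ₐ[RatFunc k] F) ∧ Odd (Nat.card (F ≃ₐ[RatFunc k] F)) ∧
        (RegExt.branchPoints k F).ncard = 2) ∨
      ((∃ n : ℕ, 1 < n ∧ Odd n ∧ Nonempty ((F ≃ₐ[RatFunc k] F) ≃* DihedralGroup n)) ∧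
        (RegExt.branchPoints k F).ncard = 3 ∧ RegExt.BranchPointsRational k F)) :
    RegExt.IsGeneric.{v, w} k F ∧
    ∀ (L : Type v) [Field L] [Algebra k L]
      (E : Type w) [Field E] [Algebra L E] [FiniteDimensional L E] [IsGalois L E],
      (∃ f : (E ≃ₐ[L] E) →* (F ≃ₐ[RatFunc k] F), Function.Injective f) →
        {t₀ : OnePoint L |
          RegExt.IsSpecializationAt (RegExt.compositum k F L) t₀ E}.Infinite := by
  have hcoord : RegExt.HasLinearCoordinate k F :=
    RegExt.hasLinearCoordinate_of_branchPoints k F hreg <| by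
      rcases hcases with ⟨hcyc, -, hr, hrat⟩ | h | ⟨⟨n, -, hn, he⟩, hr, hrat⟩
      · exact Or.inl ⟨hcyc, hr, hrat⟩
      · exact Or.inr (Or.inl h)
      · exact Or.inr (Or.inr ⟨⟨n, hn, he⟩, hr, hrat⟩)
  refine ⟨fun L _ _ E _ _ _ _ ⟨f⟩ ↦ ?_, fun L _ _ E _ _ _ _ ⟨f, hf⟩ ↦
    hcoord.infinite_specializations L E f hf⟩
  exact (hcoord.infinite_specializations L E f.toMonoidHom f.injective).nonempty
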